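/- Let $k$ be a field and $G$ a finite group whose order is invertible in $k$. Let $\mathcal D$ be a $k$-linear triangulated category with arbitrary (set-indexed) direct sums, such that $\bigoplus_{n\in\mathbb Z}\mathrm{Hom}(X,Y[n])$ is a finite-dimensional vector space for all compact objects $X,Y$ of $\mathcal D$. Let $G$ act on $\mathcal D$, i.e. there are $k$-linear autoequivalences $g_*\colon\mathcal D\to\mathcal D$ ($g\in G$) and isomorphisms $\varepsilon_{g,h}\colon g_*h_*\cong (gh)_*$ satisfying the associativity condition. (In particular, this covers a dg-enhanced $\mathcal D$ with an action that lifts to the enhancement.) For a subgroup $H\le G$, let $\mathcal D^H$ be the category of pairs $(X,\lambda)$ of an object $X$ of $\mathcal D$ and an $H$-linearisation, i.e. isomorphisms $\lambda_g\colon X\cong g_*X$, $g\in H$, with $\varepsilon_{g,h}\circ g_*\lambda_h\circ\lambda_g=\lambda_{gh}$; the morphisms $(X,\lambda)\to(Y,\mu)$ are the morphisms $\varphi\colon X\to Y$ with $\mu_g^{-1}\circ g_*\varphi\circ\lambda_g=\varphi$ for all $g\in H$. Let $$(E_{1,1},\dots,E_{1,\ell_1},\;E_{2,1},\dots,E_{2,\ell_2},\;\dots,\;E_{n,1},\dots,E_{n,\ell_n})$$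 (all $\ell_i\ge 1$) be a full strong exceptional sequence in $\mathcal D$: all members $E$ are compact with $\mathrm{End}(E)=k\cdot\mathrm{id}_E\neq 0$ and $\mathrm{Hom}(E,E[m])=0$ for $m\ne0$; if $E$ stands after $E'$ in the sequence, then $\mathrm{Hom}(E,E'[m])=0$ for all $m$, and $\mathrm{Hom}(E',E[m])=0$ for all $m\neq0$; and the direct sum $\mathbb E$ of all members is a compact generator, i.e. it is compact and an object $Y$ with $\mathrm{Hom}(\mathbb E,Y[m])=0$ for all $m$ is zero. For every $i$ let $G$ act transitively on $\{1,\dots,\ell_i\}$ such that $g_*E_{i,j}\cong E_{i,g(j)}$ for all $g\in G$ and all $j$, let $H_i=\mathrm{Stab}_G(1)$ for this action, and let $\mathcal E_i\in\mathcal D^{H_i}$ be an object with underlying object $E_{i,1}$. For $\rho\in\mathrm{irr}(H_i)$ (the isomorphism classes of irreducible finite-dimensional representations of $H_i$ over $k$), put $F_{i,\rho}=\mathrm{Ind}_{H_i}^G(\rho\otimes_k\mathcal E_i)\in\mathcal D^G$, and let $\mathbb F=\bigoplus_{i=1}^n\bigoplus_{\rho\in\mathrm{irr}(H_i)}F_{i,\rho}$.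 Here $\rho\otimes_k(X,\lambda)$ is $X^{\oplus\dim\rho}$ with the linearisation $\rho_g\otimes\lambda_g$, and $\mathrm{Ind}_H^G(X,\lambda)=\bigoplus_{[g]\in G/H}g_*X$ with the linearisation given by $\lambda$ and the isomorphisms $\varepsilon_{g,h}$. Then $\mathbb E$ admits a $G$-linearisation, and for every $G$-linearisation $\lambda$ of $\mathbb E$ we have an isomorphism of $k$-algebras $$\mathrm{End}_{\mathcal D^G}(\mathbb F)\;\cong\;\bigl(G\ltimes\mathrm{End}_{\mathcal D}(\mathbb E)\bigr)^b .$$ Here $G$ acts on $\mathrm{End}_{\mathcal D}(\mathbb E)$ from the right by $\varphi^g=\lambda_{g^{-1}}^{-1}\circ (g^{-1})_*\varphi\circ\lambda_{g^{-1}}$, and $G\ltimes A$ denotes the skew group algebra, i.e. the vector space spanned by pairs $(g,a)$, linear in $a\in A$ for each $g\in G$, with $(g,a)(h,b)=(gh,a^hb)$. The basic reduction $S^b$ of a finite-dimensional $k$-algebra $S$ is the basic $k$-algebra whose category of right modules is $k$-linearly equivalent to that of $S$; a finite-dimensional algebra $B$ is basic if the indecomposable summands in a Krull–Remak–Schmidt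 decomposition of $B$ as a right module over itself are pairwise non-isomorphic. Explicitly: $\mathrm{End}_{\mathcal D^G}(\mathbb F)$ is basic and Morita equivalent over $k$ to $G\ltimes\mathrm{End}_{\mathcal D}(\mathbb E)$, and every basic $k$-algebra that is Morita equivalent over $k$ to $G\ltimes\mathrm{End}_{\mathcal D}(\mathbb E)$ is isomorphic to $\mathrm{End}_{\mathcal D^G}(\mathbb F)$. -/

import Mathlib

open CategoryTheory CategoryTheory.Limits

universe w v u uG uD uJ

-- Elaborate `X ⟶ Y` through the category structure rather than through reflexive quivers.
attribute [-instance] CategoryTheory.catToReflQuiver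

noncomputable section

namespace EquivariantEC

/-! ### Compact objects, generators, exceptional sequences -/

section Triangulated

variable {D : Type uD} [Category.{v} D] [Preadditive D]

/-- An object `X` is compact if `Hom(X, -)` commutes with all direct sums indexed by sets
of the universe `w`. -/
def IsCompactObject (X : D) : Prop :=
  ∀ J : Type w, PreservesColimitsOfShape (Discrete J) (preadditiveCoyoneda.obj (Opposite.op X))

variable [HasShift D ℤ]

/-- `Hom^*(X, Y) = 0`, where `Hom^*(X, Y) = ⨁ n, Hom(X, Y[n])`. -/
def GradedHomVanishes (X Y : D) : Prop :=
  ∀ (n : ℤ) (f : X ⟶ (shiftFunctor D n).obj Y), f = 0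

/-- `Hom^*(X, Y)` is concentrated in degree zero. -/
def GradedHomInDegreeZero (X Y : D) : Prop :=
  ∀ n : ℤ, n ≠ 0 → ∀ f : X ⟶ (shiftFunctor D n).obj Y, f = 0

/-- A compact generator: a compact object `X` such that `Hom^*(X, Y) = 0` only for `Y ≅ 0`. -/
structure IsCompactGenerator (X : D) : Prop where
  compact : IsCompactObject.{w} X
  generates : ∀ Y : D, GradedHomVanishes X Y → IsZero Y

variable (k : Type u) [Field k] [Linear k D]

/-- The subcategory of compact objects is Hom-finite: the total space `⨁ n, Hom(X, Y[n])` is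
finite-dimensional for all compact `X` and `Y`. -/
def CompactsHomFinite (D : Type uD) [Category.{v} D] [Preadditive D] [HasShift D ℤ]
    [Linear k D] : Prop :=
  ∀ X Y : D, IsCompactObject.{w} X → IsCompactObject.{w} Y →
    FiniteDimensional k (DirectSum ℤ fun n => X ⟶ (shiftFunctor D n).obj Y)

/-- An exceptional object: compact, `End^*` concentrated in degree zero, and
`End(X) = k · id` (one-dimensional, so `X` is nonzero). -/
structure IsExceptional (X : D) : Prop where
  compact : IsCompactObject.{w} X
  degreeZero : GradedHomInDegreeZero X X
  endo : Function.Bijective fun c : k => c • 𝟙 X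

/-- An exceptional sequence, indexed by a linearly ordered set. -/
structure IsExceptionalSequence {ι : Type*} [LinearOrder ι] (E : ι → D) : Prop where
  exceptional : ∀ i, IsExceptional.{w} k (E i)
  semiorthogonal : ∀ i j, j < i → GradedHomVanishes (E i) (E j)

/-- Strongness of a sequence. -/
def IsStrongSequence {ι : Type*} [LinearOrder ι] (E : ι → D) : Prop :=
  ∀ i j, i < j → GradedHomInDegreeZero (E i) (E j)

/-- Fullness of a (finite) sequence: the direct sum of its members is a compact generator. -/
def IsFullSequence [HasFiniteBiproducts D] {ι : Type*} [Finite ι] (E : ι → D) : Prop :=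
  IsCompactGenerator.{w} (biproduct E)

end Triangulated

/-! ### Group actions on linear categories and linearisations -/

/-- A (left) action of a group on a `k`-linear category by `k`-linear autoequivalences `g_*`,
with isomorphisms `ε_{g,h} : g_* ∘ h_* ≅ (gh)_*` satisfying the associativity condition. -/
structure CatAction (k : Type u) [Field k] (G : Type uG) [Group G]
    (C : Type uD) [Category.{v} C] [Preadditive C] [Linear k C] where
  /-- the functor `g_*` -/
  act : G → C ⥤ C
  isEquivalence : ∀ g, (act g).IsEquivalence
  additive : ∀ g, (act g).Additive
  linear : ∀ g, (act g).Linear k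
  /-- the isomorphism `ε_{g,h}` -/
  eps : ∀ g h : G, act h ⋙ act g ≅ act (g * h)
  eps_assoc : ∀ (g h l : G) (X : C),
    (eps g h).hom.app ((act l).obj X) ≫ (eps (g * h) l).hom.app X ≫
        eqToHom (by rw [mul_assoc]) =
      (act g).map ((eps h l).hom.app X) ≫ (eps g (h * l)).hom.app X

attribute [instance] CatAction.isEquivalence CatAction.additive CatAction.linear

namespace CatAction

variable {k : Type u} [Field k] {G : Type uG} [Group G]
  {C : Type uD} [Category.{v} C] [Preadditive C] [Linear k C]

/-- The restriction of an action to a subgroup. -/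
def restrict (A : CatAction k G C) (H : Subgroup G) : CatAction k H C where
  act h := A.act h
  isEquivalence h := A.isEquivalence h
  additive h := A.additive h
  linear h := A.linear h
  eps g h := A.eps g h
  eps_assoc g h l X := A.eps_assoc g h l X

variable (A : CatAction k G C)

lemma eps_naturality (g h : G) {X Y : C} (f : X ⟶ Y) :
    (A.act g).map ((A.act h).map f) ≫ (A.eps g h).hom.app Y =
      (A.eps g h).hom.app X ≫ (A.act (g * h)).map f :=
  (A.eps g h).hom.naturality f

lemma eps_naturality_assoc (g h : G) {X Y Z : C} (f : X ⟶ Y) (t : (A.act (g * h)).obj Y ⟶ Z) :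
    (A.act g).map ((A.act h).map f) ≫ (A.eps g h).hom.app Y ≫ t =
      (A.eps g h).hom.app X ≫ (A.act (g * h)).map f ≫ t := by
  rw [← Category.assoc, eps_naturality, Category.assoc]

/-- `ε_{g,h}` followed by the identification `(gh)_* = l_*` for `l = gh`. -/
def epsEq {g h l : G} (e : g * h = l) (X : C) :
    (A.act g).obj ((A.act h).obj X) ⟶ (A.act l).obj X :=
  (A.eps g h).hom.app X ≫ eqToHom (by rw [e])

lemma epsEq_rfl (g h : G) (X : C) : A.epsEq (rfl : g * h = g * h) X = (A.eps g h).hom.app X := by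
  simp [epsEq]

instance {g h l : G} (e : g * h = l) (X : C) : IsIso (A.epsEq e X) := by
  subst e
  rw [epsEq_rfl]
  infer_instance

lemma epsEq_naturality {g h l : G} (e : g * h = l) {X Y : C} (f : X ⟶ Y) :
    (A.act g).map ((A.act h).map f) ≫ A.epsEq e Y = A.epsEq e X ≫ (A.act l).map f := by
  subst e
  simp only [epsEq_rfl]
  exact A.eps_naturality g h f

lemma epsEq_assoc {g h l a b m : G} (e₁ : g * h = a) (e₂ : a * l = m) (e₃ : h * l = b)
    (e₄ : g * b = m) (X : C) :
    A.epsEq e₁ ((A.act l).obj X) ≫ A.epsEq e₂ X =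
      (A.act g).map (A.epsEq e₃ X) ≫ A.epsEq e₄ X := by
  subst e₁ e₃ e₄
  have h1 := A.eps_assoc g h l X
  rw [epsEq_rfl, epsEq_rfl, epsEq_rfl, ← h1]
  rfl

lemma transition_comp {d x b u y c w : G} (eu : d * u = x * b) (ew : b * w = y * c)
    (euw : d * (u * w) = x * y * c) (X : C) (lu : X ⟶ (A.act u).obj X)
    (lw : X ⟶ (A.act w).obj X) (luw : X ⟶ (A.act (u * w)).obj X)
    (hl : lu ≫ (A.act u).map lw ≫ (A.eps u w).hom.app X = luw) :
    ((A.act d).map lu ≫ A.epsEq eu X ≫ (A.eps x b).inv.app X) ≫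
      (A.act x).map ((A.act b).map lw ≫ A.epsEq ew X ≫ (A.eps y c).inv.app X) ≫
        (A.eps x y).hom.app ((A.act c).obj X) =
      (A.act d).map luw ≫ A.epsEq euw X ≫ (A.eps (x * y) c).inv.app X := by
  have e1 : x * (y * c) = x * y * c := (mul_assoc _ _ _).symm
  have e2 : x * b * w = x * y * c := by rw [mul_assoc, ew, e1]
  have P1 := A.epsEq_assoc (rfl : x * y = x * y) (rfl : x * y * c = x * y * c) rfl e1 X
  have P2 := A.epsEq_assoc (rfl : x * b = x * b) e2 ew e1 X
  have P3 := A.eps_naturality x b lw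
  have P4 := A.epsEq_naturality eu lw
  have P5 := A.epsEq_assoc eu e2 rfl euw X
  simp only [epsEq_rfl] at P1 P2 P5
  have h1 : (A.eps (x * y) c).inv.app X ≫ (A.eps (x * y) c).hom.app X = 𝟙 _ :=
    (A.eps (x * y) c).inv_hom_id_app X
  have h2 : (A.eps y c).inv.app X ≫ (A.eps y c).hom.app X = 𝟙 _ :=
    (A.eps y c).inv_hom_id_app X
  have h3 : (A.eps x b).inv.app X ≫ (A.eps x b).hom.app X = 𝟙 _ :=
    (A.eps x b).inv_hom_id_app X
  have hI : IsIso ((A.eps (x * y) c).hom.app X) := inferInstance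
  refine (@cancel_mono _ _ _ _ _ ((A.eps (x * y) c).hom.app X)
    (@IsIso.mono_of_iso _ _ _ _ _ hI) _ _).1 ?_
  calc _ = (A.act d).map lu ≫ A.epsEq eu X ≫ (A.eps x b).inv.app X ≫
        (A.act x).map ((A.act b).map lw) ≫ (A.act x).map (A.epsEq ew X) ≫
        (A.act x).map ((A.eps y c).inv.app X) ≫
        ((A.eps x y).hom.app ((A.act c).obj X) ≫ (A.eps (x * y) c).hom.app X) := by
        simp only [Functor.map_comp, Category.assoc]
    _ = (A.act d).map lu ≫ A.epsEq eu X ≫ (A.eps x b).inv.app X ≫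
        (A.act x).map ((A.act b).map lw) ≫ (A.act x).map (A.epsEq ew X) ≫ A.epsEq e1 X := by
        have h2x : (A.act x).map ((A.eps y c).inv.app X) ≫
            (A.act x).map ((A.eps y c).hom.app X) = 𝟙 _ := by
          rw [← Functor.map_comp, h2, CategoryTheory.Functor.map_id]
        rw [P1, reassoc_of% h2x]
    _ = (A.act d).map lu ≫ A.epsEq eu X ≫ (A.eps x b).inv.app X ≫
        ((A.act x).map ((A.act b).map lw) ≫ (A.eps x b).hom.app _) ≫ A.epsEq e2 X := by
        rw [← P2]
        simp only [Category.assoc]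
    _ = (A.act d).map lu ≫ (A.epsEq eu X ≫ (A.act (x * b)).map lw) ≫ A.epsEq e2 X := by
        rw [P3]
        simp only [Category.assoc]
        rw [reassoc_of% h3]
    _ = (A.act d).map (lu ≫ (A.act u).map lw ≫ (A.eps u w).hom.app X) ≫ A.epsEq euw X := by
        rw [← P4, Category.assoc, P5]
        simp only [Functor.map_comp, Category.assoc]
    _ = _ := by
        rw [hl, Category.assoc, Category.assoc, h1]
        simp

/-- A `G`-linearisation of `X`: isomorphisms `λ_g : X ≅ g_* X` with
`ε_{g,h} ∘ g_* λ_h ∘ λ_g = λ_{gh}`. -/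
structure Linearisation (X : C) where
  /-- the isomorphism `λ_g` -/
  iso : ∀ g : G, X ≅ (A.act g).obj X
  comp : ∀ g h : G,
    (iso g).hom ≫ (A.act g).map (iso h).hom ≫ (A.eps g h).hom.app X = (iso (g * h)).hom

namespace Linearisation

variable {A}

/-- A family satisfying the cocycle condition is a linearisation as soon as `λ_1` is invertible. -/
lemma isIso_of_one {X : C} (l : ∀ g : G, X ⟶ (A.act g).obj X)
    (hl : ∀ g h : G, l g ≫ (A.act g).map (l h) ≫ (A.eps g h).hom.app X = l (g * h))
    (h1 : IsIso (l 1)) (g : G) : IsIso (l g) := by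
  have hall : ∀ g, l (g * g⁻¹) = l g ≫ (A.act g).map (l g⁻¹) ≫ (A.eps g g⁻¹).hom.app X :=
    fun g => (hl g g⁻¹).symm
  have hiso : ∀ g : G, IsIso (l (g * g⁻¹)) := by
    intro g
    have : ∀ a : G, a = 1 → IsIso (l a) := by
      rintro a rfl
      exact h1
    exact this _ (mul_inv_cancel g)
  -- every `l g` is a split monomorphism, and every `g_* (l g⁻¹)` is a split epimorphism
  have hmono : ∀ g, Mono (l g) := by
    intro g
    have := hiso g
    rw [hall g] at this
    exact mono_of_mono (l g) ((A.act g).map (l g⁻¹) ≫ (A.eps g g⁻¹).hom.app X)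
  have hI : IsIso ((A.act g).map (l g⁻¹)) := by
    have h2 := hiso g
    rw [hall g] at h2
    have h3 : IsIso ((l g ≫ (A.act g).map (l g⁻¹)) ≫ (A.eps g g⁻¹).hom.app X) := by
      rwa [Category.assoc]
    have h4 : IsIso (l g ≫ (A.act g).map (l g⁻¹)) :=
      IsIso.of_isIso_comp_right _ ((A.eps g g⁻¹).hom.app X)
    have h5 : IsSplitEpi ((A.act g).map (l g⁻¹)) :=
      ⟨⟨⟨inv (l g ≫ (A.act g).map (l g⁻¹)) ≫ l g, by simp⟩⟩⟩
    have := hmono g⁻¹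
    have h6 : Mono ((A.act g).map (l g⁻¹)) := inferInstance
    exact isIso_of_mono_of_isSplitEpi _
  have h2 := hiso g
  rw [hall g] at h2
  exact IsIso.of_isIso_comp_right (l g) ((A.act g).map (l g⁻¹) ≫ (A.eps g g⁻¹).hom.app X)

/-- Constructor for linearisations, see `isIso_of_one`. -/
def ofHom {X : C} (l : ∀ g : G, X ⟶ (A.act g).obj X)
    (hl : ∀ g h : G, l g ≫ (A.act g).map (l h) ≫ (A.eps g h).hom.app X = l (g * h))
    (h1 : IsIso (l 1)) : A.Linearisation X where
  iso g := @asIso _ _ _ _ (l g) (isIso_of_one l hl h1 g)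
  comp g h := hl g h

variable {X Y Z : C} (lX : A.Linearisation X) (lY : A.Linearisation Y) (lZ : A.Linearisation Z)

/-- The left action of `G` on `Hom(X, Y)` by conjugation with the linearisations:
`φ ↦ μ_g⁻¹ ∘ g_* φ ∘ λ_g`. -/
def conj (g : G) (f : X ⟶ Y) : X ⟶ Y :=
  (lX.iso g).hom ≫ (A.act g).map f ≫ (lY.iso g).inv

lemma conj_comp (g : G) (f : X ⟶ Y) (f' : Y ⟶ Z) :
    lX.conj lZ g (f ≫ f') = lX.conj lY g f ≫ lY.conj lZ g f' := by
  simp [conj]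

lemma conj_mul (g h : G) (f : X ⟶ Y) :
    lX.conj lY (g * h) f = lX.conj lY g (lX.conj lY h f) := by
  have hY := lY.comp g h
  have hX := lX.comp g h
  unfold conj
  rw [← Category.assoc, Iso.comp_inv_eq, ← hX, ← hY]
  simp only [Functor.map_comp, Category.assoc, Iso.inv_hom_id_assoc, ← A.eps_naturality]
  rw [← Functor.map_comp_assoc (A.act g) (lY.iso h).inv]
  simp

lemma conj_injective (g : G) : Function.Injective (lX.conj lY g) := by
  intro f f' hf
  unfold conj at hf
  rw [cancel_epi, cancel_mono] at hf
  exact (A.act g).map_injective hf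

lemma conj_one (f : X ⟶ Y) : lX.conj lY 1 f = f := by
  apply lX.conj_injective lY 1
  rw [← conj_mul, mul_one]

lemma conj_add (g : G) (f f' : X ⟶ Y) :
    lX.conj lY g (f + f') = lX.conj lY g f + lX.conj lY g f' := by
  simp [conj]

lemma conj_smul (g : G) (c : k) (f : X ⟶ Y) :
    lX.conj lY g (c • f) = c • lX.conj lY g f := by
  simp [conj, Functor.map_smul]

lemma conj_id (g : G) : lX.conj lX g (𝟙 X) = 𝟙 X := by
  simp [conj]

/-- The `G`-invariant morphisms. -/
def invariants : Submodule k (X ⟶ Y) where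
  carrier := {f | ∀ g, lX.conj lY g f = f}
  add_mem' {a b} ha hb g := by rw [conj_add, ha g, hb g]
  zero_mem' g := by simp [conj]
  smul_mem' c f hf g := by rw [conj_smul, hf g]

lemma mem_invariants_iff (f : X ⟶ Y) : f ∈ lX.invariants lY ↔
    ∀ g, (lX.iso g).hom ≫ (A.act g).map f = f ≫ (lY.iso g).hom := by
  refine forall_congr' fun g => ?_
  unfold conj
  rw [← Category.assoc, Iso.comp_inv_eq]

/-- Conjugation by the linearisation as a `k`-algebra endomorphism of `End(X)`. -/
def conjAlgHom (g : G) : End X →ₐ[k] End X :=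
  AlgHom.ofLinearMap
    { toFun := fun f => lX.conj lX g f
      map_add' := fun f f' => lX.conj_add lX g f f'
      map_smul' := fun c f => lX.conj_smul lX g c f }
    (lX.conj_id g) (fun f f' => lX.conj_comp lX lX g f' f)

/-- The right action `φ ^ g = μ_{g⁻¹}⁻¹ ∘ (g⁻¹)_* φ ∘ λ_{g⁻¹}` of `G` on the algebra `End(X)`
of an object with a linearisation. -/
def endAction : Gᵐᵒᵖ →* (End X →ₐ[k] End X) where
  toFun g := lX.conjAlgHom (g.unop)⁻¹
  map_one' := by
    ext f
    change lX.conj lX (1 : G)⁻¹ f = f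
    rw [inv_one, conj_one]
  map_mul' g h := by
    ext f
    change lX.conj lX (h.unop * g.unop)⁻¹ f = lX.conj lX _ (lX.conj lX _ f)
    rw [mul_inv_rev, conj_mul]

end Linearisation

/-! ### The equivariant category -/

/-- Objects of the equivariant category `C^G`: pairs of an object and a linearisation. -/
structure EquivObj where
  /-- the underlying object -/
  obj : C
  /-- the linearisation -/
  lin : A.Linearisation obj

namespace EquivObj

variable {A}

/-- Morphisms of the equivariant category are the invariant morphisms. -/
instance : Category.{v} A.EquivObj where
  Hom X Y := X.lin.invariants Y.lin
  id X := ⟨𝟙 X.obj, fun g => X.lin.conj_id g⟩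
  comp {X Y Z} f f' := ⟨f.1 ≫ f'.1, fun g => by
    rw [X.lin.conj_comp Y.lin Z.lin, f.2 g, f'.2 g]⟩
  id_comp _ := Subtype.ext (Category.id_comp _)
  comp_id _ := Subtype.ext (Category.comp_id _)
  assoc _ _ _ := Subtype.ext (Category.assoc _ _ _)

instance : Preadditive A.EquivObj where
  homGroup X Y := inferInstanceAs (AddCommGroup (X.lin.invariants Y.lin))
  add_comp _ _ _ _ _ _ := Subtype.ext (Preadditive.add_comp _ _ _ _ _ _)
  comp_add _ _ _ _ _ _ := Subtype.ext (Preadditive.comp_add _ _ _ _ _ _)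

instance : Linear k A.EquivObj where
  homModule X Y := inferInstanceAs (Module k (X.lin.invariants Y.lin))
  smul_comp _ _ _ _ _ _ := Subtype.ext (Linear.smul_comp _ _ _ _ _ _)
  comp_smul _ _ _ _ _ _ := Subtype.ext (Linear.comp_smul _ _ _ _ _ _)

variable (A) in
/-- The functor forgetting the linearisation. -/
def forget : A.EquivObj ⥤ C where
  obj X := X.obj
  map f := f.1

instance : (forget A).Additive where

instance : (forget A).Faithful where
  map_injective h := Subtype.ext h

end EquivObj

/-! ### Linearisations on direct sums -/

/-- Additive functors preserve finite direct sums (with index sets in any universe). -/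
instance preservesBiproduct_act (A : CatAction k G C) {ι : Type*} [Finite ι] (X : ι → C) (g : G) :
    PreservesBiproduct X (A.act g) :=
  let ⟨_⟩ := nonempty_fintype ι
  { preserves := fun {b} hb =>
      ⟨isBilimitOfTotal _ (by
        have h := congrArg (A.act g).map (IsBilimit.total hb)
        rw [Functor.map_sum, CategoryTheory.Functor.map_id] at h
        simp only [Functor.map_comp] at h
        exact h)⟩ }

section Matrix

variable [HasFiniteBiproducts C] {ι : Type*} [Fintype ι] (X : ι → C)

/-- The morphism `⨁ X ⟶ g_* (⨁ X)` with components `m d c : X d ⟶ g_* (X c)`. -/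
def matrixHom (g : G) (m : ∀ d c, X d ⟶ (A.act g).obj (X c)) :
    biproduct X ⟶ (A.act g).obj (biproduct X) :=
  ∑ d, ∑ c, biproduct.π X d ≫ m d c ≫ (A.act g).map (biproduct.ι X c)

lemma ι_matrixHom (g : G) (m : ∀ d c, X d ⟶ (A.act g).obj (X c)) (d : ι) :
    biproduct.ι X d ≫ A.matrixHom X g m = ∑ c, m d c ≫ (A.act g).map (biproduct.ι X c) := by
  classical
  unfold matrixHom
  rw [Preadditive.comp_sum, Finset.sum_eq_single d]
  · simp [Preadditive.comp_sum]
  · intro b _ hb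
    simp only [Preadditive.comp_sum]
    exact Finset.sum_eq_zero fun c _ => by
      rw [biproduct.ι_π_ne_assoc _ (Ne.symm hb), zero_comp]
  · simp

lemma ι_matrixHom_assoc (g : G) (m : ∀ d c, X d ⟶ (A.act g).obj (X c)) (d : ι) {Z : C}
    (t : (A.act g).obj (biproduct X) ⟶ Z) :
    biproduct.ι X d ≫ A.matrixHom X g m ≫ t =
      (∑ c, m d c ≫ (A.act g).map (biproduct.ι X c)) ≫ t := by
  rw [← Category.assoc, ι_matrixHom]

variable {X} {A}

/-- A linearisation of `⨁ X` from a matrix `m g d c : X d ⟶ g_* (X c)`. -/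
def linearisationOfMatrix (m : ∀ (g : G) (d c), X d ⟶ (A.act g).obj (X c))
    (hm : ∀ (g h : G) (d c), ∑ b, m g d b ≫ (A.act g).map (m h b c) ≫
      (A.eps g h).hom.app (X c) = m (g * h) d c)
    (hone : ∀ d c, d ≠ c → m 1 d c = 0) (hiso : ∀ c, IsIso (m 1 c c)) :
    A.Linearisation (biproduct X) :=
  Linearisation.ofHom (fun g => A.matrixHom X g (m g))
    (fun g h => by
      ext d
      rw [ι_matrixHom_assoc, ι_matrixHom, Preadditive.sum_comp]
      simp only [Category.assoc, ← Functor.map_comp_assoc, ι_matrixHom, Functor.map_sum,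
        Preadditive.sum_comp, Preadditive.comp_sum]
      rw [Finset.sum_comm]
      refine Finset.sum_congr rfl fun c _ => ?_
      rw [← hm, Preadditive.sum_comp]
      refine Finset.sum_congr rfl fun b _ => ?_
      simp only [Functor.map_comp, Category.assoc, eps_naturality])
    (by
      have h : A.matrixHom X 1 (m 1) =
          biproduct.map (fun c => m 1 c c) ≫ ((A.act 1).mapBiproduct X).inv := by
        ext d
        rw [ι_matrixHom, biproduct.ι_map_assoc, Functor.mapBiproduct_inv, biproduct.ι_desc]
        exact Finset.sum_eq_single d (fun c _ hc => by rw [hone d c (Ne.symm hc), zero_comp])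
          (by simp)
      have : IsIso (biproduct.map (fun c => m 1 c c)) :=
        (biproduct.mapIso fun c => asIso (m 1 c c)).isIso_hom
      rw [h]
      infer_instance)

end Matrix

namespace EquivObj

variable {A} [HasFiniteBiproducts C] {ι : Type*} [Finite ι]

/-- The direct sum of the isomorphisms `λ_g`. -/
def directSumIso (F : ι → A.EquivObj) (g : G) :
    (biproduct fun i => (F i).obj) ≅ (A.act g).obj (biproduct fun i => (F i).obj) :=
  (biproduct.mapIso fun i => (F i).lin.iso g) ≪≫
    ((A.act g).mapBiproduct fun i => (F i).obj).symm

lemma ι_directSumIso (F : ι → A.EquivObj) (g : G) (i : ι) :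
    biproduct.ι (fun i => (F i).obj) i ≫ (directSumIso F g).hom =
      ((F i).lin.iso g).hom ≫ (A.act g).map (biproduct.ι (fun i => (F i).obj) i) := by
  unfold directSumIso
  rw [Iso.trans_hom, Iso.symm_hom, biproduct.mapIso_hom, biproduct.ι_map_assoc,
    Functor.mapBiproduct_inv]
  congr 1
  exact biproduct.ι_desc _ _

/-- The direct sum of equivariant objects: the linearisation is the direct sum of the
linearisations. -/
def directSum (F : ι → A.EquivObj) : A.EquivObj where
  obj := biproduct fun i => (F i).obj
  lin :=
    { iso := directSumIso F
      comp := fun g h => by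
        ext i
        rw [← Category.assoc, ι_directSumIso, Category.assoc, ← Functor.map_comp_assoc,
          ι_directSumIso, ι_directSumIso, ← (F i).lin.comp g h]
        simp only [Functor.map_comp, Category.assoc, eps_naturality] }

/-- The inclusions of the summands are invariant. -/
def directSumι (F : ι → A.EquivObj) (i : ι) : F i ⟶ directSum F :=
  ⟨biproduct.ι (fun i => (F i).obj) i,
    ((F i).lin.mem_invariants_iff (directSum F).lin _).2 fun g => (ι_directSumIso F g i).symm⟩

/-- The projections to the summands are invariant. -/
def directSumπ (F : ι → A.EquivObj) (i : ι) : directSum F ⟶ F i :=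
  ⟨biproduct.π (fun i => (F i).obj) i,
    ((directSum F).lin.mem_invariants_iff (F i).lin _).2 fun g => by
      classical
      change (directSumIso F g).hom ≫ (A.act g).map (biproduct.π (fun i => (F i).obj) i) =
        biproduct.π (fun i => (F i).obj) i ≫ ((F i).lin.iso g).hom
      apply biproduct.hom_ext'
      intro j
      rw [← Category.assoc, ι_directSumIso, Category.assoc, ← Functor.map_comp]
      by_cases hij : j = i
      · subst hij
        rw [biproduct.ι_π_self_assoc, biproduct.ι_π_self, CategoryTheory.Functor.map_id,
          Category.comp_id]
      · rw [biproduct.ι_π_ne_assoc _ hij, biproduct.ι_π_ne _ hij]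
        simp⟩

instance : HasFiniteBiproducts A.EquivObj where
  out n :=
    { has_biproduct := fun F => by
        refine HasBiproduct.mk
          { bicone :=
              { pt := directSum F
                π := directSumπ F
                ι := directSumι F
                ι_π := fun j j' => ?_ }
            isBilimit := isBilimitOfTotal _ ?_ }
        · split_ifs with h
          · subst h
            exact Subtype.ext (biproduct.ι_π_self _ _)
          · exact Subtype.ext (biproduct.ι_π_ne _ h)
        · apply (forget A).map_injective
          rw [Functor.map_sum]
          exact biproduct.total }

end EquivObj

/-! ### Tensor products with representations, and induction -/

section Tensor

variable [HasFiniteBiproducts C] {A}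

/-- The tensor product `V ⊗ (X, λ)` of a finite-dimensional right representation `ρ` of `G`
(i.e. a representation of the opposite group) with an equivariant object. With respect to a
basis of `V`, the underlying object is `X^{⊕ dim V}` and the linearisation is `ρ_g ⊗ λ_g`. -/
def tensor (V : FDRep k Gᵐᵒᵖ) (X : A.EquivObj) : A.EquivObj where
  obj := biproduct fun _ : Fin (Module.finrank k V) => X.obj
  lin := linearisationOfMatrix
    (fun g d c => LinearMap.toMatrix (Module.finBasis k V) (Module.finBasis k V)
      (V.ρ (MulOpposite.op g)) c d • (X.lin.iso g).hom)
    (fun g h d c => by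
      rw [MulOpposite.op_mul, map_mul, LinearMap.toMatrix_mul, Matrix.mul_apply, Finset.sum_smul]
      refine Finset.sum_congr rfl fun b _ => ?_
      rw [Functor.map_smul, Linear.smul_comp, Linear.smul_comp, Linear.comp_smul, smul_smul,
        X.lin.comp, mul_comm])
    (fun d c hdc => by
      rw [MulOpposite.op_one, map_one, LinearMap.toMatrix_one, Matrix.one_apply_ne' hdc,
        zero_smul])
    (fun c => by
      rw [MulOpposite.op_one, map_one, LinearMap.toMatrix_one, Matrix.one_apply_eq, one_smul]
      infer_instance)

end Tensor

section Induction

variable {A} {H : Subgroup G}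

lemma coset_rep_mem {x : G} {d c : G ⧸ H} (h : x • c = d) : d.out⁻¹ * (x * c.out) ∈ H := by
  rw [← QuotientGroup.eq, QuotientGroup.out_eq', ← h]
  conv_lhs => rw [← QuotientGroup.out_eq' c]
  rfl

/-- For `x • c = d` in `G ⧸ H` with representatives `r(c)`, `r(d)`, write `x r(c) = r(d) h` with
`h ∈ H`. The component of the linearisation of `⨁ r(c)_* X` is the composition
`r(d)_* X ⟶ r(d)_* h_* X ≅ (r(d) h)_* X = (x r(c))_* X ≅ x_* r(c)_* X`. -/
def indEntry (X : (A.restrict H).EquivObj) (x : G) {d c : G ⧸ H} (h : x • c = d) :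
    (A.act d.out).obj X.obj ⟶ (A.act x).obj ((A.act c.out).obj X.obj) :=
  (A.act d.out).map (X.lin.iso ⟨_, coset_rep_mem h⟩).hom ≫
    A.epsEq (mul_inv_cancel_left d.out (x * c.out)) X.obj ≫
      (A.eps x c.out).inv.app X.obj

instance (X : (A.restrict H).EquivObj) (x : G) {d c : G ⧸ H} (h : x • c = d) :
    IsIso (indEntry X x h) := by
  have h1 : IsIso (A.epsEq (mul_inv_cancel_left d.out (x * c.out)) X.obj) := inferInstance
  have h2 : IsIso ((A.act d.out).map (X.lin.iso ⟨_, coset_rep_mem h⟩).hom) :=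
    ((A.act d.out).mapIso (X.lin.iso ⟨_, coset_rep_mem h⟩)).isIso_hom
  have h3 : IsIso ((A.eps x c.out).inv.app X.obj) := inferInstance
  have h4 := @IsIso.comp_isIso _ _ _ _ _ _ _ h1 h3
  exact @IsIso.comp_isIso _ _ _ _ _ _ _ h2 h4

lemma indEntry_eq (X : (A.restrict H).EquivObj) (x : G) {d c : G ⧸ H} (h : x • c = d) (u : H)
    (hu : d.out * (u : G) = x * c.out) :
    indEntry X x h = (A.act d.out).map (X.lin.iso u).hom ≫ A.epsEq hu X.obj ≫
      (A.eps x c.out).inv.app X.obj := by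
  have hu' : u = ⟨_, coset_rep_mem h⟩ := by
    apply Subtype.ext
    apply mul_left_cancel (a := d.out)
    rw [hu]
    exact (mul_inv_cancel_left _ _).symm
  subst hu'
  rfl

lemma indEntry_comp (X : (A.restrict H).EquivObj) (x y : G) {d b c : G ⧸ H} (h : x • b = d)
    (h' : y • c = b) (h'' : (x * y) • c = d) :
    indEntry X x h ≫ (A.act x).map (indEntry X y h') ≫
      (A.eps x y).hom.app ((A.act c.out).obj X.obj) = indEntry X (x * y) h'' := by
  -- `u` and `w` are the elements of `H` with `x r(b) = r(d) u` and `y r(c) = r(b) w`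
  obtain ⟨u, eu⟩ : ∃ u : H, d.out * (u : G) = x * b.out :=
    ⟨⟨_, coset_rep_mem h⟩, mul_inv_cancel_left _ _⟩
  obtain ⟨w, ew⟩ : ∃ w : H, b.out * (w : G) = y * c.out :=
    ⟨⟨_, coset_rep_mem h'⟩, mul_inv_cancel_left _ _⟩
  have euw : d.out * ((u * w : H) : G) = x * y * c.out := by
    rw [Subgroup.coe_mul, ← mul_assoc, eu, mul_assoc, ew, mul_assoc]
  rw [indEntry_eq X x h u eu, indEntry_eq X y h' w ew, indEntry_eq X (x * y) h'' (u * w) euw]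
  exact A.transition_comp eu ew euw X.obj _ _ _ (X.lin.comp u w)

open Classical in
/-- The induction `Ind_H^G X = ⨁_{[g] ∈ G ⧸ H} g_* X` of an `H`-equivariant object, where the sum
runs over a set of representatives of the cosets. -/
def induction [HasFiniteBiproducts C] [Finite G] (X : (A.restrict H).EquivObj) : A.EquivObj where
  obj := biproduct fun c : G ⧸ H => (A.act c.out).obj X.obj
  lin :=
    letI : Fintype (G ⧸ H) := Fintype.ofFinite _
    linearisationOfMatrix
      (fun x d c => if h : x • c = d then indEntry X x h else 0)
      (fun x y d c => by
        rw [Finset.sum_eq_single (y • c)]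
        · by_cases h : (x * y) • c = d
          · have h1 : x • y • c = d := by rw [← mul_smul, h]
            rw [dif_pos h, dif_pos h1, dif_pos rfl]
            exact indEntry_comp X x y h1 rfl h
          · have h1 : ¬ x • y • c = d := by rwa [← mul_smul]
            rw [dif_neg h, dif_neg h1, zero_comp]
        · intro b _ hb
          rw [dif_neg (Ne.symm hb), Functor.map_zero, zero_comp, comp_zero]
        · simp)
      (fun d c hdc => by
        rw [dif_neg]
        rw [one_smul]
        exact Ne.symm hdc)
      (fun c => by
        rw [dif_pos (one_smul G c)]
        infer_instance)

end Induction

end CatAction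

/-! ### Irreducible representations -/

/-- The family `V` of finite-dimensional right representations of `H` over `k` is a set of
representatives of the isomorphism classes of irreducible ones. -/
structure IsIrrSystem {k : Type u} [Field k] {H : Type uG} [Group H] {J : Type uJ}
    (V : J → FDRep k Hᵐᵒᵖ) : Prop where
  irreducible : ∀ j, Representation.IsIrreducible (V j).ρ
  nonisomorphic : ∀ i j, Nonempty (V i ≅ V j) → i = j
  complete : ∀ W : FDRep k Hᵐᵒᵖ, Representation.IsIrreducible W.ρ → ∃ j, Nonempty (W ≅ V j)

/-! ### Skew group algebras -/

/-- The skew group algebra `G ⋉ B` of a finite group `G` acting from the right on a `k`-algebra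
`B` by `k`-algebra homomorphisms (automatically automorphisms), `b ^ g = σ (op g) b`.
The function `x` stands for `∑ g, (g, x g)`. -/
def SkewGroupAlgebra {k : Type u} [Field k] {G : Type uG} [Group G] {B : Type v} [Ring B]
    [Algebra k B] (_σ : Gᵐᵒᵖ →* (B →ₐ[k] B)) : Type (max uG v) :=
  G → B

namespace SkewGroupAlgebra

variable {k : Type u} [Field k] {G : Type uG} [Group G] {B : Type v} [Ring B]
    [Algebra k B] (σ : Gᵐᵒᵖ →* (B →ₐ[k] B))

instance : AddCommGroup (SkewGroupAlgebra σ) := inferInstanceAs (AddCommGroup (G → B))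

instance : Module k (SkewGroupAlgebra σ) := inferInstanceAs (Module k (G → B))

open Classical in
/-- The basis element `(g, b)`. -/
def of (g : G) (b : B) : SkewGroupAlgebra σ := Pi.single g b

instance : One (SkewGroupAlgebra σ) := ⟨of σ 1 1⟩

variable [Fintype G]

/-- The multiplication `(g, a) (h, b) = (g h, a ^ h b)`, extended bilinearly; see `of_mul_of`. -/
instance : Mul (SkewGroupAlgebra σ) :=
  ⟨fun x y l => ∑ h, σ (MulOpposite.op h) (x (l * h⁻¹)) * y h⟩

lemma mul_apply (x y : SkewGroupAlgebra σ) (l : G) :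
    (x * y) l = ∑ h, σ (MulOpposite.op h) (x (l * h⁻¹)) * y h := rfl

lemma of_mul_of (g h : G) (a b : B) :
    of σ g a * of σ h b = of σ (g * h) (σ (MulOpposite.op h) a * b) := by
  classical
  funext l
  rw [mul_apply, Finset.sum_eq_single h]
  · by_cases hl : l = g * h
    · subst hl
      simp [of]
    · have : l * h⁻¹ ≠ g := fun e => hl (by rw [← e]; simp)
      simp [of, Pi.single_eq_of_ne hl, Pi.single_eq_of_ne this]
  · intro m _ hm
    simp [of, Pi.single_eq_of_ne hm]
  · simp

instance : Ring (SkewGroupAlgebra σ) :=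
  { (inferInstance : AddCommGroup (SkewGroupAlgebra σ)),
    (inferInstance : Mul (SkewGroupAlgebra σ)),
    (inferInstance : One (SkewGroupAlgebra σ)) with
    left_distrib := fun x y z => by
      funext l
      change ∑ h, _ * (y h + z h) = (∑ h, _ * y h) + ∑ h, _ * z h
      simp only [mul_add, Finset.sum_add_distrib]
    right_distrib := fun x y z => by
      funext l
      change ∑ h, σ _ (x (l * h⁻¹) + y (l * h⁻¹)) * z h =
        (∑ h, σ _ (x (l * h⁻¹)) * z h) + ∑ h, σ _ (y (l * h⁻¹)) * z h
      simp only [map_add, add_mul, Finset.sum_add_distrib]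
    zero_mul := fun x => by
      funext l
      change ∑ h, σ _ (0 : B) * x h = 0
      simp
    mul_zero := fun x => by
      funext l
      change ∑ h, _ * (0 : B) = 0
      simp
    one_mul := fun x => by
      classical
      funext l
      change ∑ h, σ (MulOpposite.op h) ((Pi.single 1 1 : G → B) (l * h⁻¹)) * x h = x l
      rw [Finset.sum_eq_single l]
      · simp
      · intro h _ hh
        rw [Pi.single_eq_of_ne]
        · simp
        · intro e
          exact hh (mul_inv_eq_one.mp e).symm
      · simp
    mul_one := fun x => by
      classical
      funext l
      change ∑ h, σ (MulOpposite.op h) (x (l * h⁻¹)) * (Pi.single 1 1 : G → B) h = x l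
      rw [Finset.sum_eq_single 1]
      · simp
      · intro h _ hh
        rw [Pi.single_eq_of_ne hh, mul_zero]
      · simp
    mul_assoc := fun x y z => by
      funext l
      change ∑ h, σ (MulOpposite.op h) (∑ m, σ (MulOpposite.op m) (x (l * h⁻¹ * m⁻¹)) * y m) * z h
        = ∑ p, σ (MulOpposite.op p) (x (l * p⁻¹)) *
            ∑ h, σ (MulOpposite.op h) (y (p * h⁻¹)) * z h
      simp only [map_sum, map_mul, Finset.sum_mul, Finset.mul_sum]
      rw [Finset.sum_comm (s := Finset.univ) (t := Finset.univ)
        (f := fun p h => σ (MulOpposite.op p) (x (l * p⁻¹)) *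
          (σ (MulOpposite.op h) (y (p * h⁻¹)) * z h))]
      refine Finset.sum_congr rfl fun h _ => ?_
      refine Fintype.sum_equiv (Equiv.mulRight h) _ _ fun m => ?_
      simp [mul_assoc, AlgHom.mul_apply] }

instance : Algebra k (SkewGroupAlgebra σ) :=
  Algebra.ofModule
    (fun c x y => by
      funext l
      change ∑ h, σ _ (c • x (l * h⁻¹)) * y h = c • ∑ h, σ _ (x (l * h⁻¹)) * y h
      simp only [map_smul, smul_mul_assoc, Finset.smul_sum])
    (fun c x y => by
      funext l
      change ∑ h, σ _ (x (l * h⁻¹)) * (c • y h) = c • ∑ h, σ _ (x (l * h⁻¹)) * y h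
      simp only [mul_smul_comm, Finset.smul_sum])

end SkewGroupAlgebra

/-! ### Basic algebras and basic reductions -/

/-- A nonzero module without nontrivial direct sum decomposition. -/
def IsIndecomposableModule (R M : Type*) [Ring R] [AddCommGroup M] [Module R M] : Prop :=
  Nontrivial M ∧ ∀ N P : Submodule R M, IsCompl N P → N = ⊥ ∨ P = ⊥

/-- A finite-dimensional algebra is basic if the indecomposable summands in its
Krull-Remak-Schmidt decomposition as a right module over itself are pairwise non-isomorphic. -/
structure IsBasicAlgebra (k : Type u) [Field k] (B : Type v) [Ring B] [Algebra k B] : Prop where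
  finiteDimensional : FiniteDimensional k B
  decomposition : ∃ (n : ℕ) (P : Fin n → Submodule Bᵐᵒᵖ B),
    DirectSum.IsInternal P ∧ (∀ i, IsIndecomposableModule Bᵐᵒᵖ (P i)) ∧
      ∀ i j, Nonempty (P i ≃ₗ[Bᵐᵒᵖ] P j) → i = j

/-- `B` is a basic reduction of `S`: it is basic, and the `k`-linear categories of right modules
over `S` and `B` are equivalent. -/
structure IsBasicReduction (k : Type u) [Field k] (S : Type*) [Ring S] [Algebra k S]
    (B : Type v) [Ring B] [Algebra k B] : Prop where
  basic : IsBasicAlgebra k B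
  morita : IsMoritaEquivalent k Sᵐᵒᵖ Bᵐᵒᵖ

end EquivariantEC

end

noncomputable section

namespace EquivariantEC

/-! ### Morita contexts -/

section MoritaContext

open MulOpposite (op unop op_unop unop_op op_mul)
open ModuleCat.Algebra

universe uB uS uM

/-! Let `B` be the endomorphism algebra of 𝔽 in the equivariant category and `S` the skew group
algebra of 𝔼. They are linked by the spaces `P = Hom(𝔽, 𝔼)` and `Q = Hom(𝔼, 𝔽)` of all morphisms of
underlying objects, invariant or not. `B` acts by composition, `S` by composition followed by
conjugation with the linearisations. Summing the conjugates of `p ≫ q` pairs `Q` and `P` into `B`;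
the function `g ↦ q ≫ conj g⁻¹ p` pairs `P` and `Q` into `S`. This is a Morita context
(`PlainHom.moritaContext`), so the categories of right modules are equivalent as soon as both trace
ideals contain 1.

For `B` this is Maschke's averaging (`PlainHom.one_mem_trace`): the identity of 𝔽 is a sum of
morphisms factoring through 𝔼, and the conjugates of the identity add up to |G|, which is
invertible. For `S` (`id_mem_unitTrace`), look at the first member X of a block, with stabiliser H.
In the object induced from ρ ⊗ X there are dim ρ copies of X, and the linearisation of 𝔽, compressed
from the a-th to the b-th copy, is the matrix coefficient ρ(g)_{ba} times λ_g for g in H, and zero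
for g outside H. Since |H| is invertible, some combination of matrix coefficients of irreducible
representations is the delta function at 1 (`exists_matrixCoefficients`); no splitting field is
needed. This puts (1, e_X) into the trace ideal, where e_X is the idempotent of 𝔼 projecting to X.
Conjugation by G reaches the idempotents of the other members of the block, and together they add up
to 1.

For `B` to be basic, the induced objects must be pairwise non-isomorphic and without nontrivial
idempotents. Members of one block are mutually orthogonal because G permutes them transitively
(`block_orthogonal`). Hence compression to the base summand embeds the morphisms of objects induced
from ρ ⊗ X and ρ' ⊗ X into the intertwiners from ρ to ρ', compatibly with composition, and Schur's
lemma applies. Different blocks are separated by semiorthogonality.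

Uniqueness is Krull-Schmidt (`IsBasicAlgebra.nonempty_algEquiv`): an equivalence of module
categories carries one regular module to a module with the same indecomposable summands as the other
regular module. Both are multiplicity-free, so they are isomorphic, and so are their endomorphism
algebras. Finally, 𝔼 is linearisable because it is the sum of the objects induced from the first
members of the blocks. -/

/-- A Morita context between two `k`-algebras `B` and `S`: bimodules `P` and `Q` with two pairings
that are compatible with each other. -/
structure MoritaContext (k : Type u) [Field k] (B : Type uB) [Ring B] [Algebra k B]
    (S : Type uS) [Ring S] [Algebra k S] (P Q : Type uM)
    [AddCommGroup P] [Module Bᵐᵒᵖ P] [Module S P]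
    [AddCommGroup Q] [Module Sᵐᵒᵖ Q] [Module B Q] where
  /-- the pairing with values in `B` -/
  left : Q →+ P →+ B
  /-- the pairing with values in `S` -/
  right : P →+ Q →+ S
  left_smul : ∀ (q : Q) (p : P) (b : B), left q (op b • p) = left q p * b
  smul_left : ∀ (b : B) (q : Q) (p : P), left (b • q) p = b * left q p
  left_balanced : ∀ (q : Q) (p : P) (s : S), left (op s • q) p = left q (s • p)
  right_smul : ∀ (p : P) (q : Q) (s : S), right p (op s • q) = right p q * s
  smul_right : ∀ (s : S) (p : P) (q : Q), right (s • p) q = s * right p q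
  right_balanced : ∀ (p : P) (q : Q) (b : B), right (op b • p) q = right p (b • q)
  left_comp : ∀ (q q' : Q) (p : P), left q p • q' = op (right p q') • q
  right_comp : ∀ (p p' : P) (q : Q), right p q • p' = op (left q p') • p
  commP : ∀ (b : B) (s : S) (p : P), op b • s • p = s • op b • p
  commQ : ∀ (b : B) (s : S) (q : Q), op s • b • q = b • op s • q
  algebraP : ∀ (c : k) (p : P), algebraMap k S c • p = op (algebraMap k B c) • p
  algebraQ : ∀ (c : k) (q : Q), algebraMap k B c • q = op (algebraMap k S c) • q

namespace MoritaContext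

variable {k : Type u} [Field k] {B : Type uB} [Ring B] [Algebra k B]
  {S : Type uS} [Ring S] [Algebra k S] {P Q : Type uM}
  [AddCommGroup P] [Module Bᵐᵒᵖ P] [Module S P] [AddCommGroup Q] [Module Sᵐᵒᵖ Q] [Module B Q]

/-- Interchanging the two algebras of a Morita context. -/
def symm (M : MoritaContext k B S P Q) : MoritaContext k S B Q P where
  left := M.right
  right := M.left
  left_smul := M.right_smul
  smul_left := M.smul_right
  left_balanced := M.right_balanced
  right_smul := M.left_smul
  smul_right := M.smul_left
  right_balanced := M.left_balanced
  left_comp := M.right_comp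
  right_comp := M.left_comp
  commP s b q := M.commQ b s q
  commQ s b p := M.commP b s p
  algebraP := M.algebraQ
  algebraQ := M.algebraP

/-- The right `S`-module structure on `Hom_B(P, N)`. -/
@[reducible]
def homModule (M : MoritaContext k B S P Q) (N : Type*) [AddCommGroup N] [Module Bᵐᵒᵖ N] :
    Module Sᵐᵒᵖ (P →ₗ[Bᵐᵒᵖ] N) where
  smul s f :=
    { toFun := fun p => f (s.unop • p)
      map_add' := fun p p' => by rw [smul_add, map_add]
      map_smul' := fun b p => by
        have := M.commP b.unop s.unop p
        rw [op_unop] at this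
        rw [← this, map_smul, RingHom.id_apply] }
  one_smul f := by ext p; exact congrArg f (one_smul S p)
  mul_smul s t f := by ext p; exact congrArg f (mul_smul t.unop s.unop p)
  smul_zero s := by ext p; rfl
  smul_add s f f' := by ext p; rfl
  add_smul s t f := by
    ext p
    exact (congrArg f (add_smul s.unop t.unop p)).trans (map_add f _ _)
  zero_smul f := by
    ext p
    exact (congrArg f (zero_smul S p)).trans (map_zero f)

/-- The functor `N ↦ Hom_B(P, N)` from right `B`-modules to right `S`-modules. -/
def homFunctor (M : MoritaContext k B S P Q) :
    ModuleCat.{max w uM} Bᵐᵒᵖ ⥤ ModuleCat.{max w uM} Sᵐᵒᵖ where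
  obj N := @ModuleCat.of Sᵐᵒᵖ _ (P →ₗ[Bᵐᵒᵖ] N) _ (M.homModule N)
  map {N N'} f :=
    letI := M.homModule N
    letI := M.homModule N'
    ModuleCat.ofHom
      { toFun := fun g => f.hom.comp g
        map_add' := fun g g' => by ext p; exact map_add f.hom _ _
        map_smul' := fun s g => rfl }

variable (M : MoritaContext k B S P Q)

instance : (homFunctor.{w} M).Linear k where
  map_smul {N N'} f c := by
    ext (g : P →ₗ[Bᵐᵒᵖ] N)
    refine LinearMap.ext fun p => ?_
    -- The scalar acts on the values through `B` and on the argument through `S`; `algebraP` says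
    -- that the two agree on `P`.
    have h1 : (algebraMap k Bᵐᵒᵖ c) • f.hom (g p) = f.hom (g (algebraMap k S c • p)) := by
      rw [M.algebraP, map_smul, map_smul]
      rfl
    exact h1

/-- The unit `N ⟶ Hom_S(Q, Hom_B(P, N))`. -/
def unitMap (N : ModuleCat.{max w uM} Bᵐᵒᵖ) :
    N ⟶ (homFunctor.{w} M.symm).obj ((homFunctor.{w} M).obj N) :=
  letI := M.homModule N
  letI := M.symm.homModule (P →ₗ[Bᵐᵒᵖ] N)
  ModuleCat.ofHom (Y := Q →ₗ[Sᵐᵒᵖ] (P →ₗ[Bᵐᵒᵖ] N))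
    { toFun := fun n =>
        { toFun := fun q =>
            { toFun := fun p => op (M.left q p) • n
              map_add' := fun p p' => by rw [map_add, MulOpposite.op_add, add_smul]
              map_smul' := fun b p => by
                have := M.left_smul q p b.unop
                rw [op_unop] at this
                rw [this, op_mul, mul_smul, op_unop, RingHom.id_apply] }
          map_add' := fun q q' => by
            ext p
            change op (M.left (q + q') p) • n = op (M.left q p) • n + op (M.left q' p) • n
            rw [map_add, AddMonoidHom.add_apply, MulOpposite.op_add, add_smul]
          map_smul' := fun s q => by
            ext p
            change op (M.left (s • q) p) • n = op (M.left q (s.unop • p)) • n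
            rw [← M.left_balanced, op_unop] }
      map_add' := fun n n' => by
        ext q p
        exact smul_add _ _ _
      map_smul' := fun b n => by
        ext q p
        change op (M.left q p) • b • n = op (M.left (b.unop • q) p) • n
        rw [M.smul_left, op_mul, op_unop, mul_smul] }

/-- The additive subgroup (in fact an ideal) of `B` generated by the values of the pairing. -/
def trace : AddSubgroup B :=
  AddSubgroup.closure (Set.range fun x : Q × P => M.left x.1 x.2)

lemma left_mem_trace (q : Q) (p : P) : M.left q p ∈ M.trace :=
  AddSubgroup.subset_closure ⟨(q, p), rfl⟩

lemma mul_mem_trace (b : B) {x : B} (hx : x ∈ M.trace) : b * x ∈ M.trace := by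
  induction hx using AddSubgroup.closure_induction with
  | mem x hx =>
    obtain ⟨⟨q, p⟩, rfl⟩ := hx
    change b * M.left q p ∈ _
    rw [← M.smul_left]
    exact M.left_mem_trace _ _
  | zero => rw [mul_zero]; exact zero_mem _
  | add x y _ _ hx hy => rw [mul_add]; exact add_mem hx hy
  | neg x _ hx => rw [mul_neg]; exact neg_mem hx

lemma trace_mul_mem (b : B) {x : B} (hx : x ∈ M.trace) : x * b ∈ M.trace := by
  induction hx using AddSubgroup.closure_induction with
  | mem x hx =>
    obtain ⟨⟨q, p⟩, rfl⟩ := hx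
    change M.left q p * b ∈ _
    rw [← M.left_smul]
    exact M.left_mem_trace _ _
  | zero => rw [zero_mul]; exact zero_mem _
  | add x y _ _ hx hy => rw [add_mul]; exact add_mem hx hy
  | neg x _ hx => rw [neg_mul]; exact neg_mem hx

variable {M}

/-- Both halves are proved for an arbitrary trace element x and then specialised to x = 1. An n in
the kernel is killed by every x. Given Φ and x = ∑ ⟨qᵢ, pᵢ⟩, the element ∑ Φ(qᵢ)(pᵢ) is a preimage
of q ↦ Φ(x q). -/
lemma unitMap_bijective (h : (1 : B) ∈ M.trace) (N : ModuleCat.{max w uM} Bᵐᵒᵖ) :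
    Function.Bijective (M.unitMap N).hom := by
  let _ := M.homModule N
  let _ := M.symm.homModule (P →ₗ[Bᵐᵒᵖ] N)
  constructor
  · refine (injective_iff_map_eq_zero _).2 fun n hn => ?_
    have h0 : ∀ x ∈ M.trace, op x • n = 0 := by
      intro x hx
      induction hx using AddSubgroup.closure_induction with
      | mem x hx =>
        obtain ⟨⟨q, p⟩, rfl⟩ := hx
        exact LinearMap.congr_fun (LinearMap.congr_fun
          (show (show Q →ₗ[Sᵐᵒᵖ] (P →ₗ[Bᵐᵒᵖ] N) from (M.unitMap N).hom n) = 0 from hn) q) p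
      | zero => rw [MulOpposite.op_zero, zero_smul]
      | add x y _ _ hx hy => rw [MulOpposite.op_add, add_smul, hx, hy, add_zero]
      | neg x _ hx => rw [MulOpposite.op_neg, neg_smul, hx, neg_zero]
    have h1 := h0 1 h
    rwa [MulOpposite.op_one, one_smul] at h1
  · intro Φ'
    obtain ⟨Φ, rfl⟩ : ∃ Φ : Q →ₗ[Sᵐᵒᵖ] (P →ₗ[Bᵐᵒᵖ] N), Φ = Φ' := ⟨Φ', rfl⟩
    have h0 : ∀ x ∈ M.trace, ∃ n : N, ∀ q p, op (M.left q p) • n = Φ (x • q) p := by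
      intro x hx
      induction hx using AddSubgroup.closure_induction with
      | mem x hx =>
        obtain ⟨⟨q₀, p₀⟩, rfl⟩ := hx
        -- The two mixed associativity laws give Φ(⟨q₀, p₀⟩ q)(p) = Φ(q₀ [p₀, q])(p) = Φ(q₀)([p₀, q]
        -- p) = Φ(q₀)(p₀ ⟨q, p⟩), with [ , ] the pairing into `S`.
        refine ⟨Φ q₀ p₀, fun q p => ?_⟩
        change _ = Φ (M.left q₀ p₀ • q) p
        rw [M.left_comp, map_smul, ← map_smul (Φ q₀), ← M.right_comp]
        rfl
      | zero => exact ⟨0, fun q p => by rw [smul_zero, zero_smul, map_zero, LinearMap.zero_apply]⟩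
      | add x y _ _ hx hy =>
        obtain ⟨m, hm⟩ := hx
        obtain ⟨n, hn⟩ := hy
        exact ⟨m + n, fun q p => by
          rw [smul_add, hm, hn, add_smul, map_add, LinearMap.add_apply]⟩
      | neg x _ hx =>
        obtain ⟨m, hm⟩ := hx
        exact ⟨-m, fun q p => by rw [smul_neg, hm, neg_smul, map_neg, LinearMap.neg_apply]⟩
    obtain ⟨n, hn⟩ := h0 1 h
    refine ⟨n, LinearMap.ext fun q => LinearMap.ext fun p => ?_⟩
    have := hn q p
    rw [one_smul] at this
    exact this

/-- The unit as a natural isomorphism. -/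
def unitIso (h : (1 : B) ∈ M.trace) :
    𝟭 (ModuleCat.{max w uM} Bᵐᵒᵖ) ≅ homFunctor.{w} M ⋙ homFunctor.{w} M.symm :=
  NatIso.ofComponents
    (fun N => (LinearEquiv.ofBijective (M.unitMap N).hom (unitMap_bijective h N)).toModuleIso)
    (fun {N N'} f => by
      ext n
      let _ := M.homModule N'
      let _ := M.symm.homModule (P →ₗ[Bᵐᵒᵖ] N')
      refine LinearMap.ext fun (q : Q) => LinearMap.ext fun (p : P) => ?_
      exact (map_smul f.hom (op (M.left q p)) n).symm)

/-- If both pairings of a Morita context generate the unit ideal, then the categories of right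
modules are equivalent. -/
def equivalence (h : (1 : B) ∈ M.trace) (h' : (1 : S) ∈ M.symm.trace) :
    ModuleCat.{max w uM} Bᵐᵒᵖ ≌ ModuleCat.{max w uM} Sᵐᵒᵖ :=
  CategoryTheory.Equivalence.mk (homFunctor.{w} M) (homFunctor.{w} M.symm) (unitIso h)
    (unitIso h').symm

instance (h : (1 : B) ∈ M.trace) (h' : (1 : S) ∈ M.symm.trace) :
    (equivalence.{w} h h').functor.Linear k :=
  inferInstanceAs ((homFunctor.{w} M).Linear k)

end MoritaContext

/-- The module categories are taken in the universe `max uG v`, which accommodates both algebras and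
both bimodules. -/
lemma isMoritaEquivalent_of_moritaContext {k : Type u} [Field k] {B : Type v} [Ring B]
    [Algebra k B] {S : Type (max uG v)} [Ring S] [Algebra k S] {P Q : Type v}
    [AddCommGroup P] [Module Bᵐᵒᵖ P] [Module S P] [AddCommGroup Q] [Module Sᵐᵒᵖ Q] [Module B Q]
    (M : MoritaContext k B S P Q) (h : (1 : B) ∈ M.trace) (h' : (1 : S) ∈ M.symm.trace) :
    IsMoritaEquivalent k Sᵐᵒᵖ Bᵐᵒᵖ :=
  let e : MoritaEquivalence k Bᵐᵒᵖ Sᵐᵒᵖ :=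
    { eqv := MoritaContext.equivalence.{uG} h h'
      linear := inferInstance }
  IsMoritaEquivalent.symm k ⟨⟨e⟩⟩

end MoritaContext

/-! ### Basic algebras from orthogonal idempotents -/

section Idempotents

open MulOpposite (op unop)

variable {B : Type*} [Ring B]

/-- The right ideal `e B` of an idempotent `e`. -/
def rightIdeal (e : B) : Submodule Bᵐᵒᵖ B where
  carrier := {b | e * b = b}
  add_mem' {a b} ha hb := by
    change e * (a + b) = a + b
    rw [mul_add, ha, hb]
  zero_mem' := mul_zero e
  smul_mem' c b hb := by
    change e * (b * c.unop) = b * c.unop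
    rw [← mul_assoc, hb]

lemma mem_rightIdeal {e b : B} : b ∈ rightIdeal e ↔ e * b = b := Iff.rfl

lemma rightIdeal_isInternal {ι : Type*} [Fintype ι] [DecidableEq ι] {e : ι → B}
    (he : CompleteOrthogonalIdempotents e) : DirectSum.IsInternal fun i => rightIdeal (e i) := by
  rw [DirectSum.isInternal_submodule_iff_iSupIndep_and_iSup_eq_top]
  constructor
  · intro i
    rw [Submodule.disjoint_def]
    intro x hx hx'
    -- All the other right ideals lie in (1 - eᵢ)B, which meets eᵢB in zero.
    have h : (⨆ j, ⨆ (_ : j ≠ i), rightIdeal (e j)) ≤ rightIdeal (1 - e i) := by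
      refine iSup₂_le fun j hj x hx => ?_
      rw [mem_rightIdeal] at hx ⊢
      rw [← hx, ← mul_assoc, sub_mul, one_mul, he.ortho (Ne.symm hj), sub_zero]
    have h1 := mem_rightIdeal.1 (h hx')
    rw [sub_mul, one_mul, mem_rightIdeal.1 hx, sub_self] at h1
    exact h1.symm
  · rw [eq_top_iff]
    intro x _
    have : x = ∑ i, e i * x := by rw [← Finset.sum_mul, he.complete, one_mul]
    rw [this]
    refine Submodule.sum_mem _ fun i _ => Submodule.mem_iSup_of_mem i ?_
    rw [mem_rightIdeal, ← mul_assoc, (he.idem i).eq]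

/-- A decomposition eB = N ⊕ P splits the generator as e = n + p, and n turns out to be an
idempotent of eBe. If n is 0 or e, then the generator lies in one of the two summands, which is then
everything. -/
lemma rightIdeal_indecomposable {e : B} (he : IsIdempotentElem e) (h0 : e ≠ 0)
    (h : ∀ x : B, e * x = x → x * e = x → x * x = x → x = 0 ∨ x = e) :
    IsIndecomposableModule Bᵐᵒᵖ (rightIdeal e) := by
  let E : rightIdeal e := ⟨e, he⟩
  have hE : ∀ N : Submodule Bᵐᵒᵖ (rightIdeal e), E ∈ N → N = ⊤ := by
    intro N hN
    rw [eq_top_iff]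
    intro x _
    have : op x.1 • E = x := Subtype.ext x.2
    rw [← this]
    exact N.smul_mem _ hN
  refine ⟨⟨⟨E, 0, fun h => h0 (congrArg Subtype.val h)⟩⟩, fun N P hNP => ?_⟩
  have hd := Submodule.disjoint_def.1 hNP.disjoint
  obtain ⟨n, hn, p, hp, hnp⟩ : ∃ n ∈ N, ∃ p ∈ P, n + p = E :=
    Submodule.mem_sup.1 (hNP.sup_eq_top ▸ Submodule.mem_top)
  have hnp' : n.1 + p.1 = e := congrArg Subtype.val hnp
  -- Since en = n, the element pn = n - n² lies in both N and P.
  have h1 : op n.1 • p = 0 := by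
    refine hd _ ?_ (P.smul_mem _ hp)
    have : op n.1 • p = n - op n.1 • n := by
      apply Subtype.ext
      change p.1 * n.1 = n.1 - n.1 * n.1
      rw [eq_sub_iff_add_eq, ← add_mul, add_comm, hnp', n.2]
    rw [this]
    exact N.sub_mem hn (N.smul_mem _ hn)
  -- Since (n + p)e = n + p, the element n - ne = pe - p lies in both N and P.
  have h2 : n - op e • n = 0 := by
    refine hd _ (N.sub_mem hn (N.smul_mem _ hn)) ?_
    have : n - op e • n = op e • p - p := by
      apply Subtype.ext
      change n.1 - n.1 * e = p.1 * e - p.1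
      rw [sub_eq_sub_iff_add_eq_add, ← add_mul, add_comm p.1 n.1, hnp', he.eq]
    rw [this]
    exact P.sub_mem (P.smul_mem _ hp) hp
  have h3 : n.1 * e = n.1 := (sub_eq_zero.1 (congrArg Subtype.val h2)).symm
  have h4 : n.1 * n.1 = n.1 := by
    have h5 : p.1 * n.1 = 0 := congrArg Subtype.val h1
    have h6 : (n.1 + p.1) * n.1 = n.1 := (congrArg (· * n.1) hnp').trans n.2
    rwa [add_mul, h5, add_zero] at h6
  rcases h n.1 n.2 h3 h4 with h5 | h5
  · left
    have : E ∈ P := by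
      have h6 : n = 0 := Subtype.ext h5
      rw [← hnp, h6, zero_add]
      exact hp
    exact disjoint_top.1 (hE P this ▸ hNP.disjoint)
  · right
    have : E ∈ N := by
      have h6 : n = E := Subtype.ext h5
      rw [← h6]
      exact hn
    exact top_disjoint.1 (hE N this ▸ hNP.disjoint)

/-- A homomorphism of right ideals eᵢB → eⱼB is left multiplication by the image of eᵢ, an element
of eⱼBeᵢ. An isomorphism therefore yields a and b with ba = eᵢ and ab = eⱼ, which is the form of the
hypothesis `hiso`. -/
lemma isBasicAlgebra_of_idempotents (k : Type u) [Field k] {B : Type v} [Ring B] [Algebra k B]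
    [FiniteDimensional k B] {ι : Type*} [Fintype ι] {e : ι → B}
    (he : CompleteOrthogonalIdempotents e) (h0 : ∀ i, e i ≠ 0)
    (hind : ∀ i (x : B), e i * x = x → x * e i = x → x * x = x → x = 0 ∨ x = e i)
    (hiso : ∀ i j (a b : B), e j * a = a → a * e i = a → e i * b = b → b * e j = b →
      b * a = e i → a * b = e j → i = j) : IsBasicAlgebra k B where
  finiteDimensional := inferInstance
  decomposition := by
    let σ := (Fintype.equivFin ι).symm
    refine ⟨Fintype.card ι, fun i => rightIdeal (e (σ i)),
      rightIdeal_isInternal (e := e ∘ σ) ((CompleteOrthogonalIdempotents.equiv σ).2 he),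
      fun i => rightIdeal_indecomposable (he.idem _) (h0 _) (hind _), ?_⟩
    rintro i j ⟨φ⟩
    apply σ.injective
    let u : rightIdeal (e (σ i)) := ⟨e (σ i), he.idem _⟩
    let v : rightIdeal (e (σ j)) := ⟨e (σ j), he.idem _⟩
    have hu : ∀ x : rightIdeal (e (σ i)), op x.1 • u = x := fun x => Subtype.ext x.2
    have hv : ∀ x : rightIdeal (e (σ j)), op x.1 • v = x := fun x => Subtype.ext x.2
    have key1 : ∀ x : rightIdeal (e (σ i)), (φ u).1 * x.1 = (φ x).1 := by
      intro x
      conv_rhs => rw [← hu x, map_smul]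
      rfl
    have key2 : ∀ x : rightIdeal (e (σ j)), (φ.symm v).1 * x.1 = (φ.symm x).1 := by
      intro x
      conv_rhs => rw [← hv x, map_smul]
      rfl
    refine hiso _ _ (φ u).1 (φ.symm v).1 (φ u).2 (key1 u) (φ.symm v).2 (key2 v) ?_ ?_
    · rw [key2, LinearEquiv.symm_apply_apply]
    · rw [key1, LinearEquiv.apply_symm_apply]

end Idempotents

/-! ### Krull-Schmidt arguments in preadditive categories -/

section KrullSchmidt

variable {C : Type*} [Category C] [Preadditive C]

/-- An object with a local endomorphism ring. -/
def HasLocalEnd (X : C) : Prop :=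
  𝟙 X ≠ 0 ∧ ∀ a b : X ⟶ X, a + b = 𝟙 X → IsIso a ∨ IsIso b

/-- The endomorphisms of `X` that are sums of morphisms factoring through members of `Q`. -/
def throughSubgroup {ι : Type*} (Q : ι → C) (X : C) : AddSubgroup (X ⟶ X) :=
  AddSubgroup.closure {z | ∃ (i : ι) (f : X ⟶ Q i) (g : Q i ⟶ X), f ≫ g = z}

lemma comp_mem_throughSubgroup {ι : Type*} (Q : ι → C) {X : C} {i : ι} (f : X ⟶ Q i)
    (g : Q i ⟶ X) : f ≫ g ∈ throughSubgroup Q X :=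
  AddSubgroup.subset_closure ⟨i, f, g, rfl⟩

lemma conj_mem_throughSubgroup {ι : Type*} {Q : ι → C} {X Y : C} {z : X ⟶ X}
    (hz : z ∈ throughSubgroup Q X) (f : Y ⟶ X) (g : X ⟶ Y) :
    f ≫ z ≫ g ∈ throughSubgroup Q Y := by
  induction hz using AddSubgroup.closure_induction with
  | mem z hz =>
    obtain ⟨i, a, b, rfl⟩ := hz
    have := comp_mem_throughSubgroup Q (f ≫ a) (b ≫ g)
    simpa only [Category.assoc] using this
  | zero => rw [zero_comp, comp_zero]; exact zero_mem _
  | add x y _ _ hx hy =>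
    rw [Preadditive.add_comp, Preadditive.comp_add]
    exact add_mem hx hy
  | neg x _ hx =>
    rw [Preadditive.neg_comp, Preadditive.comp_neg]
    exact neg_mem hx

/-- That `𝟙 X` lies in `throughSubgroup Q X` means that X is a retract of a finite sum of members of
`Q`. This form refers to no biproduct and passes through additive functors, in particular the
forgetful functor and the functors g_*. The lemma is transitivity of this relation. -/
lemma throughSubgroup_trans {ι κ : Type*} {Q : ι → C} {P : κ → C} {X : C}
    (h : ∀ i, 𝟙 (P i) ∈ throughSubgroup Q (P i)) {z : X ⟶ X} (hz : z ∈ throughSubgroup P X) :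
    z ∈ throughSubgroup Q X := by
  induction hz using AddSubgroup.closure_induction with
  | mem z hz =>
    obtain ⟨i, a, b, rfl⟩ := hz
    simpa only [Category.id_comp] using conj_mem_throughSubgroup (h i) a b
  | zero => exact zero_mem _
  | add x y _ _ hx hy => exact add_mem hx hy
  | neg x _ hx => exact neg_mem hx

lemma map_mem_throughSubgroup {C' : Type*} [Category C'] [Preadditive C'] (F : C ⥤ C')
    [F.Additive] {ι : Type*} {Q : ι → C} {X : C} {z : X ⟶ X} (hz : z ∈ throughSubgroup Q X) :
    F.map z ∈ throughSubgroup (fun i => F.obj (Q i)) (F.obj X) := by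
  induction hz using AddSubgroup.closure_induction with
  | mem z hz =>
    obtain ⟨i, a, b, rfl⟩ := hz
    rw [F.map_comp]
    exact comp_mem_throughSubgroup (fun i => F.obj (Q i)) (F.map a) (F.map b)
  | zero => rw [F.map_zero]; exact zero_mem _
  | add x y _ _ hx hy => rw [F.map_add]; exact add_mem hx hy
  | neg x _ hx => rw [F.map_neg]; exact neg_mem hx

lemma HasLocalEnd.isIso_of_add {X : C} (hX : HasLocalEnd X) {a b : X ⟶ X} (h : IsIso (a + b)) :
    IsIso a ∨ IsIso b := by
  have : a ≫ inv (a + b) + b ≫ inv (a + b) = 𝟙 X := by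
    rw [← Preadditive.add_comp, IsIso.hom_inv_id]
  rcases hX.2 _ _ this with h' | h'
  · exact Or.inl (IsIso.of_isIso_comp_right a (inv (a + b)))
  · exact Or.inr (IsIso.of_isIso_comp_right b (inv (a + b)))

lemma HasLocalEnd.not_isIso_zero {X : C} (hX : HasLocalEnd X) : ¬ IsIso (0 : X ⟶ X) := by
  intro h
  apply hX.1
  rw [← IsIso.hom_inv_id (0 : X ⟶ X), zero_comp]

lemma HasLocalEnd.map {C' : Type*} [Category C'] [Preadditive C'] (F : C ⥤ C') [F.Additive]
    [F.Full] [F.Faithful] {X : C} (hX : HasLocalEnd X) : HasLocalEnd (F.obj X) := by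
  refine ⟨fun h => hX.1 (F.map_injective (by rw [F.map_id, h, F.map_zero])), fun a b hab => ?_⟩
  obtain ⟨a, rfl⟩ := F.map_surjective a
  obtain ⟨b, rfl⟩ := F.map_surjective b
  rw [← F.map_add, ← F.map_id] at hab
  rcases hX.2 a b (F.map_injective hab) with h | h
  · exact Or.inl inferInstance
  · exact Or.inr inferInstance

/-- In a local ring a sum of non-units is a non-unit, so an invertible sum of factored endomorphisms
has an invertible term. -/
lemma exists_isIso_of_mem_throughSubgroup {ι : Type*} {Q : ι → C} {X : C} (hX : HasLocalEnd X)
    {z : X ⟶ X} (hz : z ∈ throughSubgroup Q X) (h : IsIso z) :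
    ∃ (i : ι) (f : X ⟶ Q i) (g : Q i ⟶ X), IsIso (f ≫ g) := by
  induction hz using AddSubgroup.closure_induction with
  | mem z hz =>
    obtain ⟨i, a, b, rfl⟩ := hz
    exact ⟨i, a, b, h⟩
  | zero => exact absurd h hX.not_isIso_zero
  | add x y _ _ hx hy => exact (hX.isIso_of_add h).elim hx hy
  | neg x _ hx =>
    apply hx
    refine ⟨⟨-inv (-x), ?_, ?_⟩⟩
    · rw [Preadditive.comp_neg, ← Preadditive.neg_comp, IsIso.hom_inv_id]
    · rw [Preadditive.neg_comp, ← Preadditive.comp_neg, IsIso.inv_hom_id]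

/-- An object with local endomorphism ring that is a direct summand of a sum of objects with
local endomorphism rings is isomorphic to one of them. -/
lemma exists_iso_of_mem_throughSubgroup {ι : Type*} {Q : ι → C} (hQ : ∀ i, HasLocalEnd (Q i))
    {X : C} (hX : HasLocalEnd X) (h : 𝟙 X ∈ throughSubgroup Q X) : ∃ i, Nonempty (X ≅ Q i) := by
  obtain ⟨i, f, g, hfg⟩ := exists_isIso_of_mem_throughSubgroup hX h inferInstance
  refine ⟨i, ?_⟩
  have h1 : f ≫ g ≫ inv (f ≫ g) = 𝟙 X := by rw [← Category.assoc, IsIso.hom_inv_id]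
  -- This is the idempotent of `Q i` that cuts out X. As `Q i` is local, the idempotent or its
  -- complement is invertible. In the first case it is the identity; in the second it is zero, which
  -- would force X to be zero.
  have hidem : (g ≫ inv (f ≫ g) ≫ f) ≫ (g ≫ inv (f ≫ g) ≫ f) = g ≫ inv (f ≫ g) ≫ f := by
    simp only [Category.assoc]
    rw [reassoc_of% h1]
  rcases (hQ i).2 (g ≫ inv (f ≫ g) ≫ f) (𝟙 _ - g ≫ inv (f ≫ g) ≫ f) (by abel) with h2 | h2
  · refine ⟨⟨f, g ≫ inv (f ≫ g), h1, ?_⟩⟩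
    rw [Category.assoc, ← cancel_epi (g ≫ inv (f ≫ g) ≫ f), hidem, Category.comp_id]
  · exfalso
    have h3 : g ≫ inv (f ≫ g) ≫ f = 0 := by
      rw [← cancel_mono (𝟙 _ - g ≫ inv (f ≫ g) ≫ f), Preadditive.comp_sub, hidem,
        Category.comp_id, sub_self, zero_comp]
    apply hX.1
    calc 𝟙 X = f ≫ (g ≫ inv (f ≫ g) ≫ f) ≫ g ≫ inv (f ≫ g) := by
          simp only [Category.assoc]
          rw [h1, Category.comp_id, h1]
      _ = 0 := by rw [h3, zero_comp, comp_zero]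

/-- The uniqueness part of the Krull-Schmidt theorem for multiplicity-free decompositions. -/
lemma exists_equiv_of_throughSubgroup {ι κ : Type*} {P : ι → C} {Q : κ → C}
    (hP : ∀ i, HasLocalEnd (P i)) (hQ : ∀ i, HasLocalEnd (Q i))
    (hP' : ∀ i j, Nonempty (P i ≅ P j) → i = j) (hQ' : ∀ i j, Nonempty (Q i ≅ Q j) → i = j)
    (h : ∀ i, 𝟙 (P i) ∈ throughSubgroup Q (P i)) (h' : ∀ i, 𝟙 (Q i) ∈ throughSubgroup P (Q i)) :
    ∃ σ : ι ≃ κ, ∀ i, Nonempty (P i ≅ Q (σ i)) := by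
  choose f hf using fun i => exists_iso_of_mem_throughSubgroup hQ (hP i) (h i)
  choose g hg using fun i => exists_iso_of_mem_throughSubgroup hP (hQ i) (h' i)
  exact ⟨⟨f, g, fun i => (hP' _ _ ⟨(hf i).some ≪≫ (hg (f i)).some⟩).symm,
    fun j => (hQ' _ _ ⟨(hg j).some ≪≫ (hf (g j)).some⟩).symm⟩, hf⟩

end KrullSchmidt

/-! ### Regular modules and uniqueness of basic reductions -/

section Regular

open MulOpposite (op unop)

/-- Fitting's lemma: indecomposable modules of finite length have local endomorphism rings. -/
lemma hasLocalEnd_of_indecomposable {R : Type*} [Ring R] (M : ModuleCat.{w} R) {N : Type*}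
    [AddCommGroup N] [Module R N] [IsArtinian R N] [IsNoetherian R N] (e : M ≃ₗ[R] N)
    (hN : IsIndecomposableModule R N) : HasLocalEnd M := by
  let c : Module.End R M ≃+* Module.End R N := e.conjRingEquiv
  have hiso : ∀ f : M ⟶ M, IsUnit (c f.hom) → IsIso f := by
    intro f hf
    have h2 := (Module.End.isUnit_iff _).1 ((MulEquiv.isUnit_map c).1 hf)
    exact (LinearEquiv.ofBijective f.hom h2).toModuleIso.isIso_hom
  refine ⟨fun h => ?_, fun a b hab => ?_⟩
  · obtain ⟨x, y, hxy⟩ := hN.1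
    apply hxy
    have h0 : ∀ z : M, z = 0 := fun z => congrArg (fun f : M ⟶ M => f.hom z) h
    rw [← e.apply_symm_apply x, ← e.apply_symm_apply y, h0 (e.symm x), h0 (e.symm y)]
  · have hsum : c a.hom + c b.hom = 1 := by
      rw [← map_add, ← ModuleCat.hom_add, hab]
      exact map_one c
    -- Fitting's decomposition holds for all large exponents; a positive one is chosen so that
    -- invertibility of the power implies invertibility of `a`. If instead the range of the power is
    -- zero, `a` is nilpotent and `b = 1 - a` is invertible.
    obtain ⟨n, hn, hpos⟩ := ((LinearMap.eventually_isCompl_ker_pow_range_pow (c a.hom)).and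
      (Filter.eventually_ge_atTop 1)).exists
    rcases hN.2 _ _ hn with h | h
    · left
      apply hiso
      have h1 : LinearMap.range (c a.hom ^ n) = ⊤ := by
        have := hn.sup_eq_top
        rwa [h, bot_sup_eq] at this
      have hu : IsUnit (c a.hom ^ n) :=
        (Module.End.isUnit_iff _).2 ⟨LinearMap.ker_eq_bot.1 h, LinearMap.range_eq_top.1 h1⟩
      exact (isUnit_pow_iff (Nat.one_le_iff_ne_zero.1 hpos)).1 hu
    · right
      apply hiso
      have h1 : IsNilpotent (c a.hom) := ⟨n, LinearMap.range_eq_bot.1 h⟩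
      have h2 := h1.isUnit_one_sub
      rwa [← hsum, add_sub_cancel_left] at h2

variable {k : Type u} [Field k] {B : Type v} [Ring B]

variable (B) in
/-- The right regular module of `B`. -/
def regularModule : ModuleCat.{max w v} Bᵐᵒᵖ := ModuleCat.of Bᵐᵒᵖ (ULift.{w} B)

namespace regularModule

/-- The morphism `b ↦ n b` from the regular module. -/
def desc {N : ModuleCat.{max w v} Bᵐᵒᵖ} (n : N) : regularModule.{w} B ⟶ N :=
  ModuleCat.ofHom (X := ULift.{w} B)
    { toFun := fun b => op b.down • n
      map_add' := fun a b => add_smul (op a.down) (op b.down) n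
      map_smul' := fun c b => mul_smul c (op b.down) n }

/-- The generator of the regular module. -/
def gen : regularModule.{w} B := ULift.up 1

lemma desc_gen {N : ModuleCat.{max w v} Bᵐᵒᵖ} (n : N) : (desc n).hom gen = n := one_smul _ n

lemma desc_hom_gen {N : ModuleCat.{max w v} Bᵐᵒᵖ} (f : regularModule.{w} B ⟶ N) :
    desc (f.hom gen) = f := by
  ext (b : ULift.{w} B)
  refine (map_smul f.hom (op b.down) gen).symm.trans (congrArg f.hom ?_)
  exact congrArg ULift.up (one_mul b.down)

lemma desc_comp {N N' : ModuleCat.{max w v} Bᵐᵒᵖ} (n : N) (f : N ⟶ N') :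
    desc n ≫ f = desc (f.hom n) := by
  rw [← desc_hom_gen (desc n ≫ f), ModuleCat.hom_comp, LinearMap.comp_apply, desc_gen]

lemma desc_add {N : ModuleCat.{max w v} Bᵐᵒᵖ} (n n' : N) :
    desc (n + n') = desc n + desc n' := by
  ext (b : ULift.{w} B)
  exact smul_add (op b.down) n n'

lemma desc_zero {N : ModuleCat.{max w v} Bᵐᵒᵖ} : desc (0 : N) = 0 := by
  ext (b : ULift.{w} B)
  exact smul_zero (op b.down)

/-- If morphisms out of the regular module are detected by `Y`, then the regular module is a
direct summand of a power of `Y`. -/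
lemma id_mem_throughSubgroup {Y : ModuleCat.{max w v} Bᵐᵒᵖ}
    (h : ∀ (N : ModuleCat.{max w v} Bᵐᵒᵖ) (f : regularModule.{w} B ⟶ N),
      (∀ t : Y ⟶ regularModule.{w} B, t ≫ f = 0) → f = 0) :
    𝟙 (regularModule.{w} B) ∈ throughSubgroup (fun _ : Unit => Y) (regularModule.{w} B) := by
  -- The trace of `Y` in the regular module. The quotient map by `T` is killed by every morphism
  -- from `Y`, so by hypothesis it is zero and `T` is everything. The generator 1 is then a finite
  -- sum of values of such morphisms.
  let T : Submodule Bᵐᵒᵖ (regularModule.{w} B) :=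
    ⨆ t : Y ⟶ regularModule.{w} B, LinearMap.range t.hom
  have hT : T = ⊤ := by
    have h1 := h (ModuleCat.of Bᵐᵒᵖ (regularModule.{w} B ⧸ T)) (ModuleCat.ofHom T.mkQ)
      (fun t => by
        ext y
        exact (Submodule.Quotient.mk_eq_zero T).2 (Submodule.mem_iSup_of_mem t ⟨y, rfl⟩))
    rw [← Submodule.ker_mkQ T]
    exact LinearMap.ker_eq_top.2 (congrArg ModuleCat.Hom.hom h1)
  have key : ∀ x ∈ T, desc x ∈ throughSubgroup (fun _ : Unit => Y) (regularModule.{w} B) := by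
    intro x hx
    induction hx using Submodule.iSup_induction' with
    | mem t x hx =>
      obtain ⟨y, rfl⟩ := hx
      rw [← desc_comp]
      exact comp_mem_throughSubgroup (fun _ : Unit => Y) (i := ()) _ _
    | zero => rw [desc_zero]; exact zero_mem _
    | add x y _ _ hx hy => rw [desc_add]; exact add_mem hx hy
  have h2 := key gen (hT ▸ Submodule.mem_top)
  rwa [← desc_hom_gen (𝟙 (regularModule.{w} B))]

/-- An equivalence preserves generators. Elements of a `B₂`-module are morphisms from the regular
module of `B₂`, so a morphism f of `B`-modules whose composites with all morphisms from the preimage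
of that module vanish has an image under the equivalence that kills every element. -/
lemma id_mem_throughSubgroup_inverse {B₂ : Type v} [Ring B₂]
    (e : ModuleCat.{max w v} Bᵐᵒᵖ ≌ ModuleCat.{max w v} B₂ᵐᵒᵖ) [e.functor.Additive] :
    𝟙 (regularModule.{w} B) ∈ throughSubgroup
      (fun _ : Unit => e.inverse.obj (regularModule.{w} B₂)) (regularModule.{w} B) := by
  refine id_mem_throughSubgroup fun N f hf => e.functor.map_injective ?_
  rw [e.functor.map_zero]
  ext x
  -- The element x, read as a morphism from the regular module of `B₂`, is transposed along the
  -- adjunction of `e.inverse` with `e.functor`, so that the hypothesis on f applies.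
  have h1 := hf ((e.symm.toAdjunction.homEquiv _ _).symm (desc x))
  have h2 : desc x ≫ e.functor.map f = 0 := by
    apply (e.symm.toAdjunction.homEquiv _ _).symm.injective
    have h3 := e.symm.toAdjunction.homEquiv_naturality_right_symm (desc x) f
    refine h3.trans (h1.trans ?_)
    rw [Adjunction.homEquiv_counit]
    have : e.inverse.Additive := e.inverse.additive_of_preserves_binary_products
    exact ((congrArg (· ≫ _) (e.inverse.map_zero _ _)).trans zero_comp).symm
  have h4 := desc_gen (e.functor.map f |>.hom x)
  rw [← desc_comp, h2] at h4
  exact h4.symm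

variable [Algebra k B]

open ModuleCat.Algebra in
/-- `B` is the endomorphism algebra of its right regular module. -/
def endEquiv : End (regularModule.{w} B) ≃ₐ[k] B :=
  AlgEquiv.ofLinearEquiv
    { toFun := fun f => ULift.down (show ULift.{w} B from f.hom gen)
      invFun := fun b => desc (ULift.up b : ULift.{w} B)
      map_add' := fun f f' => rfl
      map_smul' := fun c f => by
        change (show ULift.{w} B from f.hom gen).down * algebraMap k B c = c • _
        rw [Algebra.smul_def, Algebra.commutes]
      left_inv := fun f => desc_hom_gen f
      right_inv := fun b => mul_one b }
    rfl
    (fun f f' => by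
      have h := map_smul f.hom (op (show ULift.{w} B from f'.hom gen).down) gen
      have h2 : op (show ULift.{w} B from f'.hom gen).down • gen.{w} (B := B) = f'.hom gen :=
        congrArg ULift.up (one_mul _)
      rw [h2] at h
      exact congrArg ULift.down h)

end regularModule

/-- A finite internal direct sum decomposition of a module as a biproduct of modules. -/
lemma exists_iso_biproduct {R : Type*} [Ring R] (M : ModuleCat.{w} R) {N : Type v}
    [AddCommGroup N] [Module R N] {ι : Type} [Fintype ι] [DecidableEq ι]
    {P : ι → Submodule R N} (hP : DirectSum.IsInternal P) (e : M ≃ₗ[R] N)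
    (X : ι → ModuleCat.{w} R) (f : ∀ i, X i ≃ₗ[R] P i) : Nonempty (M ≅ biproduct X) := by
  let c : (DirectSum ι fun i => P i) ≃ₗ[R] N :=
    LinearEquiv.ofBijective (DirectSum.coeLinearMap P) hP
  have hc : ∀ i (x : P i), c.symm x.1 = DirectSum.lof R ι (fun i => P i) i x := by
    intro i x
    rw [LinearEquiv.symm_apply_eq]
    exact (DirectSum.coeLinearMap_lof P i x).symm
  let b : Bicone X :=
    { pt := M
      ι := fun i => ModuleCat.ofHom (e.symm.toLinearMap ∘ₗ (P i).subtype ∘ₗ (f i).toLinearMap)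
      π := fun i => ModuleCat.ofHom ((f i).symm.toLinearMap ∘ₗ
        DirectSum.component R ι (fun i => P i) i ∘ₗ c.symm.toLinearMap ∘ₗ e.toLinearMap)
      ι_π := fun i j => by
        ext x
        have h1 : c.symm (e (e.symm (f i x).1)) = DirectSum.lof R ι (fun i => P i) i (f i x) := by
          rw [e.apply_symm_apply, hc]
        split_ifs with h
        · subst h
          change (f i).symm (DirectSum.component R ι (fun i => P i) i
            (c.symm (e (e.symm (f i x).1)))) = x
          rw [h1, DirectSum.component.lof_self, LinearEquiv.symm_apply_apply]
        · change (f j).symm (DirectSum.component R ι (fun i => P i) j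
            (c.symm (e (e.symm (f i x).1)))) = 0
          rw [h1, DirectSum.component.of, dif_neg h, map_zero] }
  refine ⟨biproduct.uniqueUpToIso X (b := b) (isBilimitOfTotal b ?_)⟩
  ext m
  obtain ⟨m, rfl⟩ := (c.trans e.symm).surjective m
  induction m using DirectSum.induction_on with
  | zero => rw [map_zero, map_zero, map_zero]
  | add x y hx hy => rw [map_add, map_add, map_add, hx, hy]
  | of i x =>
    have h1 : (c.trans e.symm) (DirectSum.of (fun i => P i) i x) = e.symm x.1 :=
      congrArg e.symm (DirectSum.coeLinearMap_lof P i x)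
    rw [h1]
    have h2 : c.symm (e (e.symm x.1)) = DirectSum.lof R ι (fun i => P i) i x := by
      rw [e.apply_symm_apply, hc]
    rw [ModuleCat.hom_sum, LinearMap.sum_apply, Finset.sum_eq_single i]
    · change e.symm (f i ((f i).symm (DirectSum.component R ι (fun i => P i) i
        (c.symm (e (e.symm x.1)))))).1 = e.symm x.1
      rw [h2, DirectSum.component.lof_self, LinearEquiv.apply_symm_apply]
    · intro j _ hj
      change e.symm (f j ((f j).symm (DirectSum.component R ι (fun i => P i) j
        (c.symm (e (e.symm x.1)))))).1 = 0
      rw [h2, DirectSum.component.of, dif_neg (Ne.symm hj), map_zero, map_zero]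
      exact map_zero e.symm
    · simp

variable [Algebra k B]

/-- The multiplicity-free decomposition of the regular module of a basic algebra. -/
lemma IsBasicAlgebra.exists_decomposition (hB : IsBasicAlgebra k B) :
    ∃ (n : ℕ) (X : Fin n → ModuleCat.{max w v} Bᵐᵒᵖ), (∀ i, HasLocalEnd (X i)) ∧
      (∀ i j, Nonempty (X i ≅ X j) → i = j) ∧ Nonempty (regularModule.{w} B ≅ biproduct X) := by
  obtain ⟨n, P, hP, hind, hiso⟩ := hB.decomposition
  have := hB.finiteDimensional
  have h1 : IsArtinian Bᵐᵒᵖ B := isArtinian_of_tower k inferInstance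
  have h2 : IsNoetherian Bᵐᵒᵖ B := isNoetherian_of_tower k inferInstance
  let X : Fin n → ModuleCat.{max w v} Bᵐᵒᵖ := fun i => ModuleCat.of Bᵐᵒᵖ (ULift.{w} (P i))
  let f : ∀ i, X i ≃ₗ[Bᵐᵒᵖ] P i := fun i => ULift.moduleEquiv
  refine ⟨n, X, fun i => hasLocalEnd_of_indecomposable _ (f i) (hind i), ?_, ?_⟩
  · rintro i j ⟨φ⟩
    exact hiso i j ⟨(f i).symm.trans (φ.toLinearEquiv.trans (f j))⟩
  · exact exists_iso_biproduct _ hP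
      (show (regularModule.{w} B) ≃ₗ[Bᵐᵒᵖ] B from ULift.moduleEquiv) X f

lemma biproduct_total {C : Type*} [Category C] [Preadditive C] {ι : Type*} [Fintype ι] (X : ι → C)
    [HasBiproduct X] : ∑ i, biproduct.π X i ≫ biproduct.ι X i = 𝟙 (biproduct X) :=
  IsBilimit.total (biproduct.isBilimit X)

lemma id_mem_throughSubgroup_of_iso {C : Type*} [Category C] [Preadditive C]
    [HasFiniteBiproducts C] {ι : Type*} [Finite ι] {X : ι → C} {Y : C} (φ : Y ≅ biproduct X) :
    𝟙 Y ∈ throughSubgroup X Y := by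
  let _ := Fintype.ofFinite ι
  have h : 𝟙 Y = ∑ i, (φ.hom ≫ biproduct.π X i) ≫ biproduct.ι X i ≫ φ.inv := by
    have h0 : ∑ i, biproduct.π X i ≫ biproduct.ι X i = 𝟙 (biproduct X) := biproduct_total X
    have h1 := congrArg (fun z : biproduct X ⟶ biproduct X => φ.hom ≫ z ≫ φ.inv) h0
    simp only [Preadditive.comp_sum, Preadditive.sum_comp, Category.id_comp,
      Iso.hom_inv_id] at h1
    simp only [Category.assoc] at h1 ⊢
    exact h1.symm
  rw [h]
  exact sum_mem fun i _ => comp_mem_throughSubgroup X _ _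

lemma id_mem_throughSubgroup_of_retract {C : Type*} [Category C] [Preadditive C]
    {ι : Type*} {X : ι → C} {Y Z : C} (f : Z ⟶ Y) (g : Y ⟶ Z) (hfg : f ≫ g = 𝟙 Z)
    (h : 𝟙 Y ∈ throughSubgroup X Y) : 𝟙 Z ∈ throughSubgroup X Z := by
  have := conj_mem_throughSubgroup h f g
  rwa [Category.id_comp, hfg] at this

open ModuleCat.Algebra in
/-- Basic algebras with equivalent categories of right modules are isomorphic. -/
theorem IsBasicAlgebra.nonempty_algEquiv (hB : IsBasicAlgebra k B) {B₂ : Type v} [Ring B₂]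
    [Algebra k B₂] (hB₂ : IsBasicAlgebra k B₂)
    (e : ModuleCat.{max w v} Bᵐᵒᵖ ≌ ModuleCat.{max w v} B₂ᵐᵒᵖ) [e.functor.Linear k] :
    Nonempty (B ≃ₐ[k] B₂) := by
  have hadd : e.functor.Additive := e.functor.additive_of_preserves_binary_products
  have hadd' : e.symm.functor.Additive := e.inverse.additive_of_preserves_binary_products
  obtain ⟨n, P, hP, hPiso, ⟨φ⟩⟩ := IsBasicAlgebra.exists_decomposition.{w} hB
  obtain ⟨m, Q, hQ, hQiso, ⟨ψ⟩⟩ := IsBasicAlgebra.exists_decomposition.{w} hB₂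
  let F := e.functor
  let φ' : F.obj (regularModule.{w} B) ≅ biproduct fun i => F.obj (P i) :=
    F.mapIso φ ≪≫ F.mapBiproduct P
  -- The regular module of `B` is a retract of a finite sum of copies of the preimage of that of
  -- `B₂`. Applying F and the counit, its image is a retract of a sum of copies of the regular
  -- module of `B₂`, hence of indecomposables `Q j`. The converse, `h2`, uses the inverse
  -- equivalence.
  have h1 : 𝟙 (F.obj (regularModule.{w} B)) ∈ throughSubgroup Q (F.obj (regularModule.{w} B)) := by
    have ha := map_mem_throughSubgroup F
      (regularModule.id_mem_throughSubgroup_inverse.{w} (B := B) (B₂ := B₂) e)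
    rw [F.map_id] at ha
    refine throughSubgroup_trans (fun _ => ?_) ha
    exact id_mem_throughSubgroup_of_iso ((e.counitIso.app _).trans ψ)
  have h2 : 𝟙 (regularModule.{w} B₂) ∈
      throughSubgroup (fun i => F.obj (P i)) (regularModule.{w} B₂) := by
    refine throughSubgroup_trans (fun _ => ?_)
      (regularModule.id_mem_throughSubgroup_inverse.{w} (B := B₂) (B₂ := B) e.symm)
    exact id_mem_throughSubgroup_of_iso φ'
  obtain ⟨σ, hσ⟩ := exists_equiv_of_throughSubgroup (P := fun i => F.obj (P i)) (Q := Q)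
    (fun i => (hP i).map F) hQ (fun i j ⟨θ⟩ => hPiso i j ⟨F.preimageIso θ⟩) hQiso
    (fun i => id_mem_throughSubgroup_of_retract (biproduct.ι (fun i => F.obj (P i)) i ≫ φ'.inv)
      (φ'.hom ≫ biproduct.π (fun i => F.obj (P i)) i) (by simp) h1)
    (fun j => id_mem_throughSubgroup_of_retract (biproduct.ι Q j ≫ ψ.inv)
      (ψ.hom ≫ biproduct.π Q j) (by simp) h2)
  -- Every indecomposable occurs exactly once on either side, so matching the isomorphism classes
  -- already gives an isomorphism of the two sums.
  let θ : F.obj (regularModule.{w} B) ≅ regularModule.{w} B₂ :=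
    φ' ≪≫ biproduct.whiskerEquiv σ (fun i => (hσ i).some.symm) ≪≫ ψ.symm
  let α : End (regularModule.{w} B) ≃ₐ[k] End (F.obj (regularModule.{w} B)) :=
    AlgEquiv.ofLinearEquiv
      { Functor.FullyFaithful.homEquiv (.ofFullyFaithful F) with
        map_add' := fun f g => F.map_add
        map_smul' := fun c f => F.map_smul c f }
      (F.map_id _) (fun f g => F.map_comp g f)
  let β : End (F.obj (regularModule.{w} B)) ≃ₐ[k] End (regularModule.{w} B₂) :=
    AlgEquiv.ofLinearEquiv
      { toFun := fun f => θ.inv ≫ f ≫ θ.hom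
        invFun := fun f => θ.hom ≫ f ≫ θ.inv
        map_add' := fun f g => by rw [Preadditive.add_comp, Preadditive.comp_add]
        map_smul' := fun c f => by rw [Linear.smul_comp, Linear.comp_smul]; rfl
        left_inv := fun f => by simp
        right_inv := fun f => by simp }
      (by simp [End.one_def]) (fun f g => by simp [End.mul_def])
  exact ⟨regularModule.endEquiv.symm.trans (α.trans (β.trans regularModule.endEquiv))⟩

/-- Basic reductions are unique up to isomorphism. -/
lemma IsBasicReduction.nonempty_algEquiv {S : Type (max uG v)} [Ring S] [Algebra k S]
    {B₂ : Type v} [Ring B₂] [Algebra k B₂] (h : IsBasicReduction k S B)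
    (h₂ : IsBasicReduction k S B₂) : Nonempty (B ≃ₐ[k] B₂) := by
  obtain ⟨⟨e⟩⟩ := h.morita
  obtain ⟨⟨e₂⟩⟩ := h₂.morita
  let E : ModuleCat.{max uG v} Bᵐᵒᵖ ≌ ModuleCat.{max uG v} B₂ᵐᵒᵖ := e.eqv.symm.trans e₂.eqv
  have : E.functor.Linear k := by
    have := e.symm.linear
    have := e₂.linear
    exact Functor.instLinearComp e.symm.eqv.functor e₂.eqv.functor
  exact IsBasicAlgebra.nonempty_algEquiv.{uG} h.basic h₂.basic E

end Regular

namespace CatAction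

open MulOpposite (op unop)

variable {k : Type u} [Field k] {G : Type uG} [Group G]
  {C : Type uD} [Category.{v} C] [Preadditive C] [Linear k C] {A : CatAction k G C}

namespace Linearisation

variable {X Y : C} (lX : A.Linearisation X) (lY : A.Linearisation Y)

lemma conj_zero (g : G) : lX.conj lY g 0 = 0 := by simp [conj]

lemma conj_sum (g : G) {ι : Type*} (s : Finset ι) (f : ι → (X ⟶ Y)) :
    lX.conj lY g (∑ i ∈ s, f i) = ∑ i ∈ s, lX.conj lY g (f i) := by
  simp [conj, Functor.map_sum, Preadditive.sum_comp, Preadditive.comp_sum]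

end Linearisation

/-! ### The Morita context between an equivariant endomorphism algebra and a skew group algebra -/

/-- Morphisms between the underlying objects of two equivariant objects. -/
def PlainHom (X Y : A.EquivObj) : Type v := X.obj ⟶ Y.obj

instance (X Y : A.EquivObj) : AddCommGroup (PlainHom X Y) :=
  inferInstanceAs (AddCommGroup (X.obj ⟶ Y.obj))

namespace EquivObj

variable {X Y Z : A.EquivObj}

/-- The action of `G` on morphisms by conjugation. -/
def conj (g : G) (f : X.obj ⟶ Y.obj) : X.obj ⟶ Y.obj := X.lin.conj Y.lin g f

lemma conj_comp (g : G) (f : X.obj ⟶ Y.obj) (f' : Y.obj ⟶ Z.obj) :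
    conj g (X := X) (Y := Z) (f ≫ f') = conj g f ≫ conj g f' := X.lin.conj_comp Y.lin Z.lin g f f'

lemma conj_conj (g h : G) (f : X.obj ⟶ Y.obj) : conj g (conj h f) = conj (g * h) f :=
  (X.lin.conj_mul Y.lin g h f).symm

lemma conj_sum (g : G) {ι : Type*} (s : Finset ι) (f : ι → (X.obj ⟶ Y.obj)) :
    conj g (∑ i ∈ s, f i) = ∑ i ∈ s, conj g (f i) := X.lin.conj_sum Y.lin g s f

lemma conj_add (g : G) (f f' : X.obj ⟶ Y.obj) : conj g (f + f') = conj g f + conj g f' :=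
  X.lin.conj_add Y.lin g f f'

lemma conj_zero (g : G) : conj g (0 : X.obj ⟶ Y.obj) = 0 := X.lin.conj_zero Y.lin g

lemma conj_one (f : X.obj ⟶ Y.obj) : conj 1 f = f := X.lin.conj_one Y.lin f

lemma conj_id (g : G) : conj g (𝟙 X.obj) = 𝟙 X.obj := X.lin.conj_id g

lemma conj_hom (g : G) (f : X ⟶ Y) : conj g f.1 = f.1 := f.2 g

variable [Fintype G]

/-- The sum of the conjugates of a morphism. -/
def transfer : (X.obj ⟶ Y.obj) →+ (X ⟶ Y) where
  toFun f := ⟨∑ g, conj g f, fun h => by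
    change conj h _ = _
    rw [conj_sum]
    refine Fintype.sum_equiv (Equiv.mulLeft h) _ _ fun g => ?_
    exact conj_conj h g f⟩
  map_zero' := Subtype.ext (Finset.sum_eq_zero fun g _ => conj_zero g)
  map_add' f f' := Subtype.ext (by
    change ∑ g, conj g (f + f') = (∑ g, conj g f) + ∑ g, conj g f'
    rw [← Finset.sum_add_distrib]
    exact Finset.sum_congr rfl fun g _ => conj_add g f f')

lemma transfer_val (f : X.obj ⟶ Y.obj) : (transfer f).1 = ∑ g, conj g f := rfl

/-- Conjugation fixes invariant morphisms, so they can be pulled out of the sum. On either side this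
makes the pairing with values in `End F` a map of bimodules. -/
lemma transfer_comp (f : X.obj ⟶ Y.obj) (t : Y ⟶ Z) :
    transfer (Y := Z) (f ≫ t.1) = transfer f ≫ t := by
  apply Subtype.ext
  change ∑ g, conj g (f ≫ t.1) = (∑ g, conj g f) ≫ t.1
  simp only [conj_comp, conj_hom, Preadditive.sum_comp]

lemma comp_transfer (t : X ⟶ Y) (f : Y.obj ⟶ Z.obj) :
    transfer (X := X) (t.1 ≫ f) = t ≫ transfer f := by
  apply Subtype.ext
  change ∑ g, conj g (t.1 ≫ f) = t.1 ≫ ∑ g, conj g f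
  simp only [conj_comp, conj_hom, Preadditive.comp_sum]

lemma transfer_conj (g : G) (f : X.obj ⟶ Y.obj) : transfer (conj g f) = transfer f := by
  apply Subtype.ext
  change ∑ h, conj h (conj g f) = ∑ h, conj h f
  simp only [conj_conj]
  exact Fintype.sum_equiv (Equiv.mulRight g) _ _ fun h => rfl

end EquivObj

/-! ### Identities between the two pairings and the actions of the skew group algebra -/

namespace EquivObj

variable {F E : A.EquivObj}

/-- The pairing with values in the skew group algebra. -/
def skewPair (p : F.obj ⟶ E.obj) (q : E.obj ⟶ F.obj) (g : G) : E.obj ⟶ E.obj :=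
  q ≫ conj g⁻¹ p

lemma skewPair_hom_comp (b : F ⟶ F) (p : F.obj ⟶ E.obj) (q : E.obj ⟶ F.obj) :
    skewPair (b.1 ≫ p) q = skewPair p (q ≫ b.1) := by
  funext l
  simp only [skewPair, conj_comp, conj_hom, Category.assoc]

open Classical in
/-- The element `(g, a)` of the skew group algebra. -/
def skewOf (g : G) (a : E.obj ⟶ E.obj) (l : G) : E.obj ⟶ E.obj := if l = g then a else 0

lemma skewOf_self (g : G) (a : E.obj ⟶ E.obj) : skewOf g a g = a := if_pos rfl

lemma skewOf_ne {g l : G} (h : l ≠ g) (a : E.obj ⟶ E.obj) : skewOf g a l = 0 := if_neg h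

variable [Fintype G]

/-- The product of the skew group algebra of the endomorphisms of an equivariant object. -/
def skewMul (s t : G → (E.obj ⟶ E.obj)) (l : G) : E.obj ⟶ E.obj :=
  ∑ h : G, t h ≫ conj h⁻¹ (s (l * h⁻¹))

/-- The left action of the skew group algebra on morphisms to `E`. -/
def skewAct (s : G → (E.obj ⟶ E.obj)) (p : F.obj ⟶ E.obj) : F.obj ⟶ E.obj :=
  ∑ g : G, conj g (p ≫ s g)

/-- The right action of the skew group algebra on morphisms from `E`. -/
def actSkew (q : E.obj ⟶ F.obj) (s : G → (E.obj ⟶ E.obj)) : E.obj ⟶ F.obj :=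
  ∑ g : G, s g ≫ conj g⁻¹ q

lemma sum_mul_inv_right {M : Type*} [AddCommMonoid M] (f : G → G → M) :
    ∑ l, ∑ h, f h (l * h⁻¹) = ∑ m, ∑ h, f h m := by
  rw [Finset.sum_comm, Finset.sum_comm (f := fun m h => f h m)]
  exact Finset.sum_congr rfl fun h _ => Fintype.sum_equiv (Equiv.mulRight h⁻¹) _ _ fun l => rfl

lemma skewAct_skewMul (s t : G → (E.obj ⟶ E.obj)) (p : F.obj ⟶ E.obj) :
    skewAct (skewMul s t) p = skewAct s (skewAct t p) := by
  simp only [skewAct, skewMul, Preadditive.comp_sum, Preadditive.sum_comp, conj_sum]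
  refine Eq.trans ?_ (sum_mul_inv_right fun h m => conj m (conj h (p ≫ t h) ≫ s m))
  simp only [conj_comp, conj_conj, inv_mul_cancel_right, Category.assoc]

lemma actSkew_skewMul (q : E.obj ⟶ F.obj) (s t : G → (E.obj ⟶ E.obj)) :
    actSkew q (skewMul s t) = actSkew (actSkew q s) t := by
  simp only [actSkew, skewMul, Preadditive.comp_sum, Preadditive.sum_comp, conj_sum]
  rw [Finset.sum_comm (f := fun h m => t h ≫ conj h⁻¹ (s m ≫ conj m⁻¹ q))]
  refine Eq.trans ?_ (sum_mul_inv_right fun h m => t h ≫ conj h⁻¹ (s m ≫ conj m⁻¹ q))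
  simp only [conj_comp, conj_conj, mul_inv_rev, inv_inv, inv_mul_cancel_left, Category.assoc]

lemma skewPair_actSkew (p : F.obj ⟶ E.obj) (q : E.obj ⟶ F.obj) (s : G → (E.obj ⟶ E.obj)) :
    skewPair p (actSkew q s) = skewMul (skewPair p q) s := by
  funext l
  simp only [skewPair, actSkew, skewMul, Preadditive.sum_comp, conj_comp, conj_conj,
    mul_inv_rev, inv_inv, inv_mul_cancel_left, Category.assoc]

lemma skewPair_skewAct (s : G → (E.obj ⟶ E.obj)) (p : F.obj ⟶ E.obj) (q : E.obj ⟶ F.obj) :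
    skewPair (skewAct s p) q = skewMul s (skewPair p q) := by
  funext l
  simp only [skewPair, skewAct, skewMul, Preadditive.comp_sum, conj_sum, conj_comp, conj_conj,
    Category.assoc]
  refine Fintype.sum_equiv ((Equiv.inv G).trans (Equiv.mulRight l)) _ _ fun g => ?_
  simp

/-- One of the two mixed associativity laws: both sides are the sum of q' ≫ conj g p ≫ conj g q over
g, with g replaced by its inverse on one side. -/
lemma actSkew_skewPair (p : F.obj ⟶ E.obj) (q q' : E.obj ⟶ F.obj) :
    actSkew q (skewPair p q') = q' ≫ (transfer (p ≫ q)).1 := by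
  simp only [actSkew, skewPair, transfer_val, Preadditive.comp_sum, conj_comp, Category.assoc]
  exact Fintype.sum_equiv (Equiv.inv G) _ _ fun g => rfl

lemma skewAct_skewPair (p p' : F.obj ⟶ E.obj) (q : E.obj ⟶ F.obj) :
    skewAct (skewPair p q) p' = (transfer (p' ≫ q)).1 ≫ p := by
  simp only [skewAct, skewPair, transfer_val, Preadditive.sum_comp, conj_comp, conj_conj,
    mul_inv_cancel, conj_one, Category.assoc]

/-- Balancedness over the skew group algebra. Conjugating the g-th term by g moves the twist from q
to p, and `transfer` does not notice conjugation. -/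
lemma transfer_actSkew (p : F.obj ⟶ E.obj) (q : E.obj ⟶ F.obj) (s : G → (E.obj ⟶ E.obj)) :
    transfer (p ≫ actSkew q s) = transfer (skewAct s p ≫ q) := by
  simp only [skewAct, actSkew, Preadditive.sum_comp, Preadditive.comp_sum, map_sum]
  refine Finset.sum_congr rfl fun g _ => ?_
  rw [← transfer_conj g]
  simp only [conj_comp, conj_conj, mul_inv_cancel, conj_one, Category.assoc]

lemma skewAct_hom_comp (b : F ⟶ F) (s : G → (E.obj ⟶ E.obj)) (p : F.obj ⟶ E.obj) :
    skewAct s (b.1 ≫ p) = b.1 ≫ skewAct s p := by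
  simp only [skewAct, Preadditive.comp_sum, conj_comp, conj_hom, Category.assoc]

lemma actSkew_comp_hom (b : F ⟶ F) (s : G → (E.obj ⟶ E.obj)) (q : E.obj ⟶ F.obj) :
    actSkew (q ≫ b.1) s = actSkew q s ≫ b.1 := by
  simp only [actSkew, Preadditive.sum_comp, conj_comp, conj_hom, Category.assoc]

lemma skewAct_skewOf (g : G) (a : E.obj ⟶ E.obj) (p : F.obj ⟶ E.obj) :
    skewAct (skewOf g a) p = conj g (p ≫ a) := by
  unfold skewAct
  rw [Finset.sum_eq_single g, skewOf_self]
  · intro l _ hl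
    rw [skewOf_ne hl, comp_zero, conj_zero]
  · simp

lemma actSkew_skewOf (g : G) (a : E.obj ⟶ E.obj) (q : E.obj ⟶ F.obj) :
    actSkew q (skewOf g a) = a ≫ conj g⁻¹ q := by
  unfold actSkew
  rw [Finset.sum_eq_single g, skewOf_self]
  · intro l _ hl
    rw [skewOf_ne hl, zero_comp]
  · simp

lemma skewAct_smul_id (c : k) (p : F.obj ⟶ E.obj) :
    skewAct (skewOf 1 (c • 𝟙 E.obj)) p = (c • 𝟙 F.obj) ≫ p := by
  rw [skewAct_skewOf, conj_one, Linear.comp_smul, Category.comp_id, Linear.smul_comp,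
    Category.id_comp]

lemma actSkew_smul_id (c : k) (q : E.obj ⟶ F.obj) :
    actSkew q (skewOf 1 (c • 𝟙 E.obj)) = q ≫ (c • 𝟙 F.obj) := by
  rw [actSkew_skewOf, inv_one, conj_one, Linear.comp_smul, Category.comp_id, Linear.smul_comp,
    Category.id_comp]

lemma skewAct_id (p : F.obj ⟶ E.obj) : skewAct (skewOf 1 (𝟙 E.obj)) p = p := by
  rw [skewAct_skewOf, conj_one, Category.comp_id]

lemma actSkew_id (q : E.obj ⟶ F.obj) : actSkew q (skewOf 1 (𝟙 E.obj)) = q := by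
  rw [actSkew_skewOf, inv_one, conj_one, Category.id_comp]

end EquivObj

/-! ### The bimodules Hom(F, E) and Hom(E, F) and their Morita context -/

namespace PlainHom

open EquivObj

variable (F E : A.EquivObj)

instance : Module (End F)ᵐᵒᵖ (PlainHom F E) where
  smul b p := b.unop.1 ≫ p
  one_smul p := Category.id_comp (X := F.obj) (Y := E.obj) p
  mul_smul b c p := Category.assoc (W := F.obj) (Z := E.obj) b.unop.1 c.unop.1 p
  smul_zero b := comp_zero (X := F.obj) (Z := E.obj) (f := b.unop.1)
  smul_add b p p' := Preadditive.comp_add F.obj F.obj E.obj b.unop.1 p p'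
  add_smul b c p := Preadditive.add_comp F.obj F.obj E.obj b.unop.1 c.unop.1 p
  zero_smul p := zero_comp (X := F.obj) (Z := E.obj) (f := p)

instance : Module (End F) (PlainHom E F) where
  smul b q := q ≫ b.1
  one_smul q := Category.comp_id (X := E.obj) (Y := F.obj) q
  mul_smul b c q := (Category.assoc (W := E.obj) (Z := F.obj) q c.1 b.1).symm
  smul_zero b := zero_comp (X := E.obj) (Z := F.obj) (f := b.1)
  smul_add b p p' := Preadditive.add_comp E.obj F.obj F.obj p p' b.1
  add_smul b c p := Preadditive.comp_add E.obj F.obj F.obj p b.1 c.1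
  zero_smul p := comp_zero (X := E.obj) (Z := F.obj) (f := p)

lemma algebraMap_end (c : k) : (algebraMap k (End F) c).1 = c • 𝟙 F.obj := by
  rw [Algebra.algebraMap_eq_smul_one]
  rfl

lemma one_eq_skewOf :
    (1 : SkewGroupAlgebra E.lin.endAction) = skewOf (E := E) 1 (𝟙 E.obj) := by
  classical
  funext l
  change (Pi.single (1 : G) (1 : End E.obj) : G → End E.obj) l = _
  by_cases h : l = 1
  · subst h
    rw [skewOf_self, Pi.single_eq_same]
    rfl
  · rw [skewOf_ne h, Pi.single_eq_of_ne h]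

variable [Fintype G]

instance : Module (SkewGroupAlgebra E.lin.endAction) (PlainHom F E) where
  smul s p := skewAct (F := F) (E := E) s p
  one_smul p := (congrArg (fun s => skewAct (F := F) (E := E) s p) (one_eq_skewOf E)).trans
    (skewAct_id _)
  mul_smul s t p := skewAct_skewMul (F := F) (E := E) s t p
  smul_zero s := Finset.sum_eq_zero fun g _ =>
    (congrArg (conj g) (zero_comp (X := F.obj) (f := s g))).trans (conj_zero g)
  smul_add s p p' := by
    refine (Finset.sum_congr rfl fun g _ => ?_).trans Finset.sum_add_distrib
    exact (congrArg (conj g) (Preadditive.add_comp F.obj E.obj E.obj p p' (s g))).trans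
      (conj_add g _ _)
  add_smul s t p := by
    refine (Finset.sum_congr rfl fun g _ => ?_).trans Finset.sum_add_distrib
    exact (congrArg (conj g) (Preadditive.comp_add F.obj E.obj E.obj p (s g) (t g))).trans
      (conj_add g _ _)
  zero_smul p := Finset.sum_eq_zero fun g _ =>
    (congrArg (conj g) (comp_zero (X := F.obj) (Z := E.obj) (f := p))).trans (conj_zero g)

instance : Module (SkewGroupAlgebra E.lin.endAction)ᵐᵒᵖ (PlainHom E F) where
  smul s q := actSkew (F := F) (E := E) q s.unop
  one_smul q := (congrArg (fun s => actSkew (F := F) (E := E) q s) (one_eq_skewOf E)).trans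
    (actSkew_id _)
  mul_smul s t q := actSkew_skewMul (F := F) (E := E) q t.unop s.unop
  smul_zero s := Finset.sum_eq_zero fun g _ =>
    (congrArg (s.unop g ≫ ·) (conj_zero (X := E) (Y := F) g⁻¹)).trans comp_zero
  smul_add s q q' := by
    refine (Finset.sum_congr rfl fun g _ => ?_).trans Finset.sum_add_distrib
    exact (congrArg (s.unop g ≫ ·) (conj_add (X := E) (Y := F) g⁻¹ q q')).trans
      (Preadditive.comp_add _ _ _ _ _ _)
  add_smul s t q := by
    refine (Finset.sum_congr rfl fun g _ => ?_).trans Finset.sum_add_distrib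
    exact Preadditive.add_comp E.obj E.obj F.obj (s.unop g) (t.unop g) (conj g⁻¹ q)
  zero_smul q := Finset.sum_eq_zero fun g _ => zero_comp (X := E.obj) (Z := F.obj)

lemma algebraMap_skew (c : k) :
    algebraMap k (SkewGroupAlgebra E.lin.endAction) c = skewOf (E := E) 1 (c • 𝟙 E.obj) := by
  rw [Algebra.algebraMap_eq_smul_one, one_eq_skewOf]
  funext l
  change c • skewOf (E := E) 1 (𝟙 E.obj) l = _
  by_cases h : l = 1
  · subst h
    rw [skewOf_self, skewOf_self]
  · rw [skewOf_ne h, skewOf_ne h, smul_zero]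

/-- The Morita context between `End F` in the equivariant category and the skew group algebra of
the endomorphisms of `E`. -/
def moritaContext : MoritaContext k (End F) (SkewGroupAlgebra E.lin.endAction)
    (PlainHom F E) (PlainHom E F) where
  left := AddMonoidHom.mk' (fun q => AddMonoidHom.mk'
      (fun p => transfer (X := F) (Y := F) ((p : F.obj ⟶ E.obj) ≫ (q : E.obj ⟶ F.obj)))
      (fun p p' => (congrArg transfer (Preadditive.add_comp F.obj E.obj F.obj p p' q)).trans
        (map_add transfer _ _)))
    (fun q q' => AddMonoidHom.ext fun p =>
      (congrArg transfer (Preadditive.comp_add F.obj E.obj F.obj p q q')).trans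
        (map_add transfer _ _))
  right := AddMonoidHom.mk' (fun p => AddMonoidHom.mk'
      (fun q => skewPair (F := F) (E := E) p q)
      (fun q q' => funext fun g => Preadditive.add_comp E.obj F.obj E.obj q q' (conj g⁻¹ p)))
    (fun p p' => AddMonoidHom.ext fun q => funext fun g =>
      (congrArg (fun z : F.obj ⟶ E.obj => (q : E.obj ⟶ F.obj) ≫ z)
        (conj_add (X := F) (Y := E) g⁻¹ p p')).trans (Preadditive.comp_add _ _ _ _ _ _))
  left_smul q p b := (congrArg transfer (Category.assoc (W := F.obj) (Z := F.obj) b.1 p q)).trans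
    (comp_transfer b _)
  smul_left b q p :=
    (congrArg transfer (Category.assoc (W := F.obj) (Z := F.obj) p q b.1)).symm.trans
      (transfer_comp _ b)
  left_balanced q p s := transfer_actSkew (F := F) (E := E) p q s
  right_smul p q s := skewPair_actSkew (F := F) (E := E) p q s
  smul_right s p q := skewPair_skewAct (F := F) (E := E) s p q
  right_balanced p q b := skewPair_hom_comp (F := F) (E := E) b p q
  left_comp q q' p := (actSkew_skewPair (F := F) (E := E) p q q').symm
  right_comp p p' q := skewAct_skewPair (F := F) (E := E) p p' q
  commP b s p := (skewAct_hom_comp (F := F) (E := E) b s p).symm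
  commQ b s q := actSkew_comp_hom (F := F) (E := E) b s q
  algebraP c p := (congrArg (fun s => skewAct (F := F) (E := E) s p) (algebraMap_skew E c)).trans
    ((skewAct_smul_id (F := F) (E := E) c p).trans
      (congrArg (· ≫ (p : F.obj ⟶ E.obj)) (algebraMap_end F c)).symm)
  algebraQ c q := (congrArg ((q : E.obj ⟶ F.obj) ≫ ·) (algebraMap_end F c)).trans
    ((actSkew_smul_id (F := F) (E := E) c q).symm.trans
      (congrArg (fun s => actSkew (F := F) (E := E) q s) (algebraMap_skew E c)).symm)

variable {F E}

/-- Maschke's averaging: `transfer` maps every morphism factoring through E to a value of the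
pairing, and it maps the identity to |G|. As the trace is closed under multiplication by `End F`,
dividing by |G| gives 1. -/
lemma one_mem_trace (hG : (Fintype.card G : k) ≠ 0)
    (h : 𝟙 F.obj ∈ throughSubgroup (fun _ : Unit => E.obj) F.obj) :
    (1 : End F) ∈ (moritaContext F E).trace := by
  have key : ∀ z ∈ throughSubgroup (fun _ : Unit => E.obj) F.obj,
      (transfer z : F ⟶ F) ∈ (moritaContext F E).trace := by
    intro z hz
    induction hz using AddSubgroup.closure_induction with
    | mem z hz =>
      obtain ⟨_, p, q, rfl⟩ := hz
      exact (moritaContext F E).left_mem_trace q p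
    | zero => rw [map_zero]; exact zero_mem (moritaContext F E).trace
    | add x y _ _ hx hy => rw [map_add]; exact add_mem hx hy
    | neg x _ hx => rw [map_neg]; exact neg_mem hx
  have h1 := (moritaContext F E).mul_mem_trace
    (algebraMap k (End F) (Fintype.card G : k)⁻¹) (key _ h)
  have h2 : (transfer (𝟙 F.obj) : F ⟶ F) = algebraMap k (End F) (Fintype.card G : k) := by
    apply Subtype.ext
    rw [algebraMap_end, transfer_val]
    simp only [conj_id, Finset.sum_const, Finset.card_univ, Nat.cast_smul_eq_nsmul]
  rwa [h2, ← map_mul, inv_mul_cancel₀ hG, map_one] at h1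

end PlainHom

end CatAction

namespace CatAction

variable {k : Type u} [Field k] {G : Type uG} [Group G]
  {C : Type uD} [Category.{v} C] [Preadditive C] [Linear k C] {A : CatAction k G C}

/-! ### The trace ideal in the skew group algebra -/

namespace PlainHom

open EquivObj

variable {F E : A.EquivObj}

/-- The element `(g, a)` of the skew group algebra. -/
def single (E : A.EquivObj) (g : G) (a : E.obj ⟶ E.obj) : SkewGroupAlgebra E.lin.endAction :=
  skewOf g a

lemma single_eq_of (g : G) (a : E.obj ⟶ E.obj) :
    single E g a = SkewGroupAlgebra.of (B := End E.obj) E.lin.endAction g a := by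
  classical
  funext l
  change skewOf g a l = (Pi.single g a : G → End E.obj) l
  by_cases h : l = g
  · subst h
    rw [skewOf_self, Pi.single_eq_same]
  · rw [skewOf_ne h, Pi.single_eq_of_ne h]

lemma single_add (g : G) (a b : E.obj ⟶ E.obj) :
    single E g (a + b) = single E g a + single E g b := by
  funext l
  change skewOf g (a + b) l = skewOf g a l + skewOf g b l
  unfold skewOf
  split_ifs
  · rfl
  · exact (add_zero _).symm

/-- `a ↦ (g, a)` as a homomorphism of additive groups. -/
def singleHom (E : A.EquivObj) (g : G) : (E.obj ⟶ E.obj) →+ SkewGroupAlgebra E.lin.endAction :=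
  AddMonoidHom.mk' (single E g) (single_add g)

variable [Fintype G]

lemma single_mul_single (g h : G) (a b : E.obj ⟶ E.obj) :
    single E g a * single E h b = single E (g * h) (b ≫ conj h⁻¹ a) := by
  rw [single_eq_of, single_eq_of, SkewGroupAlgebra.of_mul_of, single_eq_of]
  rfl

/-- The ideal of endomorphisms `a` of `E` such that `(1, a)` lies in the trace ideal. -/
def unitTrace (F E : A.EquivObj) : AddSubgroup (E.obj ⟶ E.obj) :=
  (moritaContext F E).symm.trace.comap (singleHom E 1)

lemma mem_unitTrace {a : E.obj ⟶ E.obj} :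
    a ∈ unitTrace F E ↔ single E 1 a ∈ (moritaContext F E).symm.trace := Iff.rfl

/-- The product (g, y') (1, a) (g⁻¹, x), with y' the conjugate of y by g⁻¹, has group component 1
and equals (1, x ≫ conj g a ≫ y). Thus the ideal is stable under the action of G as well. -/
lemma conj_mem_unitTrace {a : E.obj ⟶ E.obj} (ha : a ∈ unitTrace F E) (g : G)
    (x y : E.obj ⟶ E.obj) : x ≫ conj g a ≫ y ∈ unitTrace F E := by
  have h1 := (moritaContext F E).symm.mul_mem_trace (single E g (conj g⁻¹ y)) (mem_unitTrace.1 ha)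
  have h2 := (moritaContext F E).symm.trace_mul_mem (single E g⁻¹ x) h1
  rw [single_mul_single, single_mul_single, mul_one, mul_inv_cancel, inv_inv, inv_one, conj_one,
    conj_comp, conj_conj, mul_inv_cancel, conj_one] at h2
  exact h2

/-- A criterion for `(1, π ≫ ι)` to lie in the trace ideal, where `ι` and `π` exhibit `X` as a
direct summand of `E`. -/
lemma mem_unitTrace_of_sum {X : C} (ι : X ⟶ E.obj) (π : E.obj ⟶ X) {σ : Type*} [Fintype σ]
    (t : σ → k) (q : σ → (X ⟶ F.obj)) (p : σ → (F.obj ⟶ X))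
    (h1 : ∑ s, t s • (q s ≫ p s) = 𝟙 X)
    (h0 : ∀ g : G, g ≠ 1 → ∑ s, t s • (q s ≫ (F.lin.iso g).hom ≫ (A.act g).map (p s)) = 0) :
    π ≫ ι ∈ unitTrace F E := by
  -- The component at g of the right-hand side contains the sum of `h1` if g = 1, and otherwise the
  -- sum of `h0` at g⁻¹, between `π` and a morphism built from `ι`. Hence only the component at 1
  -- survives.
  have key : single E 1 (π ≫ ι) =
      ∑ s, (moritaContext F E).right (p s ≫ ι : F.obj ⟶ E.obj)
        (t s • (π ≫ q s) : E.obj ⟶ F.obj) := by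
    funext g
    have hs : (∑ s, (moritaContext F E).right (p s ≫ ι : F.obj ⟶ E.obj)
        (t s • (π ≫ q s) : E.obj ⟶ F.obj)) g =
        ∑ s, skewPair (F := F) (E := E) (p s ≫ ι) (t s • (π ≫ q s)) g :=
      Finset.sum_apply (M := fun _ : G => End E.obj) g _ _
    rw [hs]
    unfold skewPair single
    by_cases hg : g = 1
    · subst hg
      rw [skewOf_self]
      have h2 := congrArg (fun z => π ≫ z ≫ ι) h1
      simp only [Preadditive.sum_comp, Preadditive.comp_sum, Linear.smul_comp, Linear.comp_smul,
        Category.id_comp, Category.assoc] at h2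
      rw [← h2]
      simp only [inv_one, conj_one, Linear.smul_comp, Category.assoc]
    · rw [skewOf_ne hg]
      have h2 := congrArg (fun z => π ≫ z ≫ (A.act g⁻¹).map ι ≫ (E.lin.iso g⁻¹).inv)
        (h0 g⁻¹ (fun h => hg (inv_eq_one.1 h)))
      simp only [Preadditive.sum_comp, Preadditive.comp_sum, Linear.smul_comp, Linear.comp_smul,
        zero_comp, comp_zero, Category.assoc] at h2
      rw [← h2]
      simp only [EquivObj.conj, Linearisation.conj, Linear.smul_comp, Functor.map_comp,
        Category.assoc]
  rw [mem_unitTrace, key]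
  exact sum_mem fun s _ => (moritaContext F E).symm.left_mem_trace _ _

lemma one_mem_symm_trace (h : 𝟙 E.obj ∈ unitTrace F E) :
    (1 : SkewGroupAlgebra E.lin.endAction) ∈ (moritaContext F E).symm.trace := by
  rw [one_eq_skewOf]
  exact h

end PlainHom

/-! ### Induced equivariant objects -/

section Matrix

variable [HasFiniteBiproducts C] {ι : Type*} [Fintype ι] {X : ι → C}

lemma ι_matrixHom_π (g : G) (m : ∀ d c, X d ⟶ (A.act g).obj (X c)) (d c : ι) :
    biproduct.ι X d ≫ A.matrixHom X g m ≫ (A.act g).map (biproduct.π X c) = m d c := by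
  classical
  rw [A.ι_matrixHom_assoc, Preadditive.sum_comp, Finset.sum_eq_single c]
  · rw [Category.assoc, ← Functor.map_comp, biproduct.ι_π_self, CategoryTheory.Functor.map_id,
      Category.comp_id]
  · intro b _ hb
    rw [Category.assoc, ← Functor.map_comp, biproduct.ι_π_ne _ hb, Functor.map_zero, comp_zero]
  · simp

end Matrix

section Induction

variable {H : Subgroup G}

/-- The isomorphism `λ_u` of an `H`-equivariant object, in terms of the action of `G`. -/
def linIso (X : (A.restrict H).EquivObj) (u : H) : X.obj ≅ (A.act u).obj X.obj := X.lin.iso u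

lemma linIso_comp (X : (A.restrict H).EquivObj) {u w x : H} (e : (u : G) * (w : G) = x) :
    (linIso X u).hom ≫ (A.act u).map (linIso X w).hom ≫ A.epsEq e X.obj = (linIso X x).hom := by
  obtain rfl : u * w = x := Subtype.ext e
  have h : A.epsEq e X.obj = (A.eps u w).hom.app X.obj := A.epsEq_rfl _ _ _
  rw [h]
  exact X.lin.comp u w

/-- The representative chosen for the trivial coset is some a in H, not necessarily 1. The diagonal
entry of the induced linearisation at g in H is therefore built from u = a⁻¹ga, and conjugating by
λ_a turns it back into λ_g. -/
lemma linIso_conj (X : (A.restrict H).EquivObj) {a u g : H} (e : (a : G) * (u : G) = g * a) :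
    (linIso X a).hom ≫ ((A.act a).map (linIso X u).hom ≫ A.epsEq e X.obj ≫
      (A.eps g a).inv.app X.obj) ≫ (A.act g).map (linIso X a).inv = (linIso X g).hom := by
  have h1 := linIso_comp X (x := g * a) e
  have h2 := linIso_comp X (u := g) (w := a) (x := g * a) rfl
  have h3 : A.epsEq (rfl : (g : G) * (a : G) = g * a) X.obj ≫ (A.eps g a).inv.app X.obj = 𝟙 _ := by
    rw [A.epsEq_rfl]
    exact (A.eps g a).hom_inv_id_app X.obj
  have h4 := h1.trans h2.symm
  calc _ = ((linIso X a).hom ≫ (A.act a).map (linIso X u).hom ≫ A.epsEq e X.obj) ≫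
        (A.eps g a).inv.app X.obj ≫ (A.act g).map (linIso X a).inv := by
        simp only [Category.assoc]
    _ = (linIso X g).hom := by
        rw [h4, Category.assoc, Category.assoc, reassoc_of% h3, ← Functor.map_comp,
          Iso.hom_inv_id, CategoryTheory.Functor.map_id, Category.comp_id]

/-- The trivial coset. -/
abbrev baseCoset (H : Subgroup G) : G ⧸ H := QuotientGroup.mk (s := H) (1 : G)

/-- The element of `H` representing the trivial coset. -/
def baseRep (H : Subgroup G) : H :=
  ⟨(baseCoset H).out, by
    have h2 := QuotientGroup.eq.1 (QuotientGroup.out_eq' (baseCoset H))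
    rw [mul_one] at h2
    exact inv_mem_iff.1 h2⟩

lemma smul_baseCoset_eq_iff (g : G) : g • baseCoset H = baseCoset H ↔ g ∈ H := by
  change ((g * 1 : G) : G ⧸ H) = ((1 : G) : G ⧸ H) ↔ _
  rw [mul_one, eq_comm, QuotientGroup.eq, inv_one, one_mul]

variable [HasFiniteBiproducts C] [Finite G] (X Y Z : (A.restrict H).EquivObj)

/-- The inclusion of a summand of the induced object. -/
def indIn (c : G ⧸ H) : (A.act c.out).obj X.obj ⟶ (induction X).obj :=
  biproduct.ι (fun c : G ⧸ H => (A.act c.out).obj X.obj) c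

/-- The projection to a summand of the induced object. -/
def indOut (c : G ⧸ H) : (induction X).obj ⟶ (A.act c.out).obj X.obj :=
  biproduct.π (fun c : G ⧸ H => (A.act c.out).obj X.obj) c

lemma indIn_indOut (c : G ⧸ H) : indIn X c ≫ indOut X c = 𝟙 _ :=
  biproduct.ι_π_self (fun c : G ⧸ H => (A.act c.out).obj X.obj) c

lemma indIn_indOut_ne {c d : G ⧸ H} (h : c ≠ d) : indIn X c ≫ indOut X d = 0 :=
  biproduct.ι_π_ne (fun c : G ⧸ H => (A.act c.out).obj X.obj) h

lemma sum_indOut_indIn [Fintype (G ⧸ H)] : ∑ c, indOut X c ≫ indIn X c = 𝟙 _ :=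
  biproduct_total fun c : G ⧸ H => (A.act c.out).obj X.obj

variable {X} in
lemma ind_hom_ext {T : C} {f f' : (induction X).obj ⟶ T}
    (h : ∀ c, indIn X c ≫ f = indIn X c ≫ f') : f = f' :=
  biproduct.hom_ext' _ _ h

lemma indIn_lin_indOut {g : G} {d c : G ⧸ H} (h : g • c = d) :
    indIn X d ≫ ((induction X).lin.iso g).hom ≫ (A.act g).map (indOut X c) = indEntry X g h :=
  letI : Fintype (G ⧸ H) := Fintype.ofFinite _
  (ι_matrixHom_π _ _ _ _).trans (dif_pos h)

lemma indIn_lin_indOut_ne {g : G} {d c : G ⧸ H} (h : g • c ≠ d) :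
    indIn X d ≫ ((induction X).lin.iso g).hom ≫ (A.act g).map (indOut X c) = 0 :=
  letI : Fintype (G ⧸ H) := Fintype.ofFinite _
  (ι_matrixHom_π _ _ _ _).trans (dif_neg h)

lemma indIn_lin {g : G} {d c : G ⧸ H} (h : g • c = d) :
    indIn X d ≫ ((induction X).lin.iso g).hom =
      indEntry X g h ≫ (A.act g).map (indIn X c) := by
  let _ : Fintype (G ⧸ H) := Fintype.ofFinite _
  have h1 : 𝟙 _ = ∑ b, (A.act g).map (indOut X b) ≫ (A.act g).map (indIn X b) := by
    rw [← CategoryTheory.Functor.map_id, ← sum_indOut_indIn X, Functor.map_sum]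
    simp only [Functor.map_comp]
  rw [← Category.comp_id (indIn X d ≫ _), h1, Preadditive.comp_sum, Finset.sum_eq_single c]
  · rw [Category.assoc, ← indIn_lin_indOut X h]
    simp only [Category.assoc]
  · intro b _ hb
    have h2 := indIn_lin_indOut_ne X (g := g) (d := d) (c := b)
      (fun hb' => hb (smul_left_cancel g (hb'.trans h.symm)))
    rw [Category.assoc, reassoc_of% h2, zero_comp]
  · simp

/-- The identification of `X` with the summand of the induced object at the trivial coset. -/
def baseIso : X.obj ≅ (A.act (baseCoset H).out).obj X.obj := linIso X (baseRep H)

/-- The inclusion of `X` into the induced object. -/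
def indι : X.obj ⟶ (induction X).obj := (baseIso X).hom ≫ indIn X (baseCoset H)

/-- The projection of the induced object to `X`. -/
def indπ : (induction X).obj ⟶ X.obj := indOut X (baseCoset H) ≫ (baseIso X).inv

lemma indι_indπ : indι X ≫ indπ X = 𝟙 X.obj := by
  have h := indIn_indOut X (baseCoset H)
  rw [indι, indπ, Category.assoc, reassoc_of% h, Iso.hom_inv_id]

lemma indπ_indι : indπ X ≫ indι X = indOut X (baseCoset H) ≫ indIn X (baseCoset H) := by
  rw [indι, indπ, Category.assoc, Iso.inv_hom_id_assoc]

/-- Together with the vanishing for g outside H in the next lemma, this determines the compression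
of the induced linearisation to the base summand. These compressions are what the criterion
`PlainHom.mem_unitTrace_of_sum` is applied to. -/
lemma indι_lin_indπ (g : H) :
    indι X ≫ ((induction X).lin.iso (g : G)).hom ≫ (A.act g).map (indπ X) = (linIso X g).hom := by
  have hg : (g : G) • baseCoset H = baseCoset H := (smul_baseCoset_eq_iff _).2 g.2
  let u : H := (baseRep H)⁻¹ * (g * baseRep H)
  have hu : (baseCoset H).out * (u : G) = g * (baseCoset H).out :=
    mul_inv_cancel_left (baseRep H : G) _
  have h1 := indIn_lin_indOut X hg
  have h2 := linIso_conj X (a := baseRep H) (u := u) (g := g) hu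
  rw [indι, indπ, Functor.map_comp, Category.assoc, reassoc_of% h1, indEntry_eq X (g : G) hg u hu]
  exact h2

lemma indι_lin_indπ_of_notMem {g : G} (hg : g ∉ H) :
    indι X ≫ ((induction X).lin.iso g).hom ≫ (A.act g).map (indπ X) = 0 := by
  have h := indIn_lin_indOut_ne X (g := g) (d := baseCoset H) (c := baseCoset H)
    (fun h => hg ((smul_baseCoset_eq_iff g).1 h))
  rw [indι, indπ, Functor.map_comp, Category.assoc, reassoc_of% h, zero_comp, comp_zero]

/-- Elements of H fix the trivial coset, so the base summand is stable under H and its inclusion is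
H-equivariant. With `lin_indπ` this makes `indComponent` an H-equivariant morphism. -/
lemma indι_lin (g : H) : indι X ≫ ((induction X).lin.iso (g : G)).hom =
    (linIso X g).hom ≫ (A.act g).map (indι X) := by
  have hg : (g : G) • baseCoset H = baseCoset H := (smul_baseCoset_eq_iff _).2 g.2
  have h1 : indIn X (baseCoset H) ≫ ((induction X).lin.iso (g : G)).hom =
      indIn X (baseCoset H) ≫ ((induction X).lin.iso (g : G)).hom ≫
        (A.act g).map (indπ X) ≫ (A.act g).map (indι X) := by
    have h2 := indIn_lin_indOut X hg
    rw [← Functor.map_comp, indπ_indι, Functor.map_comp, reassoc_of% h2]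
    exact indIn_lin X hg
  rw [← indι_lin_indπ X g]
  unfold indι at h1 ⊢
  rw [Category.assoc, h1]
  simp only [Category.assoc]

lemma lin_indπ (g : H) : ((induction X).lin.iso (g : G)).hom ≫ (A.act g).map (indπ X) =
    indπ X ≫ (linIso X g).hom := by
  have h1 : ((induction X).lin.iso (g : G)).hom ≫ (A.act g).map (indπ X) =
      (indπ X ≫ indι X) ≫ ((induction X).lin.iso (g : G)).hom ≫ (A.act g).map (indπ X) := by
    rw [indπ_indι]
    apply ind_hom_ext
    intro c
    by_cases hc : c = baseCoset H
    · subst hc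
      have h := indIn_indOut X (baseCoset H)
      rw [Category.assoc, reassoc_of% h]
    · have h := indIn_indOut_ne X hc
      rw [Category.assoc, reassoc_of% h, zero_comp]
      have h2 := indIn_lin_indOut_ne X (g := g) (d := c) (c := baseCoset H) (fun h => hc
        (h.symm.trans ((smul_baseCoset_eq_iff _).2 g.2)))
      rw [indπ, Functor.map_comp, reassoc_of% h2, zero_comp]
  rw [h1, Category.assoc, indι_lin_indπ]

variable {X Y Z}

/-- The component at `X` of a morphism of induced objects. -/
def indComponent (f : induction X ⟶ induction Y) : X ⟶ Y :=
  ⟨indι X ≫ f.1 ≫ indπ Y, (Linearisation.mem_invariants_iff _ _ _).2 fun g => by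
    have hf := (Linearisation.mem_invariants_iff _ _ f.1).1 f.2 (g : G)
    have h1 := indι_lin X g
    have h2 := lin_indπ Y g
    change (linIso X g).hom ≫ (A.act g).map (indι X ≫ f.1 ≫ indπ Y) =
      (indι X ≫ f.1 ≫ indπ Y) ≫ (linIso Y g).hom
    rw [Functor.map_comp, Functor.map_comp, ← reassoc_of% h1, reassoc_of% hf, h2]
    simp only [Category.assoc]⟩

lemma indComponent_id : indComponent (𝟙 (induction X)) = 𝟙 X := by
  apply Subtype.ext
  change indι X ≫ 𝟙 _ ≫ indπ X = 𝟙 _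
  rw [Category.id_comp, indι_indπ]

lemma indComponent_sub (f f' : induction X ⟶ induction Y) :
    indComponent (f - f') = indComponent f - indComponent f' := by
  apply Subtype.ext
  change indι X ≫ (f.1 - f'.1) ≫ indπ Y = indι X ≫ f.1 ≫ indπ Y - indι X ≫ f'.1 ≫ indπ Y
  rw [Preadditive.sub_comp, Preadditive.comp_sub]

/-- The injectivity in Frobenius reciprocity: the translates of the base summand under G exhaust the
induced object, so an equivariant morphism is determined by its restriction to that summand. -/
lemma ind_hom_eq_zero (f : induction X ⟶ induction Y) (h : indι X ≫ f.1 = 0) : f = 0 := by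
  have h0 : indIn X (baseCoset H) ≫ f.1 = 0 := by
    rw [indι, Category.assoc] at h
    rw [← cancel_epi (baseIso X).hom, h, comp_zero]
  apply Subtype.ext
  change f.1 = 0
  apply ind_hom_ext
  intro c
  obtain ⟨g, rfl⟩ : ∃ g : G, g • baseCoset H = c := MulAction.exists_smul_eq G _ _
  have hf := (Linearisation.mem_invariants_iff _ _ f.1).1 f.2 g
  have h1 := indIn_lin X (g := g) (c := baseCoset H) rfl
  rw [comp_zero, ← cancel_mono ((induction Y).lin.iso g).hom, zero_comp, Category.assoc, ← hf,
    reassoc_of% h1, ← Functor.map_comp, h0, Functor.map_zero, comp_zero]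

/-- The condition that there are no nonzero morphisms from `X` to the translates of `Y` at the
nontrivial cosets. -/
def TranslatesOrthogonal (X Y : (A.restrict H).EquivObj) : Prop :=
  ∀ c : G ⧸ H, c ≠ baseCoset H → ∀ t : X.obj ⟶ (A.act c.out).obj Y.obj, t = 0

/-- Every component outside the base summand is a morphism from X to a nontrivial translate of Y and
vanishes. So compression to the base summand loses nothing, which makes `indComponent` both
multiplicative and faithful. -/
lemma TranslatesOrthogonal.comp_indπ_indι (h : TranslatesOrthogonal X Y)
    (t : X.obj ⟶ (induction Y).obj) : t ≫ indπ Y ≫ indι Y = t := by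
  let _ : Fintype (G ⧸ H) := Fintype.ofFinite _
  have h1 : t = ∑ c, t ≫ indOut Y c ≫ indIn Y c := by
    rw [← Preadditive.comp_sum, sum_indOut_indIn, Category.comp_id]
  conv_rhs => rw [h1]
  rw [indπ_indι, Finset.sum_eq_single (baseCoset H)]
  · intro c _ hc
    rw [← Category.assoc, h c hc (t ≫ indOut Y c), zero_comp]
  · simp

lemma TranslatesOrthogonal.indComponent_comp (h : TranslatesOrthogonal X Y)
    (f : induction X ⟶ induction Y) (f' : induction Y ⟶ induction Z) :
    indComponent (f ≫ f') = indComponent f ≫ indComponent f' := by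
  apply Subtype.ext
  change indι X ≫ (f.1 ≫ f'.1) ≫ indπ Z = (indι X ≫ f.1 ≫ indπ Y) ≫ indι Y ≫ f'.1 ≫ indπ Z
  have h1 := h.comp_indπ_indι (indι X ≫ f.1)
  simp only [Category.assoc] at h1 ⊢
  rw [reassoc_of% h1]

lemma TranslatesOrthogonal.eq_zero (h : TranslatesOrthogonal X Y)
    (f : induction X ⟶ induction Y) (hf : indComponent f = 0) : f = 0 := by
  apply ind_hom_eq_zero
  have h1 := h.comp_indπ_indι (indι X ≫ f.1)
  have h2 : indι X ≫ f.1 ≫ indπ Y = 0 := congrArg Subtype.val hf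
  simp only [Category.assoc] at h1
  rw [← h1, reassoc_of% h2, zero_comp]

end Induction

end CatAction

namespace CatAction

variable {k : Type u} [Field k] {G : Type uG} [Group G]
  {C : Type uD} [Category.{v} C] [Preadditive C] [Linear k C] {A : CatAction k G C}

/-! ### Morphisms between tensor products with representations -/

lemma smul_lin_injective {X : A.EquivObj} (hX : Function.Bijective fun c : k => c • 𝟙 X.obj) (g : G)
    {c d : k} (h : c • (X.lin.iso g).hom = d • (X.lin.iso g).hom) :
    c = d := by
  apply hX.1
  have h2 := congrArg (· ≫ (X.lin.iso g).inv) h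
  simpa only [Linear.smul_comp, Iso.hom_inv_id] using h2

section Tensor

variable [HasFiniteBiproducts C] (V W U : FDRep k Gᵐᵒᵖ) (X : A.EquivObj)

/-- The inclusion of a summand of the tensor product. -/
def tensorIn (a : Fin (Module.finrank k V)) : X.obj ⟶ (tensor V X).obj :=
  biproduct.ι (fun _ : Fin (Module.finrank k V) => X.obj) a

/-- The projection to a summand of the tensor product. -/
def tensorOut (a : Fin (Module.finrank k V)) : (tensor V X).obj ⟶ X.obj :=
  biproduct.π (fun _ : Fin (Module.finrank k V) => X.obj) a

lemma tensorIn_tensorOut (a b : Fin (Module.finrank k V)) :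
    tensorIn V X a ≫ tensorOut V X b = (if a = b then (1 : k) else 0) • 𝟙 X.obj := by
  split_ifs with h
  · subst h
    rw [one_smul]
    exact biproduct.ι_π_self (fun _ : Fin (Module.finrank k V) => X.obj) a
  · rw [zero_smul]
    exact biproduct.ι_π_ne (fun _ : Fin (Module.finrank k V) => X.obj) h

lemma sum_tensorOut_tensorIn : ∑ a, tensorOut V X a ≫ tensorIn V X a = 𝟙 _ :=
  biproduct_total fun _ : Fin (Module.finrank k V) => X.obj

/-- The matrix of a group element acting on a representation. -/
def repMatrix (g : G) :
    Matrix (Fin (Module.finrank k V)) (Fin (Module.finrank k V)) k :=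
  LinearMap.toMatrix (Module.finBasis k V) (Module.finBasis k V) (V.ρ (MulOpposite.op g))

lemma tensorIn_lin_tensorOut (g : G) (a b : Fin (Module.finrank k V)) :
    tensorIn V X a ≫ ((tensor V X).lin.iso g).hom ≫ (A.act g).map (tensorOut V X b) =
      repMatrix V g b a • (X.lin.iso g).hom :=
  ι_matrixHom_π _ _ _ _

variable {X}

lemma tensorIn_lin (g : G) (a : Fin (Module.finrank k V)) :
    tensorIn V X a ≫ ((tensor V X).lin.iso g).hom =
      ∑ b, repMatrix V g b a • (X.lin.iso g).hom ≫ (A.act g).map (tensorIn V X b) := by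
  have h1 : 𝟙 _ = ∑ b, (A.act g).map (tensorOut V X b) ≫ (A.act g).map (tensorIn V X b) := by
    rw [← CategoryTheory.Functor.map_id, ← sum_tensorOut_tensorIn V X, Functor.map_sum]
    simp only [Functor.map_comp]
  rw [← Category.comp_id (tensorIn V X a ≫ _), h1, Preadditive.comp_sum]
  refine Finset.sum_congr rfl fun b _ => ?_
  rw [← Linear.smul_comp, ← tensorIn_lin_tensorOut]
  simp only [Category.assoc]

variable (hX : Function.Bijective fun c : k => c • 𝟙 X.obj) {V W U}

/-- The matrix entries of a morphism of tensor products. -/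
def entry (f : (tensor V X).obj ⟶ (tensor W X).obj) (b : Fin (Module.finrank k W))
    (a : Fin (Module.finrank k V)) : k :=
  (Equiv.ofBijective _ hX).symm (tensorIn V X a ≫ f ≫ tensorOut W X b)

lemma entry_smul (f : (tensor V X).obj ⟶ (tensor W X).obj) (b : Fin (Module.finrank k W))
    (a : Fin (Module.finrank k V)) :
    entry hX f b a • 𝟙 X.obj = tensorIn V X a ≫ f ≫ tensorOut W X b :=
  (Equiv.ofBijective _ hX).apply_symm_apply _

lemma entry_eq_iff (f : (tensor V X).obj ⟶ (tensor W X).obj) (b : Fin (Module.finrank k W))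
    (a : Fin (Module.finrank k V)) (c : k) :
    entry hX f b a = c ↔ tensorIn V X a ≫ f ≫ tensorOut W X b = c • 𝟙 X.obj := by
  rw [← entry_smul hX, hX.1.eq_iff]

lemma tensorIn_comp (f : (tensor V X).obj ⟶ (tensor W X).obj) (a : Fin (Module.finrank k V)) :
    tensorIn V X a ≫ f = ∑ b, entry hX f b a • tensorIn W X b := by
  rw [← Category.comp_id (tensorIn V X a ≫ f), ← sum_tensorOut_tensorIn W X, Preadditive.comp_sum]
  refine Finset.sum_congr rfl fun b _ => ?_
  rw [← Category.id_comp (tensorIn W X b), ← Linear.smul_comp, entry_smul]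
  simp only [Category.assoc, Category.id_comp]

/-- The matrix of a morphism of tensor products as a linear map. -/
def tensorLin (f : (tensor V X).obj ⟶ (tensor W X).obj) : V →ₗ[k] W :=
  Matrix.toLin (Module.finBasis k V) (Module.finBasis k W) (Matrix.of (entry hX f))

lemma tensorLin_comp (f : (tensor V X).obj ⟶ (tensor W X).obj)
    (f' : (tensor W X).obj ⟶ (tensor U X).obj) :
    tensorLin hX (f ≫ f') = tensorLin hX f' ∘ₗ tensorLin hX f := by
  unfold tensorLin
  rw [← Matrix.toLin_mul]
  congr 1
  ext c a
  rw [Matrix.of_apply, Matrix.mul_apply, entry_eq_iff, Category.assoc, ← Category.assoc,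
    tensorIn_comp hX f, Preadditive.sum_comp, Finset.sum_smul]
  refine Finset.sum_congr rfl fun b _ => ?_
  rw [Linear.smul_comp, ← entry_smul hX, smul_smul, mul_comm]
  rfl

lemma tensorLin_id : tensorLin hX (𝟙 (tensor V X).obj) = LinearMap.id := by
  unfold tensorLin
  rw [← Matrix.toLin_one (Module.finBasis k V)]
  congr 1
  ext b a
  rw [Matrix.of_apply, entry_eq_iff, Category.id_comp, tensorIn_tensorOut, Matrix.one_apply]
  simp only [eq_comm]

lemma tensorLin_sub (f f' : (tensor V X).obj ⟶ (tensor W X).obj) :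
    tensorLin hX (f - f') = tensorLin hX f - tensorLin hX f' := by
  unfold tensorLin
  rw [← map_sub]
  congr 1
  ext b a
  rw [Matrix.of_apply, entry_eq_iff, Preadditive.sub_comp, Preadditive.comp_sub, ← entry_smul hX,
    ← entry_smul hX, ← sub_smul]
  rfl

lemma eq_zero_of_tensorLin (f : (tensor V X).obj ⟶ (tensor W X).obj) (hf : tensorLin hX f = 0) :
    f = 0 := by
  unfold tensorLin at hf
  rw [LinearEquiv.map_eq_zero_iff] at hf
  refine biproduct.hom_ext' _ _ fun a => ?_
  refine (tensorIn_comp hX f a).trans (Eq.trans ?_ comp_zero.symm)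
  refine Finset.sum_eq_zero fun b _ => ?_
  have : entry hX f b a = 0 := congrFun (congrFun hf b) a
  rw [this, zero_smul]

/-- The linear map of an equivariant morphism is a homomorphism of representations. -/
lemma tensorLin_intertwines (f : tensor V X ⟶ tensor W X) (g : G) :
    tensorLin hX f.1 ∘ₗ V.ρ (MulOpposite.op g) = W.ρ (MulOpposite.op g) ∘ₗ tensorLin hX f.1 := by
  have hV : V.ρ (MulOpposite.op g) =
      Matrix.toLin (Module.finBasis k V) (Module.finBasis k V) (repMatrix V g) :=
    (Matrix.toLin_toMatrix _ _ _).symm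
  have hW : W.ρ (MulOpposite.op g) =
      Matrix.toLin (Module.finBasis k W) (Module.finBasis k W) (repMatrix W g) :=
    (Matrix.toLin_toMatrix _ _ _).symm
  unfold tensorLin
  rw [hV, hW, ← Matrix.toLin_mul, ← Matrix.toLin_mul]
  congr 1
  ext c a
  rw [Matrix.mul_apply, Matrix.mul_apply]
  -- The two matrix entries are the coefficients of λ_g in the corresponding component of the two
  -- sides of the equivariance relation for f.
  apply smul_lin_injective hX g
  have hf := (Linearisation.mem_invariants_iff _ _ f.1).1 f.2 g
  have h1 : tensorIn V X a ≫ (((tensor V X).lin.iso g).hom ≫ (A.act g).map f.1) ≫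
      (A.act g).map (tensorOut W X c) =
      (∑ b, entry hX f.1 c b * repMatrix V g b a) • (X.lin.iso g).hom := by
    rw [← Category.assoc, ← Category.assoc, tensorIn_lin, Preadditive.sum_comp,
      Preadditive.sum_comp, Finset.sum_smul]
    refine Finset.sum_congr rfl fun b _ => ?_
    rw [Linear.smul_comp, Linear.smul_comp, Category.assoc, Category.assoc, ← Functor.map_comp,
      ← Functor.map_comp, ← entry_smul hX, Functor.map_smul, CategoryTheory.Functor.map_id,
      Linear.comp_smul, Category.comp_id, smul_smul, mul_comm]
  have h2 : tensorIn V X a ≫ (f.1 ≫ ((tensor W X).lin.iso g).hom) ≫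
      (A.act g).map (tensorOut W X c) =
      (∑ b, repMatrix W g c b * entry hX f.1 b a) • (X.lin.iso g).hom := by
    rw [Category.assoc, ← Category.assoc, tensorIn_comp hX, Preadditive.sum_comp, Finset.sum_smul]
    refine Finset.sum_congr rfl fun b _ => ?_
    rw [Linear.smul_comp, tensorIn_lin_tensorOut, smul_smul, mul_comm]
  exact h1.symm.trans ((congrArg (fun z => tensorIn V X a ≫ z ≫ (A.act g).map (tensorOut W X c))
    hf).trans h2)

/-- The intertwining map of an equivariant morphism of tensor products. -/
def tensorIntertwining (f : tensor V X ⟶ tensor W X) :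
    Representation.IntertwiningMap V.ρ W.ρ where
  toLinearMap := tensorLin hX f.1
  isIntertwining' g := tensorLin_intertwines hX f g.unop

end Tensor

/-! ### Induced objects of irreducible representations -/

section Irreducible

/-- A linear equivalence that commutes with the actions is an isomorphism of representations. -/
lemma nonempty_iso_of_linearEquiv {K : Type*} [Group K] {V W : FDRep k K} (e : V ≃ₗ[k] W)
    (he : ∀ g x, e (V.ρ g x) = W.ρ g (e x)) : Nonempty (V ≅ W) :=
  ⟨Action.mkIso e.toFGModuleCatIso (fun g => by
    ext x
    exact he g x)⟩

variable {H : Subgroup G} [HasFiniteBiproducts C] {X : (A.restrict H).EquivObj}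
  {V W U : FDRep k Hᵐᵒᵖ}

lemma TranslatesOrthogonal.tensor (h : TranslatesOrthogonal X X) :
    TranslatesOrthogonal (tensor V X) (tensor W X) := by
  intro c hc t
  have h1 : 𝟙 _ =
      ∑ b, (A.act c.out).map (tensorOut W X b) ≫ (A.act c.out).map (tensorIn W X b) := by
    rw [← CategoryTheory.Functor.map_id, ← sum_tensorOut_tensorIn W X, Functor.map_sum]
    simp only [Functor.map_comp]
  rw [← Category.comp_id t, h1, Preadditive.comp_sum]
  refine Finset.sum_eq_zero fun b _ => ?_
  have h2 : t ≫ (A.act c.out).map (tensorOut W X b) = 0 := by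
    refine biproduct.hom_ext' _ _ fun a => ?_
    exact (h c hc _).trans comp_zero.symm
  rw [← Category.assoc, h2, zero_comp]

variable [Finite G]

/-- Compression to the base summand turns f into an idempotent intertwiner of V. By Schur's lemma it
is zero or bijective, and a bijective idempotent is the identity. This works over any field, since
the intertwiners need not be scalars. -/
lemma induction_tensor_idempotent (hX : Function.Bijective fun c : k => c • 𝟙 X.obj)
    (h : TranslatesOrthogonal X X) [Representation.IsIrreducible V.ρ]
    (f : induction (tensor V X) ⟶ induction (tensor V X)) (hf : f ≫ f = f) :
    f = 0 ∨ f = 𝟙 _ := by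
  rcases Representation.IsIrreducible.bijective_or_eq_zero
    (tensorIntertwining hX (indComponent f)) with h1 | h1
  · right
    have h2 : tensorLin hX (indComponent f).1 ∘ₗ tensorLin hX (indComponent f).1 =
        tensorLin hX (indComponent f).1 := by
      rw [← tensorLin_comp]
      have h3 := (h.tensor (V := V) (W := V)).indComponent_comp f f
      rw [hf] at h3
      exact congrArg (tensorLin hX) (congrArg Subtype.val h3).symm
    have h4 : tensorLin hX (indComponent f).1 = LinearMap.id := by
      ext x
      exact h1.1 (LinearMap.congr_fun h2 x)
    rw [← sub_eq_zero]
    apply (h.tensor (V := V) (W := V)).eq_zero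
    rw [indComponent_sub, indComponent_id]
    apply Subtype.ext
    apply eq_zero_of_tensorLin hX
    refine (tensorLin_sub hX _ _).trans ?_
    rw [h4]
    exact sub_eq_zero.2 (tensorLin_id hX).symm
  · left
    apply (h.tensor (V := V) (W := V)).eq_zero
    apply Subtype.ext
    apply eq_zero_of_tensorLin hX
    exact congrArg Representation.IntertwiningMap.toLinearMap h1

/-- Compression respects identities and composition, so it sends an isomorphism and its inverse to
mutually inverse intertwiners. -/
lemma nonempty_iso_of_induction_tensor (hX : Function.Bijective fun c : k => c • 𝟙 X.obj)
    (h : TranslatesOrthogonal X X)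
    (e : induction (tensor V X) ≅ induction (tensor W X)) : Nonempty (V ≅ W) := by
  have h1 : tensorLin hX (indComponent e.inv).1 ∘ₗ tensorLin hX (indComponent e.hom).1 =
      LinearMap.id := by
    rw [← tensorLin_comp, ← tensorLin_id hX]
    have h3 := (h.tensor (V := V) (W := W)).indComponent_comp e.hom e.inv
    rw [e.hom_inv_id, indComponent_id] at h3
    exact congrArg (tensorLin hX) (congrArg Subtype.val h3).symm
  have h2 : tensorLin hX (indComponent e.hom).1 ∘ₗ tensorLin hX (indComponent e.inv).1 =
      LinearMap.id := by
    rw [← tensorLin_comp, ← tensorLin_id hX]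
    have h3 := (h.tensor (V := W) (W := V)).indComponent_comp e.inv e.hom
    rw [e.inv_hom_id, indComponent_id] at h3
    exact congrArg (tensorLin hX) (congrArg Subtype.val h3).symm
  refine nonempty_iso_of_linearEquiv (LinearEquiv.ofLinearMap _ _ h2 h1) fun g x => ?_
  exact LinearMap.congr_fun (tensorLin_intertwines hX (indComponent e.hom) g.unop) x

lemma id_induction_tensor_ne_zero (hX : Function.Bijective fun c : k => c • 𝟙 X.obj)
    [hV : Representation.IsIrreducible V.ρ] :
    𝟙 (induction (tensor V X)) ≠ 0 := by
  intro h0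
  have h1 : (𝟙 (tensor V X) : tensor V X ⟶ tensor V X) = 0 := by
    rw [← indComponent_id, h0]
    apply Subtype.ext
    change indι _ ≫ 0 ≫ indπ _ = 0
    rw [zero_comp, comp_zero]
  have h2 : (LinearMap.id : V →ₗ[k] V) = 0 := by
    rw [← tensorLin_id hX, ← sub_self (tensorLin hX (𝟙 (tensor V X).obj)), ← tensorLin_sub]
    congr 1
    rw [sub_self]
    exact congrArg Subtype.val h1
  refine bot_ne_top (α := Subrepresentation V.ρ) (SetLike.ext fun x => ?_)
  have h3 : x = 0 := LinearMap.congr_fun h2 x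
  subst h3
  exact ⟨fun _ => Submodule.mem_top, fun _ => Submodule.zero_mem ⊥⟩

end Irreducible

end CatAction

/-! ### Matrix coefficients of irreducible representations -/

section Coefficients

variable {k : Type u} [Field k] {K : Type uG} [Group K]

/-- An element of the group algebra that acts as zero on all irreducible representations acts as
zero on all finite-dimensional representations. -/
lemma sum_smul_eq_zero_of_irreducible [Fintype K] [NeZero (Nat.card K : k)] (c : K → k)
    (h : ∀ W : FDRep k K, Representation.IsIrreducible W.ρ → ∑ g, c g • W.ρ g = 0)
    {U : Type u} [AddCommGroup U] [Module k U] [FiniteDimensional k U]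
    (ρ : Representation k K U) : ∑ g, c g • ρ g = 0 := by
  induction hn : Module.finrank k U using Nat.strong_induction_on generalizing U with
  | _ n ih =>
    have hss : Representation.IsSemisimpleRepresentation ρ := inferInstance
    -- The representation is zero, irreducible, or, by Maschke, the sum of two proper
    -- subrepresentations, to which induction on the dimension applies.
    by_cases hU : Nontrivial (Subrepresentation ρ)
    · by_cases hs : ∃ p : Subrepresentation ρ, p ≠ ⊥ ∧ p ≠ ⊤
      · obtain ⟨p, hp0, hp1⟩ := hs
        obtain ⟨q, hpq⟩ := hss.exists_isCompl p
        have key : ∀ r : Subrepresentation ρ, r ≠ ⊤ → ∀ x ∈ r, (∑ g, c g • ρ g) x = 0 := by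
          intro r hr x hx
          have hlt : Module.finrank k r.toSubmodule < n := by
            rw [← hn]
            apply Submodule.finrank_lt
            intro h
            exact hr (Subrepresentation.toSubmodule_injective h)
          have h1 := LinearMap.congr_fun (ih _ hlt r.toRepresentation rfl) ⟨x, hx⟩
          have h2 := congrArg Subtype.val h1
          simp only [LinearMap.sum_apply, LinearMap.smul_apply, AddSubmonoidClass.coe_finsetSum,
            Submodule.coe_smul, LinearMap.zero_apply, ZeroMemClass.coe_zero] at h2 ⊢
          exact h2
        have hq1 : q ≠ ⊤ := by
          rintro rfl
          exact hp0 (disjoint_top.1 hpq.disjoint)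
        ext x
        have hx : x ∈ (p ⊔ q : Subrepresentation ρ).toSubmodule := by
          rw [hpq.sup_eq_top]
          exact Submodule.mem_top
        obtain ⟨y, hy, z, hz, rfl⟩ := Submodule.mem_sup.1 hx
        rw [map_add, key p hp1 y hy, key q hq1 z hz, add_zero, LinearMap.zero_apply]
      · have hirr : Representation.IsIrreducible ρ :=
          { eq_bot_or_eq_top := fun p => by
              by_contra hcon
              exact hs ⟨p, fun h => hcon (Or.inl h), fun h => hcon (Or.inr h)⟩ }
        exact h (FDRep.of ρ) hirr
    · ext x
      have h1 : (⊥ : Subrepresentation ρ) = ⊤ :=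
        (not_nontrivial_iff_subsingleton.1 hU).elim _ _
      have h2 : ∀ y : U, y = 0 := fun y => by
        have : y ∈ (⊥ : Subrepresentation ρ) := h1 ▸ (Submodule.mem_top (R := k) (M := U))
        exact this
      exact h2 _

/-- The regular representation on the coordinate space. -/
def coordRegular (k : Type u) [Field k] [Fintype K] :
    Representation k K (Fin (Fintype.card K) → k) where
  toFun g := LinearMap.funLeft k k fun i =>
    Fintype.equivFin K (g⁻¹ * (Fintype.equivFin K).symm i)
  map_one' := by
    ext f i
    simp [LinearMap.funLeft]
  map_mul' g h := by
    refine LinearMap.ext fun f => funext fun i => ?_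
    simp [LinearMap.funLeft, mul_assoc]

/-- Faithfulness of the regular representation: applied to the delta function at 1, the operator
returns the function c itself. The space consists of coordinate vectors because
`sum_smul_eq_zero_of_irreducible` requires a space in the universe of k, and the group may live
elsewhere. -/
lemma eq_zero_of_sum_smul_coordRegular [Fintype K] (c : K → k)
    (h : ∑ g, c g • coordRegular (K := K) k g = 0) : c = 0 := by
  classical
  funext a
  have h1 := congrFun (LinearMap.congr_fun h (Pi.single (Fintype.equivFin K 1) 1))
    (Fintype.equivFin K a)
  rw [LinearMap.sum_apply, Finset.sum_apply, Finset.sum_eq_single a] at h1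
  · simpa [coordRegular, LinearMap.funLeft] using h1
  · intro b _ hb
    have : Fintype.equivFin K (b⁻¹ * a) ≠ Fintype.equivFin K 1 := fun hh =>
      hb (inv_mul_eq_one.1 ((Fintype.equivFin K).injective hh))
    simp [coordRegular, LinearMap.funLeft, Pi.single_eq_of_ne this]
  · simp

end Coefficients

/-- The delta function at `1` is a linear combination of matrix coefficients of irreducible
representations. -/
lemma exists_matrixCoefficients {k : Type u} [Field k] {H : Type uG} [Group H] [Finite H]
    (hH : (Nat.card H : k) ≠ 0) {J : Type uJ} [Fintype J] {V : J → FDRep k Hᵐᵒᵖ}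
    (hV : IsIrrSystem V) :
    ∃ t : (Σ j : J, Fin (Module.finrank k (V j)) × Fin (Module.finrank k (V j))) → k,
      (∑ s, t s * CatAction.repMatrix (V s.1) (1 : H) s.2.2 s.2.1 = 1) ∧
      ∀ h : H, h ≠ 1 → ∑ s, t s * CatAction.repMatrix (V s.1) h s.2.2 s.2.1 = 0 := by
  classical
  have : Finite Hᵐᵒᵖ := Finite.of_equiv H MulOpposite.opEquiv
  let _ : Fintype Hᵐᵒᵖ := Fintype.ofFinite Hᵐᵒᵖ
  have : NeZero (Nat.card Hᵐᵒᵖ : k) := ⟨by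
    rwa [Nat.card_congr (MulOpposite.opEquiv (α := H)).symm]⟩
  let S := Σ j : J, Fin (Module.finrank k (V j)) × Fin (Module.finrank k (V j))
  -- `Ψ` sends an element of the group algebra to the matrix entries of its action on all the
  -- irreducible representations. An element of the kernel acts as zero on all of these, hence on
  -- the regular representation, so it is zero.
  let Ψ : (Hᵐᵒᵖ → k) →ₗ[k] (S → k) := LinearMap.pi fun s =>
    ∑ g : Hᵐᵒᵖ, CatAction.repMatrix (V s.1) g.unop s.2.2 s.2.1 • LinearMap.proj g
  have hΨ : ∀ c s, Ψ c s = ∑ g : Hᵐᵒᵖ, CatAction.repMatrix (V s.1) g.unop s.2.2 s.2.1 * c g := by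
    intro c s
    simp [Ψ]
  have hinj : LinearMap.ker Ψ = ⊥ := by
    rw [LinearMap.ker_eq_bot']
    intro c hc
    apply eq_zero_of_sum_smul_coordRegular
    apply sum_smul_eq_zero_of_irreducible
    intro W hW
    obtain ⟨j, ⟨e⟩⟩ := hV.complete W hW
    have h1 : ∑ g, c g • (V j).ρ g = 0 := by
      apply (LinearMap.toMatrix (Module.finBasis k (V j)) (Module.finBasis k (V j))).injective
      ext b a
      have h2 := congrFun hc ⟨j, a, b⟩
      rw [hΨ] at h2
      rw [map_sum, map_zero, Matrix.sum_apply]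
      refine Eq.trans (Finset.sum_congr rfl fun g _ => ?_) h2
      rw [map_smul, Matrix.smul_apply, smul_eq_mul, mul_comm]
      rfl
    apply (FDRep.isoToLinearEquiv e).conj.injective
    rw [map_sum, map_zero, ← h1]
    refine Finset.sum_congr rfl fun g _ => ?_
    rw [map_smul, FDRep.Iso.conj_ρ e]
  -- By injectivity, the value at 1 of a group algebra element is a linear functional of its matrix
  -- entries. The coordinates of such a functional are the coefficients t; testing on the basis
  -- element h gives the delta function.
  obtain ⟨ψ, hψ⟩ := Ψ.exists_leftInverse_of_injective hinj
  let φ : (S → k) →ₗ[k] k := LinearMap.proj (1 : Hᵐᵒᵖ) ∘ₗ ψ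
  have key : ∀ h : H, ∑ s, φ (Pi.single s 1) * CatAction.repMatrix (V s.1) h s.2.2 s.2.1 =
      (Pi.single (MulOpposite.op h) 1 : Hᵐᵒᵖ → k) 1 := by
    intro h
    have h1 : φ (Ψ (Pi.single (MulOpposite.op h) 1)) =
        (Pi.single (MulOpposite.op h) 1 : Hᵐᵒᵖ → k) 1 :=
      congrFun (LinearMap.congr_fun hψ _) 1
    rw [← h1, LinearMap.pi_apply_eq_sum_univ φ]
    refine Finset.sum_congr rfl fun s _ => ?_
    rw [smul_eq_mul, mul_comm, hΨ, Finset.sum_eq_single (MulOpposite.op h)]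
    · rw [Pi.single_eq_same, mul_one]
      congr 2
      funext s'
      rw [Pi.single_apply]
      simp only [eq_comm]
    · intro g _ hg
      rw [Pi.single_eq_of_ne hg, mul_zero]
    · simp
  refine ⟨fun s => φ (Pi.single s 1), (key 1).trans ?_, fun h hh => (key h).trans ?_⟩
  · rw [MulOpposite.op_one, Pi.single_eq_same]
  · rw [Pi.single_eq_of_ne]
    exact fun h' => hh (MulOpposite.op_injective h'.symm)

/-! ### Consequences of factorizations -/

section Through

variable {C : Type*} [Category C] [Preadditive C]

lemma eq_zero_of_throughSubgroup {ι κ : Type*} {P : ι → C} {Q : κ → C} {X Y : C}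
    (hX : 𝟙 X ∈ throughSubgroup P X) (hY : 𝟙 Y ∈ throughSubgroup Q Y)
    (h : ∀ i j (t : P i ⟶ Q j), t = 0) (f : X ⟶ Y) : f = 0 := by
  have h1 : ∀ z ∈ throughSubgroup Q Y, ∀ i (t : P i ⟶ Y), t ≫ z = 0 := by
    intro z hz i t
    induction hz using AddSubgroup.closure_induction with
    | mem z hz =>
      obtain ⟨j, a, b, rfl⟩ := hz
      rw [← Category.assoc, h i j (t ≫ a), zero_comp]
    | zero => rw [comp_zero]
    | add x y _ _ hx hy => rw [Preadditive.comp_add, hx, hy, add_zero]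
    | neg x _ hx => rw [Preadditive.comp_neg, hx, neg_zero]
  have h2 : ∀ z ∈ throughSubgroup P X, z ≫ f = 0 := by
    intro z hz
    induction hz using AddSubgroup.closure_induction with
    | mem z hz =>
      obtain ⟨j, a, b, rfl⟩ := hz
      have := h1 _ hY j (b ≫ f)
      rw [Category.comp_id] at this
      rw [Category.assoc, this, comp_zero]
    | zero => rw [zero_comp]
    | add x y _ _ hx hy => rw [Preadditive.add_comp, hx, hy, add_zero]
    | neg x _ hx => rw [Preadditive.neg_comp, hx, neg_zero]
  rw [← h2 _ hX, Category.id_comp]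

variable (k : Type*) [Field k] [Linear k C]

/-- Precomposition with a morphism factoring through a `P i` has finite-dimensional range, and this
property is stable under sums. For the identity the range is the whole Hom space. -/
lemma finiteDimensional_precomp {ι : Type*} {P : ι → C} {X : C} (hX : 𝟙 X ∈ throughSubgroup P X)
    (T : C) (h : ∀ i, FiniteDimensional k (P i ⟶ T)) : FiniteDimensional k (X ⟶ T) := by
  have key : ∀ z ∈ throughSubgroup P X,
      FiniteDimensional k (LinearMap.range (Linear.leftComp k T z)) := by
    intro z hz
    induction hz using AddSubgroup.closure_induction with
    | mem z hz =>
      obtain ⟨j, a, b, rfl⟩ := hz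
      have hle : LinearMap.range (Linear.leftComp k T (a ≫ b)) ≤
          LinearMap.range (Linear.leftComp k T a) := by
        rintro _ ⟨t, rfl⟩
        exact ⟨b ≫ t, (Category.assoc a b t).symm⟩
      have := h j
      exact Submodule.finiteDimensional_of_le hle
    | zero =>
      have hle : LinearMap.range (Linear.leftComp k T (0 : X ⟶ X)) ≤ ⊥ := by
        rintro _ ⟨t, rfl⟩
        exact zero_comp
      exact Submodule.finiteDimensional_of_le hle
    | add x y _ _ hx hy =>
      have hle : LinearMap.range (Linear.leftComp k T (x + y)) ≤
          LinearMap.range (Linear.leftComp k T x) ⊔ LinearMap.range (Linear.leftComp k T y) := by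
        rintro _ ⟨t, rfl⟩
        exact Submodule.mem_sup.2 ⟨_, ⟨t, rfl⟩, _, ⟨t, rfl⟩,
          (Preadditive.add_comp _ _ _ x y t).symm⟩
      exact Submodule.finiteDimensional_of_le hle
    | neg x _ hx =>
      have hle : LinearMap.range (Linear.leftComp k T (-x)) ≤
          LinearMap.range (Linear.leftComp k T x) := by
        rintro _ ⟨t, rfl⟩
        exact ⟨-t, (Preadditive.comp_neg x t).trans (Preadditive.neg_comp x t).symm⟩
      exact Submodule.finiteDimensional_of_le hle
  have h1 := key _ hX
  have h2 : LinearMap.range (Linear.leftComp k T (𝟙 X)) = ⊤ :=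
    LinearMap.range_eq_top.2 fun t => ⟨t, Category.id_comp t⟩
  rw [h2] at h1
  exact Module.Finite.equiv Submodule.topEquiv

lemma finiteDimensional_postcomp {ι : Type*} {P : ι → C} {X : C} (hX : 𝟙 X ∈ throughSubgroup P X)
    (T : C) (h : ∀ i, FiniteDimensional k (T ⟶ P i)) : FiniteDimensional k (T ⟶ X) := by
  have key : ∀ z ∈ throughSubgroup P X,
      FiniteDimensional k (LinearMap.range (Linear.rightComp k T z)) := by
    intro z hz
    induction hz using AddSubgroup.closure_induction with
    | mem z hz =>
      obtain ⟨j, a, b, rfl⟩ := hz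
      have hle : LinearMap.range (Linear.rightComp k T (a ≫ b)) ≤
          LinearMap.range (Linear.rightComp k T b) := by
        rintro _ ⟨t, rfl⟩
        exact ⟨t ≫ a, Category.assoc t a b⟩
      have := h j
      exact Submodule.finiteDimensional_of_le hle
    | zero =>
      have hle : LinearMap.range (Linear.rightComp k T (0 : X ⟶ X)) ≤ ⊥ := by
        rintro _ ⟨t, rfl⟩
        exact comp_zero
      exact Submodule.finiteDimensional_of_le hle
    | add x y _ _ hx hy =>
      have hle : LinearMap.range (Linear.rightComp k T (x + y)) ≤
          LinearMap.range (Linear.rightComp k T x) ⊔ LinearMap.range (Linear.rightComp k T y) := by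
        rintro _ ⟨t, rfl⟩
        exact Submodule.mem_sup.2 ⟨_, ⟨t, rfl⟩, _, ⟨t, rfl⟩,
          (Preadditive.comp_add _ _ _ t x y).symm⟩
      exact Submodule.finiteDimensional_of_le hle
    | neg x _ hx =>
      have hle : LinearMap.range (Linear.rightComp k T (-x)) ≤
          LinearMap.range (Linear.rightComp k T x) := by
        rintro _ ⟨t, rfl⟩
        exact ⟨-t, (Preadditive.neg_comp t x).trans (Preadditive.comp_neg t x).symm⟩
      exact Submodule.finiteDimensional_of_le hle
  have h1 := key _ hX
  have h2 : LinearMap.range (Linear.rightComp k T (𝟙 X)) = ⊤ :=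
    LinearMap.range_eq_top.2 fun t => ⟨t, Category.comp_id t⟩
  rw [h2] at h1
  exact Module.Finite.equiv Submodule.topEquiv

/-- The endomorphism algebra of a direct sum of pairwise non-isomorphic objects without
nontrivial idempotent endomorphisms is basic. -/
lemma isBasicAlgebra_end_biproduct {k : Type u} [Field k] {C : Type uD} [Category.{v} C]
    [Preadditive C] [Linear k C] {ι : Type*} [Finite ι] (F : ι → C) [HasBiproduct F]
    [FiniteDimensional k (End (biproduct F))] (h0 : ∀ i, 𝟙 (F i) ≠ 0)
    (hidem : ∀ i (f : F i ⟶ F i), f ≫ f = f → f = 0 ∨ f = 𝟙 _)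
    (hiso : ∀ i j, Nonempty (F i ≅ F j) → i = j) : IsBasicAlgebra k (End (biproduct F)) := by
  classical
  let _ : Fintype ι := Fintype.ofFinite ι
  let e : ι → End (biproduct F) := fun i => biproduct.π F i ≫ biproduct.ι F i
  have hself : ∀ i, biproduct.ι F i ≫ biproduct.π F i = 𝟙 _ := fun i => biproduct.ι_π_self F i
  have he : CompleteOrthogonalIdempotents e :=
    { idem := fun i => by
        change (biproduct.π F i ≫ biproduct.ι F i) ≫ biproduct.π F i ≫ biproduct.ι F i = _
        rw [Category.assoc, reassoc_of% (hself i)]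
      ortho := fun i j hij => by
        change (biproduct.π F j ≫ biproduct.ι F j) ≫ biproduct.π F i ≫ biproduct.ι F i = 0
        rw [Category.assoc, biproduct.ι_π_ne_assoc F (Ne.symm hij), zero_comp, comp_zero]
      complete := biproduct_total F }
  have hsplit : ∀ i (T : C) (x : biproduct F ⟶ T), e i ≫ x = x →
      biproduct.π F i ≫ biproduct.ι F i ≫ x = x := by
    intro i T x hx
    rw [← Category.assoc]
    exact hx
  have hsplit' : ∀ i (T : C) (x : T ⟶ biproduct F), x ≫ e i = x →
      (x ≫ biproduct.π F i) ≫ biproduct.ι F i = x := by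
    intro i T x hx
    rw [Category.assoc]
    exact hx
  refine isBasicAlgebra_of_idempotents k he ?_ ?_ ?_
  · intro i hi
    apply h0 i
    have hi' : biproduct.π F i ≫ biproduct.ι F i = 0 := hi
    have h1 : biproduct.ι F i ≫ (biproduct.π F i ≫ biproduct.ι F i) ≫ biproduct.π F i = 𝟙 _ := by
      rw [Category.assoc, hself, Category.comp_id, hself]
    rw [← h1, hi', zero_comp, comp_zero]
  · intro i x hx1 hx2 hx3
    -- Multiplication in `End` is composition in the reverse order, so `x * e i = x` says that `e i
    -- ≫ x = x`.
    have h1 := hsplit i _ x hx2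
    have h2 := hsplit' i _ x hx1
    have h3 : x ≫ x = x := hx3
    let f := biproduct.ι F i ≫ x ≫ biproduct.π F i
    have hf : f ≫ f = f := by
      simp only [f, Category.assoc]
      rw [reassoc_of% h1, reassoc_of% h3]
    have hxf : x = biproduct.π F i ≫ f ≫ biproduct.ι F i := by
      simp only [f, Category.assoc] at h1 h2 ⊢
      rw [h2, h1]
    rcases hidem i f hf with h | h
    · left
      rw [hxf, h, zero_comp, comp_zero]
    · right
      rw [hxf, h, Category.id_comp]
  · intro i j a b ha1 ha2 hb1 hb2 hba hab
    have a1 := hsplit' j _ a ha1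
    have b1 := hsplit' i _ b hb1
    have hba' : a ≫ b = biproduct.π F i ≫ biproduct.ι F i := hba
    have hab' : b ≫ a = biproduct.π F j ≫ biproduct.ι F j := hab
    rw [Category.assoc] at a1 b1
    refine hiso i j ⟨⟨biproduct.ι F i ≫ a ≫ biproduct.π F j,
      biproduct.ι F j ≫ b ≫ biproduct.π F i, ?_, ?_⟩⟩
    · have h1 : (biproduct.ι F i ≫ a ≫ biproduct.π F j) ≫ biproduct.ι F j ≫ b ≫ biproduct.π F i =
          biproduct.ι F i ≫ (a ≫ biproduct.π F j ≫ biproduct.ι F j) ≫ b ≫ biproduct.π F i := by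
        simp only [Category.assoc]
      rw [h1, a1, reassoc_of% hba', hself, Category.comp_id, hself]
    · have h1 : (biproduct.ι F j ≫ b ≫ biproduct.π F i) ≫ biproduct.ι F i ≫ a ≫ biproduct.π F j =
          biproduct.ι F j ≫ (b ≫ biproduct.π F i ≫ biproduct.ι F i) ≫ a ≫ biproduct.π F j := by
        simp only [Category.assoc]
      rw [h1, b1, reassoc_of% hab', hself, Category.comp_id, hself]

end Through

namespace CatAction

variable {k : Type u} [Field k] {G : Type uG} [Group G]
  {C : Type uD} [Category.{v} C] [Preadditive C] [Linear k C] {A : CatAction k G C}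

/-- Transport of a linearisation along an isomorphism. -/
def Linearisation.ofIso {X Y : C} (l : A.Linearisation X) (φ : X ≅ Y) : A.Linearisation Y where
  iso g := φ.symm ≪≫ l.iso g ≪≫ (A.act g).mapIso φ
  comp g h := by
    simp only [Iso.trans_hom, Iso.symm_hom, Functor.mapIso_hom, Functor.map_comp, Category.assoc]
    rw [A.eps_naturality, ← l.comp, ← Functor.map_comp_assoc (A.act g) φ.hom, Iso.hom_inv_id,
      CategoryTheory.Functor.map_id, Category.id_comp]
    simp only [Category.assoc]

/-! ### Orthogonality and linearisability of transitively permuted blocks -/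

section Blocks

variable {n : ℕ} {ℓ : Fin n → ℕ}
  {E : ∀ i, Fin (ℓ i) → C} [∀ i, MulAction G (Fin (ℓ i))]

/-- Members of a transitively permuted block are mutually orthogonal. -/
lemma block_orthogonal [Fintype G] [∀ i, MulAction.IsPretransitive G (Fin (ℓ i))]
    (hperm : ∀ i (j : Fin (ℓ i)) (g : G), Nonempty ((A.act g).obj (E i j) ≅ E i (g • j)))
    (hsemi : ∀ i (j j' : Fin (ℓ i)), j' < j → ∀ f : E i j ⟶ E i j', f = 0)
    (i : Fin n) {j j' : Fin (ℓ i)} (hne : j ≠ j') (f : E i j ⟶ E i j') : f = 0 := by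
  by_contra hf
  -- The translate by g of a nonzero f is a nonzero morphism from member g • j to member g • j', and
  -- semiorthogonality then forbids g • j' < g • j.
  have hle : ∀ g : G, g • j ≤ g • j' := by
    intro g
    by_contra hlt
    obtain ⟨φ⟩ := hperm i j g
    obtain ⟨φ'⟩ := hperm i j' g
    apply hf
    have h0 := hsemi i _ _ (not_le.1 hlt) (φ.inv ≫ (A.act g).map f ≫ φ'.hom)
    apply (A.act g).map_injective
    rw [Functor.map_zero, ← cancel_mono φ'.hom, ← cancel_epi φ.inv, h0, zero_comp, comp_zero]
  obtain ⟨h, rfl⟩ := MulAction.exists_smul_eq G j j'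
  -- With j' = h • j, both sums of positions run over the same terms, reordered by right
  -- multiplication by h. Termwise inequalities between equal sums are equalities; the term at g = 1
  -- gives j = j'.
  have hsum : ∑ g : G, ((g • j : Fin (ℓ i)) : ℕ) = ∑ g : G, ((g • h • j : Fin (ℓ i)) : ℕ) := by
    refine (Fintype.sum_equiv (Equiv.mulRight h) _ _ fun g => ?_).symm
    rw [smul_smul]
    rfl
  have h1 : ((1 : G) • j : Fin (ℓ i)) = (1 : G) • h • j := by
    apply Fin.ext
    exact (Finset.sum_eq_sum_iff_of_le (f := fun g : G => ((g • j : Fin (ℓ i)) : ℕ))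
      fun g _ => Fin.le_def.1 (hle g)).1 hsum 1 (Finset.mem_univ _)
  rw [one_smul, one_smul] at h1
  exact hne h1

variable [∀ i, NeZero (ℓ i)]

/-- The first member of a block as an equivariant object. -/
abbrev firstMember (L : ∀ i, (A.restrict (MulAction.stabilizer G (0 : Fin (ℓ i)))).Linearisation
    (E i 0)) (i : Fin n) : (A.restrict (MulAction.stabilizer G (0 : Fin (ℓ i)))).EquivObj :=
  ⟨E i 0, L i⟩

lemma firstMember_translatesOrthogonal
    (L : ∀ i, (A.restrict (MulAction.stabilizer G (0 : Fin (ℓ i)))).Linearisation (E i 0))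
    (hperm : ∀ i (j : Fin (ℓ i)) (g : G), Nonempty ((A.act g).obj (E i j) ≅ E i (g • j)))
    (horth : ∀ i (j j' : Fin (ℓ i)), j ≠ j' → ∀ f : E i j ⟶ E i j', f = 0) (i : Fin n) :
    TranslatesOrthogonal (firstMember L i) (firstMember L i) := by
  intro c hc t
  obtain ⟨φ⟩ := hperm i 0 c.out
  have h0 : (0 : Fin (ℓ i)) ≠ c.out • 0 := by
    intro h
    apply hc
    rw [← QuotientGroup.out_eq' c]
    exact ((QuotientGroup.eq).2 (by rw [inv_one, one_mul]; exact h.symm)).symm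
  have h1 : t ≫ φ.hom = 0 := horth i _ _ h0 _
  have h2 : t = (t ≫ φ.hom) ≫ φ.inv := by simp
  rw [h2, h1, zero_comp]

/-- The direct sum of the blocks is linearisable. -/
lemma nonempty_linearisation [HasFiniteBiproducts C] [Finite G]
    [∀ i, MulAction.IsPretransitive G (Fin (ℓ i))]
    (L : ∀ i, (A.restrict (MulAction.stabilizer G (0 : Fin (ℓ i)))).Linearisation (E i 0))
    (hperm : ∀ i (j : Fin (ℓ i)) (g : G), Nonempty ((A.act g).obj (E i j) ≅ E i (g • j))) :
    Nonempty (A.Linearisation (biproduct fun p : Σ i, Fin (ℓ i) => E p.1 p.2)) := by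
  let W : A.EquivObj := EquivObj.directSum fun i => induction (firstMember L i)
  have hblock : ∀ i, Nonempty ((induction (firstMember L i)).obj ≅ biproduct (E i)) := by
    intro i
    -- The orbit-stabiliser bijection, written with the coset representatives that occur in the
    -- definition of `induction`, so that the summand at c is the translate isomorphic to the member
    -- σ(c).
    let σ : G ⧸ MulAction.stabilizer G (0 : Fin (ℓ i)) ≃ Fin (ℓ i) :=
      Equiv.ofBijective (fun c => c.out • 0) (by
        constructor
        · intro c d h
          rw [← QuotientGroup.out_eq' c, ← QuotientGroup.out_eq' d]
          apply (QuotientGroup.eq).2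
          change (c.out⁻¹ * d.out) • (0 : Fin (ℓ i)) = 0
          have h' : c.out • (0 : Fin (ℓ i)) = d.out • 0 := h
          rw [mul_smul, ← h', inv_smul_smul]
        · intro j
          obtain ⟨g, hg⟩ := MulAction.exists_smul_eq G (0 : Fin (ℓ i)) j
          refine ⟨QuotientGroup.mk g, ?_⟩
          have h1 : (QuotientGroup.mk (s := MulAction.stabilizer G (0 : Fin (ℓ i))) g).out⁻¹ * g ∈
            MulAction.stabilizer G (0 : Fin (ℓ i)) := QuotientGroup.eq.1 (QuotientGroup.out_eq' _)
          have h2 := MulAction.mem_stabilizer_iff.1 h1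
          rw [mul_smul, inv_smul_eq_iff, hg] at h2
          exact h2.symm)
    exact ⟨biproduct.whiskerEquiv σ fun c => (hperm i 0 c.out).some.symm⟩
  let φ : W.obj ≅ biproduct fun p : Σ i, Fin (ℓ i) => E p.1 p.2 :=
    (biproduct.mapIso fun i => (hblock i).some) ≪≫ biproductBiproductIso (fun i => Fin (ℓ i)) E
  exact ⟨W.lin.ofIso φ⟩

end Blocks

end CatAction

namespace CatAction

variable {k : Type u} [Field k] {G : Type uG} [Group G]
  {C : Type uD} [Category.{v} C] [Preadditive C] [Linear k C] {A : CatAction k G C}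

/-! ### The induced sequence: generation by the members of 𝔼 and the trace ideal -/

section InducedSequence

variable [HasFiniteBiproducts C] {n : ℕ} {ℓ : Fin n → ℕ} [∀ i, NeZero (ℓ i)]
  {E : ∀ i, Fin (ℓ i) → C} [∀ i, MulAction G (Fin (ℓ i))]
  (L : ∀ i, (A.restrict (MulAction.stabilizer G (0 : Fin (ℓ i)))).Linearisation (E i 0))
  {J : Fin n → Type uJ} (V : ∀ i, J i → FDRep k (MulAction.stabilizer G (0 : Fin (ℓ i)))ᵐᵒᵖ)

/-- The members of the induced sequence. -/
abbrev inducedMember [Finite G] (p : Σ i, J i) : A.EquivObj :=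
  induction (tensor (V p.1 p.2) (firstMember L p.1))

/-- After forgetting the linearisation, an induced object is a sum of translates of copies of the
first member, and each translate is isomorphic to a member of the same block. -/
lemma id_inducedMember_mem_throughSubgroup [Finite G]
    (hperm : ∀ i (j : Fin (ℓ i)) (g : G), Nonempty ((A.act g).obj (E i j) ≅ E i (g • j)))
    (p : Σ i, J i) :
    𝟙 (inducedMember L V p).obj ∈ throughSubgroup (E p.1) (inducedMember L V p).obj := by
  have h1 : 𝟙 (tensor (V p.1 p.2) (firstMember L p.1)).obj ∈ throughSubgroup
      (fun _ : Fin (Module.finrank k (V p.1 p.2)) => E p.1 0)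
      (tensor (V p.1 p.2) (firstMember L p.1)).obj :=
    id_mem_throughSubgroup_of_iso (Iso.refl _)
  have h2 : 𝟙 (inducedMember L V p).obj ∈ throughSubgroup
      (fun c : G ⧸ MulAction.stabilizer G (0 : Fin (ℓ p.1)) =>
        (A.act c.out).obj (tensor (V p.1 p.2) (firstMember L p.1)).obj)
      (inducedMember L V p).obj :=
    id_mem_throughSubgroup_of_iso (Iso.refl _)
  refine throughSubgroup_trans (fun c => ?_) h2
  have h3 := map_mem_throughSubgroup (A.act c.out) h1
  rw [CategoryTheory.Functor.map_id] at h3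
  refine throughSubgroup_trans (fun _ => ?_) h3
  obtain ⟨φ⟩ := hperm p.1 0 c.out
  have h4 := comp_mem_throughSubgroup (E p.1) φ.hom φ.inv
  rwa [Iso.hom_inv_id] at h4

variable [Fintype G] [∀ i, Finite (J i)]

lemma id_inducedSum_mem_throughSubgroup
    (hperm : ∀ i (j : Fin (ℓ i)) (g : G), Nonempty ((A.act g).obj (E i j) ≅ E i (g • j))) :
    𝟙 (biproduct (inducedMember L V)).obj ∈ throughSubgroup
      (fun q : Σ i, Fin (ℓ i) => E q.1 q.2) (biproduct (inducedMember L V)).obj := by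
  have h1 : 𝟙 (biproduct (inducedMember L V)) ∈ throughSubgroup (inducedMember L V)
      (biproduct (inducedMember L V)) :=
    id_mem_throughSubgroup_of_iso (Iso.refl _)
  have h2 := map_mem_throughSubgroup (EquivObj.forget A) h1
  rw [CategoryTheory.Functor.map_id] at h2
  refine throughSubgroup_trans (fun p => ?_) h2
  refine throughSubgroup_trans (fun j => ?_) (id_inducedMember_mem_throughSubgroup L V hperm p)
  have h3 := comp_mem_throughSubgroup (fun q : Σ i, Fin (ℓ i) => E q.1 q.2)
    (i := ⟨p.1, j⟩) (𝟙 (E p.1 j)) (𝟙 (E p.1 j))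
  rwa [Category.comp_id] at h3

lemma id_mem_throughSubgroup_biproduct {ι : Type*} [Finite ι] (X : ι → C) (i : ι) :
    𝟙 (X i) ∈ throughSubgroup (fun _ : Unit => biproduct X) (X i) := by
  have h := comp_mem_throughSubgroup (fun _ : Unit => biproduct X) (i := ())
    (biproduct.ι X i) (biproduct.π X i)
  rwa [biproduct.ι_π_self] at h

/-- The inclusion of a copy of the first member of a block into the sum of the induced
sequence. -/
def firstIn (i : Fin n)
    (s : Σ j : J i, Fin (Module.finrank k (V i j)) × Fin (Module.finrank k (V i j))) :
    E i 0 ⟶ (biproduct (inducedMember L V)).obj :=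
  (tensorIn (V i s.1) (firstMember L i) s.2.1 ≫
    indι (tensor (V i s.1) (firstMember L i))) ≫ (biproduct.ι (inducedMember L V) ⟨i, s.1⟩).1

/-- The projection of the sum of the induced sequence to a copy of the first member of a
block. -/
def firstOut (i : Fin n)
    (s : Σ j : J i, Fin (Module.finrank k (V i j)) × Fin (Module.finrank k (V i j))) :
    (biproduct (inducedMember L V)).obj ⟶ E i 0 :=
  (biproduct.π (inducedMember L V) ⟨i, s.1⟩).1 ≫
    indπ (tensor (V i s.1) (firstMember L i)) ≫ tensorOut (V i s.1) (firstMember L i) s.2.2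

lemma ι_lin_π (p : Σ i, J i) (g : G) :
    (biproduct.ι (inducedMember L V) p).1 ≫ ((biproduct (inducedMember L V)).lin.iso g).hom ≫
      (A.act g).map (biproduct.π (inducedMember L V) p).1 =
      ((inducedMember L V p).lin.iso g).hom := by
  have h1 := (Linearisation.mem_invariants_iff _ _ _).1 (biproduct.π (inducedMember L V) p).2 g
  have h2 : (biproduct.ι (inducedMember L V) p).1 ≫ (biproduct.π (inducedMember L V) p).1 =
      𝟙 (inducedMember L V p).obj :=
    congrArg Subtype.val (biproduct.ι_π_self (inducedMember L V) p)
  rw [h1, reassoc_of% h2]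

/-- The index s selects a representation together with two copies of the first member, one for the
inclusion and one for the projection. The compression of the linearisation of 𝔽 between them is a
matrix coefficient times λ_g, which reduces the trace condition to a statement about functions on
the stabiliser. -/
lemma firstIn_lin_firstOut (i : Fin n)
    (s : Σ j : J i, Fin (Module.finrank k (V i j)) × Fin (Module.finrank k (V i j)))
    (g : MulAction.stabilizer G (0 : Fin (ℓ i))) :
    firstIn L V i s ≫ ((biproduct (inducedMember L V)).lin.iso (g : G)).hom ≫
      (A.act (g : G)).map (firstOut L V i s) =
      repMatrix (V i s.1) g s.2.2 s.2.1 • (linIso (firstMember L i) g).hom := by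
  have h1 := ι_lin_π L V ⟨i, s.1⟩ (g : G)
  have h2 := indι_lin_indπ (tensor (V i s.1) (firstMember L i)) g
  have h3 : tensorIn (V i s.1) (firstMember L i) s.2.1 ≫
      (linIso (tensor (V i s.1) (firstMember L i)) g).hom ≫
      (A.act (g : G)).map (tensorOut (V i s.1) (firstMember L i) s.2.2) =
      repMatrix (V i s.1) g s.2.2 s.2.1 • (linIso (firstMember L i) g).hom :=
    tensorIn_lin_tensorOut (V i s.1) (firstMember L i) g s.2.1 s.2.2
  rw [firstIn, firstOut, Functor.map_comp, Functor.map_comp, Category.assoc, reassoc_of% h1,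
    Category.assoc, reassoc_of% h2]
  exact h3

lemma firstIn_lin_firstOut_of_notMem (i : Fin n)
    (s : Σ j : J i, Fin (Module.finrank k (V i j)) × Fin (Module.finrank k (V i j)))
    {g : G} (hg : g ∉ MulAction.stabilizer G (0 : Fin (ℓ i))) :
    firstIn L V i s ≫ ((biproduct (inducedMember L V)).lin.iso g).hom ≫
      (A.act g).map (firstOut L V i s) = 0 := by
  have h1 := ι_lin_π L V ⟨i, s.1⟩ g
  have h2 := indι_lin_indπ_of_notMem (tensor (V i s.1) (firstMember L i)) hg
  rw [firstIn, firstOut, Functor.map_comp, Functor.map_comp, Category.assoc, reassoc_of% h1,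
    Category.assoc, reassoc_of% h2, zero_comp, comp_zero]

lemma firstIn_firstOut (i : Fin n)
    (s : Σ j : J i, Fin (Module.finrank k (V i j)) × Fin (Module.finrank k (V i j))) :
    firstIn L V i s ≫ firstOut L V i s =
      repMatrix (V i s.1) (1 : MulAction.stabilizer G (0 : Fin (ℓ i))) s.2.2 s.2.1 • 𝟙 (E i 0) := by
  have h1 : (biproduct.ι (inducedMember L V) ⟨i, s.1⟩).1 ≫
      (biproduct.π (inducedMember L V) ⟨i, s.1⟩).1 = 𝟙 (inducedMember L V ⟨i, s.1⟩).obj :=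
    congrArg Subtype.val (biproduct.ι_π_self (inducedMember L V) ⟨i, s.1⟩)
  have h2 := indι_indπ (tensor (V i s.1) (firstMember L i))
  rw [firstIn, firstOut, Category.assoc, reassoc_of% h1, Category.assoc, reassoc_of% h2]
  refine (tensorIn_tensorOut (V i s.1) (firstMember L i) s.2.1 s.2.2).trans ?_
  congr 1
  unfold repMatrix
  rw [MulOpposite.op_one, map_one, LinearMap.toMatrix_one, Matrix.one_apply]
  simp only [eq_comm]

/-- The idempotent of the first member of each block lies in the ideal by the matrix coefficients,
the idempotents of the other members follow by conjugation, and the identity is the sum of all of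
them. -/
lemma id_mem_unitTrace [∀ i, MulAction.IsPretransitive G (Fin (ℓ i))]
    (hG : (Fintype.card G : k) ≠ 0) (hV : ∀ i, IsIrrSystem (V i))
    (hperm : ∀ i (j : Fin (ℓ i)) (g : G), Nonempty ((A.act g).obj (E i j) ≅ E i (g • j)))
    (Λ : A.Linearisation (biproduct fun p : Σ i, Fin (ℓ i) => E p.1 p.2)) :
    𝟙 (biproduct fun p : Σ i, Fin (ℓ i) => E p.1 p.2) ∈
      PlainHom.unitTrace (biproduct (inducedMember L V)) ⟨_, Λ⟩ := by
  let X : (Σ i, Fin (ℓ i)) → C := fun p => E p.1 p.2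
  have hfirst : ∀ i, biproduct.π X ⟨i, 0⟩ ≫ biproduct.ι X ⟨i, 0⟩ ∈
      PlainHom.unitTrace (biproduct (inducedMember L V)) ⟨_, Λ⟩ := by
    intro i
    -- The order of a subgroup divides |G|, so it is invertible in k as well.
    have hH : (Nat.card (MulAction.stabilizer G (0 : Fin (ℓ i))) : k) ≠ 0 := by
      intro h0
      obtain ⟨m, hm⟩ := Subgroup.card_subgroup_dvd_card (MulAction.stabilizer G (0 : Fin (ℓ i)))
      apply hG
      rw [← Nat.card_eq_fintype_card, hm, Nat.cast_mul, h0, zero_mul]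
    let _ : Fintype (J i) := Fintype.ofFinite _
    obtain ⟨t, ht1, ht0⟩ := exists_matrixCoefficients hH (hV i)
    refine PlainHom.mem_unitTrace_of_sum (E := ⟨_, Λ⟩) (biproduct.ι X ⟨i, 0⟩)
      (biproduct.π X ⟨i, 0⟩) t (firstIn L V i) (firstOut L V i) ?_ ?_
    · simp only [firstIn_firstOut, smul_smul]
      rw [← Finset.sum_smul, ht1, one_smul]
    · intro g hg
      by_cases hgm : g ∈ MulAction.stabilizer G (0 : Fin (ℓ i))
      · have h1 := fun s => firstIn_lin_firstOut L V i s ⟨g, hgm⟩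
        have h2 := ht0 ⟨g, hgm⟩ (fun h => hg (congrArg Subtype.val h))
        have h3 := congrArg (· • (linIso (firstMember L i) ⟨g, hgm⟩).hom) h2
        -- For g ≠ 1 in the stabiliser, λ_g is a common factor and its coefficient is the delta
        -- function at g, which is zero.
        simp only [Finset.sum_smul, zero_smul, mul_smul, ← h1] at h3
        exact h3
      · simp only [firstIn_lin_firstOut_of_notMem L V i _ hgm, smul_zero, Finset.sum_const_zero]
  have hall : ∀ p, biproduct.π X p ≫ biproduct.ι X p ∈
      PlainHom.unitTrace (biproduct (inducedMember L V)) ⟨_, Λ⟩ := by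
    rintro ⟨i, j⟩
    obtain ⟨g, rfl⟩ := MulAction.exists_smul_eq G (0 : Fin (ℓ i)) j
    obtain ⟨φ⟩ := hperm i 0 g
    -- Conjugation by g turns the idempotent of the first member into one whose image is its
    -- translate by g. The two outer factors identify this image with the member g • 0 by means of
    -- φ, so that the product is the idempotent of that member.
    have h1 := PlainHom.conj_mem_unitTrace (hfirst i) g
      (biproduct.π X ⟨i, g • 0⟩ ≫ φ.inv ≫ (A.act g).map (biproduct.ι X ⟨i, 0⟩) ≫ (Λ.iso g).inv)
      ((Λ.iso g).hom ≫ (A.act g).map (biproduct.π X ⟨i, 0⟩) ≫ φ.hom ≫ biproduct.ι X ⟨i, g • 0⟩)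
    have h2 : (A.act g).map (biproduct.ι X ⟨i, 0⟩) ≫ (A.act g).map (biproduct.π X ⟨i, 0⟩) =
        𝟙 ((A.act g).obj (E i 0)) := by
      rw [← Functor.map_comp, biproduct.ι_π_self, CategoryTheory.Functor.map_id]
    have h3 : ∀ a : biproduct X ⟶ biproduct X, EquivObj.conj (X := ⟨_, Λ⟩) (Y := ⟨_, Λ⟩) g a =
      (Λ.iso g).hom ≫ (A.act g).map a ≫ (Λ.iso g).inv := fun _ => rfl
    rw [h3] at h1
    simp only [Functor.map_comp, Category.assoc, Iso.inv_hom_id_assoc] at h1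
    rw [reassoc_of% h2, reassoc_of% h2, Category.id_comp, Category.id_comp,
      Iso.inv_hom_id_assoc] at h1
    exact h1
  rw [← biproduct_total]
  exact sum_mem fun p _ => hall p

end InducedSequence

end CatAction

namespace CatAction

variable {k : Type u} [Field k] {G : Type uG} [Group G]
  {C : Type uD} [Category.{v} C] [Preadditive C] [Linear k C] {A : CatAction k G C}

lemma PlainHom.isMoritaEquivalent [Fintype G] {F E : A.EquivObj}
    (h : (1 : End F) ∈ (moritaContext F E).trace)
    (h' : (1 : SkewGroupAlgebra E.lin.endAction) ∈ (moritaContext F E).symm.trace) :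
    IsMoritaEquivalent k (SkewGroupAlgebra E.lin.endAction)ᵐᵒᵖ (End F)ᵐᵒᵖ :=
  isMoritaEquivalent_of_moritaContext (moritaContext F E) h h'

/-! ### Basicness of End(𝔽) and its Morita equivalence with the skew group algebra -/

section InducedSequence

variable [HasFiniteBiproducts C] {n : ℕ} {ℓ : Fin n → ℕ} [∀ i, NeZero (ℓ i)]
  {E : ∀ i, Fin (ℓ i) → C} [∀ i, MulAction G (Fin (ℓ i))]
  (L : ∀ i, (A.restrict (MulAction.stabilizer G (0 : Fin (ℓ i)))).Linearisation (E i 0))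
  {J : Fin n → Type uJ} (V : ∀ i, J i → FDRep k (MulAction.stabilizer G (0 : Fin (ℓ i)))ᵐᵒᵖ)

/-- Induced objects from different blocks are not isomorphic. -/
lemma inducedMember_fst_eq_of_iso [Finite G] (hV : ∀ i, IsIrrSystem (V i))
    (hendo : ∀ i, Function.Bijective fun c : k => c • 𝟙 (E i 0))
    (hperm : ∀ i (j : Fin (ℓ i)) (g : G), Nonempty ((A.act g).obj (E i j) ≅ E i (g • j)))
    (hblocks : ∀ i i' : Fin n, i' < i → ∀ j j' (f : E i j ⟶ E i' j'), f = 0)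
    {p q : Σ i, J i} (e : inducedMember L V p ≅ inducedMember L V q) : p.1 = q.1 := by
  have hle : ∀ {p q : Σ i, J i} (_ : inducedMember L V p ≅ inducedMember L V q),
      ¬ q.1 < p.1 := by
    intro p q e hlt
    have := (hV p.1).irreducible p.2
    apply id_induction_tensor_ne_zero (V := V p.1 p.2) (X := firstMember L p.1) (hendo p.1)
    -- Both induced objects are generated by the members of their blocks, and there are no nonzero
    -- morphisms from a later block to an earlier one. So the isomorphism would be zero, although
    -- its source is not.
    have h0 : e.hom = 0 := Subtype.ext
      (eq_zero_of_throughSubgroup (id_inducedMember_mem_throughSubgroup L V hperm p)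
        (id_inducedMember_mem_throughSubgroup L V hperm q) (hblocks _ _ hlt) e.hom.1)
    rw [← e.hom_inv_id, h0, zero_comp]
  exact le_antisymm (not_lt.1 (hle e)) (not_lt.1 (hle e.symm))

variable [Fintype G] [∀ i, Finite (J i)]

/-- The endomorphism algebra of the sum of the induced sequence is basic. -/
lemma isBasicAlgebra_end_inducedSum [∀ i, MulAction.IsPretransitive G (Fin (ℓ i))]
    (hV : ∀ i, IsIrrSystem (V i))
    (hendo : ∀ i, Function.Bijective fun c : k => c • 𝟙 (E i 0))
    (hperm : ∀ i (j : Fin (ℓ i)) (g : G), Nonempty ((A.act g).obj (E i j) ≅ E i (g • j)))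
    (hsemi : ∀ i (j j' : Fin (ℓ i)), j' < j → ∀ f : E i j ⟶ E i j', f = 0)
    (hblocks : ∀ i i' : Fin n, i' < i → ∀ j j' (f : E i j ⟶ E i' j'), f = 0)
    (hfin : ∀ p q : Σ i, Fin (ℓ i), FiniteDimensional k (E p.1 p.2 ⟶ E q.1 q.2)) :
    IsBasicAlgebra k (End (biproduct (inducedMember L V))) := by
  have horth : ∀ i, TranslatesOrthogonal (firstMember L i) (firstMember L i) :=
    firstMember_translatesOrthogonal L hperm fun i _ _ => block_orthogonal hperm hsemi i
  have hF := id_inducedSum_mem_throughSubgroup L V hperm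
  have hfd : FiniteDimensional k
      ((biproduct (inducedMember L V)).obj ⟶ (biproduct (inducedMember L V)).obj) :=
    finiteDimensional_precomp k hF _ fun p => finiteDimensional_postcomp k hF _ (hfin p)
  have hfd' : FiniteDimensional k (End (biproduct (inducedMember L V))) :=
    inferInstanceAs (FiniteDimensional k ((biproduct (inducedMember L V)).lin.invariants
      (biproduct (inducedMember L V)).lin))
  refine isBasicAlgebra_end_biproduct _ (fun p => ?_) (fun p f hf => ?_) fun p q hpq => ?_
  · have := (hV p.1).irreducible p.2
    exact id_induction_tensor_ne_zero (hendo p.1)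
  · have := (hV p.1).irreducible p.2
    exact induction_tensor_idempotent (hendo p.1) (horth p.1) f hf
  · obtain ⟨e⟩ := hpq
    have h1 := inducedMember_fst_eq_of_iso L V hV hendo hperm hblocks e
    obtain ⟨i, a⟩ := p
    obtain ⟨i', b⟩ := q
    obtain rfl : i = i' := h1
    rw [(hV i).nonisomorphic a b (nonempty_iso_of_induction_tensor (hendo i) (horth i) e)]

/-- The endomorphism algebra of the sum of the induced sequence is Morita equivalent to the skew
group algebra of the original sequence. -/
lemma isMoritaEquivalent_end_inducedSum [∀ i, MulAction.IsPretransitive G (Fin (ℓ i))]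
    (hG : (Fintype.card G : k) ≠ 0) (hV : ∀ i, IsIrrSystem (V i))
    (hperm : ∀ i (j : Fin (ℓ i)) (g : G), Nonempty ((A.act g).obj (E i j) ≅ E i (g • j)))
    (Λ : A.Linearisation (biproduct fun p : Σ i, Fin (ℓ i) => E p.1 p.2)) :
    IsMoritaEquivalent k (SkewGroupAlgebra Λ.endAction)ᵐᵒᵖ
      (End (biproduct (inducedMember L V)))ᵐᵒᵖ :=
  PlainHom.isMoritaEquivalent (E := ⟨_, Λ⟩)
    (PlainHom.one_mem_trace hG (throughSubgroup_trans
      (fun p => id_mem_throughSubgroup_biproduct (fun p : Σ i, Fin (ℓ i) => E p.1 p.2) p)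
      (id_inducedSum_mem_throughSubgroup L V hperm)))
    (PlainHom.one_mem_symm_trace (id_mem_unitTrace L V hG hV hperm Λ))

end InducedSequence

end CatAction

/-! ### Morphisms of degree zero -/

section DegreeZero

variable {D : Type uD} [Category.{v} D] [Preadditive D] [HasShift D ℤ] {X Y : D}

lemma GradedHomVanishes.eq_zero (h : GradedHomVanishes X Y) (f : X ⟶ Y) : f = 0 := by
  rw [← cancel_mono ((shiftFunctorZero D ℤ).inv.app Y), zero_comp]
  exact h 0 _

/-- Hom(X, Y) embeds as the summand of degree zero, through the identification of Y[0] with Y. -/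
lemma CompactsHomFinite.finiteDimensional {k : Type u} [Field k] [Linear k D]
    (hfin : CompactsHomFinite.{w} k D) (hX : IsCompactObject.{w} X) (hY : IsCompactObject.{w} Y) :
    FiniteDimensional k (X ⟶ Y) := by
  have := hfin X Y hX hY
  let s : (X ⟶ Y) →ₗ[k] (X ⟶ (shiftFunctor D (0 : ℤ)).obj Y) :=
    Linear.rightComp k X ((shiftFunctorZero D ℤ).inv.app Y)
  refine FiniteDimensional.of_injective
    (DirectSum.lof k ℤ (fun n => X ⟶ (shiftFunctor D n).obj Y) 0 ∘ₗ s) ?_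
  refine (DirectSum.of_injective (β := fun n : ℤ => X ⟶ (shiftFunctor D n).obj Y) 0).comp ?_
  intro f f' h
  exact (cancel_mono ((shiftFunctorZero D ℤ).inv.app Y)).1 h

end DegreeZero

end EquivariantEC

end

/-! ### The main theorem -/

open EquivariantEC in
theorem theorem3p6
    -- a finite group whose order is invertible in the field `k`
    {k : Type u} [Field k] {G : Type uG} [Group G] [Fintype G] (hG : (Fintype.card G : k) ≠ 0)
    -- a cocomplete `k`-linear triangulated category whose compact objects are Hom-finite
    {D : Type uD} [Category.{v} D] [Preadditive D] [Linear k D] [HasZeroObject D] [HasShift D ℤ]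
    [∀ n : ℤ, (shiftFunctor D n).Additive] [∀ n : ℤ, (shiftFunctor D n).Linear k]
    [Pretriangulated D] [IsTriangulated D] [HasCoproducts.{w} D]
    (hfin : CompactsHomFinite.{w} k D)
    -- a `k`-linear action of `G`
    (A : CatAction k G D)
    -- a full strong exceptional sequence in `n` non-empty blocks of lengths `ℓ i`
    {n : ℕ} (ℓ : Fin n → ℕ) [∀ i, NeZero (ℓ i)] (E : ∀ i, Fin (ℓ i) → D)
    (hE : IsExceptionalSequence.{w} k fun p : Σₗ i, Fin (ℓ i) => E (ofLex p).1 (ofLex p).2)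
    (hstrong : IsStrongSequence fun p : Σₗ i, Fin (ℓ i) => E (ofLex p).1 (ofLex p).2)
    (hfull : IsFullSequence.{w} fun p : Σ i, Fin (ℓ i) => E p.1 p.2)
    -- the blocks are permuted transitively
    [∀ i, MulAction G (Fin (ℓ i))] [∀ i, MulAction.IsPretransitive G (Fin (ℓ i))]
    (hperm : ∀ i (j : Fin (ℓ i)) (g : G), Nonempty ((A.act g).obj (E i j) ≅ E i (g • j)))
    -- linearisations of the first members over their stabilisers
    (L : ∀ i, (A.restrict (MulAction.stabilizer G (0 : Fin (ℓ i)))).Linearisation (E i 0))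
    -- the irreducible representations of the stabilisers
    {J : Fin n → Type uJ} [∀ i, Finite (J i)]
    (V : ∀ i, J i → FDRep k (MulAction.stabilizer G (0 : Fin (ℓ i)))ᵐᵒᵖ)
    (hV : ∀ i, IsIrrSystem (V i))
    -- `𝔼` and `𝔽` are the direct sums of the original and of the induced sequence
    (𝔼 : D) (h𝔼 : 𝔼 = biproduct fun p : Σ i, Fin (ℓ i) => E p.1 p.2)
    (𝔽 : A.EquivObj)
    (h𝔽 : 𝔽 = biproduct fun p : Σ i, J i =>
      CatAction.induction (CatAction.tensor (V p.1 p.2) ⟨E p.1 0, L p.1⟩)) :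
    -- `𝔼` is `G`-linearisable, and for any linearisation `End(𝔽)` is the basic reduction of
    -- the skew group algebra `G ⋉ End(𝔼)`, unique up to isomorphism
    Nonempty (A.Linearisation 𝔼) ∧
      ∀ Λ : A.Linearisation 𝔼,
        IsBasicReduction k (SkewGroupAlgebra Λ.endAction) (End 𝔽) ∧
        ∀ (B : Type v) [Ring B] [Algebra k B],
          IsBasicReduction k (SkewGroupAlgebra Λ.endAction) B → Nonempty (End 𝔽 ≃ₐ[k] B) := by

  -- The sequence is ordered lexicographically: semiorthogonality in degree zero is extracted once
  -- for two members of the same block and once for members of different blocks.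
  have hsemi : ∀ i (j j' : Fin (ℓ i)), j' < j → ∀ f : E i j ⟶ E i j', f = 0 :=
    fun i j j' h => (hE.semiorthogonal (toLex ⟨i, j⟩) (toLex ⟨i, j'⟩)
      (Sigma.Lex.right _ _ h)).eq_zero
  have hblocks : ∀ i i' : Fin n, i' < i → ∀ j j' (f : E i j ⟶ E i' j'), f = 0 :=
    fun i i' h j j' => (hE.semiorthogonal (toLex ⟨i, j⟩) (toLex ⟨i', j'⟩)
      (Sigma.Lex.left _ _ h)).eq_zero
  have hhom : ∀ p q : Σ i, Fin (ℓ i), FiniteDimensional k (E p.1 p.2 ⟶ E q.1 q.2) :=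
    fun p q => hfin.finiteDimensional (hE.exceptional (toLex p)).compact
      (hE.exceptional (toLex q)).compact
  subst h𝔼 h𝔽
  refine ⟨CatAction.nonempty_linearisation L hperm, fun Λ => ?_⟩
  have hred : IsBasicReduction k (SkewGroupAlgebra Λ.endAction)
      (End (biproduct (CatAction.inducedMember L V))) :=
    ⟨CatAction.isBasicAlgebra_end_inducedSum L V hV
      (fun i => (hE.exceptional (toLex ⟨i, 0⟩)).endo) hperm hsemi hblocks hhom,
      CatAction.isMoritaEquivalent_end_inducedSum L V hG hV hperm Λ⟩
  exact ⟨hred, fun B _ _ hB => hred.nonempty_algEquiv hB⟩
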